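/- Let $n$ be a natural number and let $r>0$, $\delta>0$, $\Lambda$, $K$ be real numbers. There is a constant $C$, depending only on $n, r, \Lambda, \delta, K$, with the following property. Let $(M^n,g)$ be a Riemannian manifold given by global coordinates, i.e. $M=V$ is an open subset of $\mathbb R^n$ with a $C^4$ metric $g=g_{ij}(y)\,dy^i dy^j$, and let $X:(M,g)\to\mathbb R^{n+1}$ be an isometric immersion of class $C^4$. Suppose that 1. $\|g\|_{C^4}\le\Lambda$ in these coordinates, in the sense that all $g_{ij}$ and their derivatives of order at most $4$ are bounded by $\Lambda$ on $V$, and $|v|^2\le\Lambda\, g_{ij}(y)v^iv^j$ for all $y\in V$, $v\in\mathbb R^n$; 2. the (intrinsic) scalar curvature of $g$ satisfies $R_g\ge\delta$ on $M$; 3. the hypersurface is a $C^1$ graph over a ball $B_r=B_r(x_0)\subset\mathbb R^n$: there is $u\in C^1(B_r)$ with $|u|\le K$ and $|\nabla u|\le K$ on $B_r$, such that $X$ maps $M$ bijectively onto $\{(x,u(x)):x\in B_r\}$. Then every principal curvature $\kappa_i$ of the hypersurface at every point $(x,u(x))$ with $|x-x_0|\le r/2$ satisfies $|\kappa_i|\le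 C$. (When the coordinates are the graph coordinates $y=x$, one has $g_{ij}v^iv^j\ge|v|^2$ and, for $n\ge1$, $\sup|g_{11}|\ge1$, so that the last inequality in 1. follows from the bounds on the $g_{ij}$ and their derivatives.) -/

import Mathlib

namespace HeinzEstimate

/-- Euclidean space `ℝⁿ`. -/
abbrev Euc (n : ℕ) : Type := EuclideanSpace ℝ (Fin n)

/-- The `i`-th coordinate vector of `ℝⁿ`. -/
noncomputable def basisVec {n : ℕ} (i : Fin n) : Euc n := EuclideanSpace.single i 1

/-- The partial derivative `∂ᵢ f` at `y`. -/
noncomputable def pderiv {n : ℕ} (i : Fin n) (f : Euc n → ℝ) (y : Euc n) : ℝ :=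
  fderiv ℝ f y (basisVec i)

/-- The Christoffel symbol
`Γᵏᵢⱼ = ½ ∑ₗ gᵏˡ (∂ᵢ gⱼₗ + ∂ⱼ gᵢₗ - ∂ₗ gᵢⱼ)` of a metric in coordinates. -/
noncomputable def christoffel {n : ℕ} (g : Euc n → Matrix (Fin n) (Fin n) ℝ)
    (k i j : Fin n) (y : Euc n) : ℝ :=
  (1 / 2) * ∑ l, (g y)⁻¹ k l *
    (pderiv i (fun z => g z j l) y + pderiv j (fun z => g z i l) y
      - pderiv l (fun z => g z i j) y)

/-- The Ricci curvature
`Ricⱼₖ = ∑ᵢ (∂ᵢ Γⁱⱼₖ - ∂ₖ Γⁱᵢⱼ) + ∑ᵢₚ (Γⁱᵢₚ Γᵖⱼₖ - Γⁱₖₚ Γᵖᵢⱼ)`. -/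
noncomputable def ricci {n : ℕ} (g : Euc n → Matrix (Fin n) (Fin n) ℝ)
    (j k : Fin n) (y : Euc n) : ℝ :=
  (∑ i, (pderiv i (christoffel g i j k) y - pderiv k (christoffel g i i j) y)) +
    ∑ i, ∑ p, (christoffel g i i p y * christoffel g p j k y
      - christoffel g i k p y * christoffel g p i j y)

/-- The scalar curvature `R_g = ∑ⱼₖ gʲᵏ Ricⱼₖ`, computed from the metric alone.
It is normalized so that the unit `n`-sphere has `R_g = n (n - 1)`. -/
noncomputable def scalarCurvature {n : ℕ} (g : Euc n → Matrix (Fin n) (Fin n) ℝ)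
    (y : Euc n) : ℝ :=
  ∑ j, ∑ k, (g y)⁻¹ j k * ricci g j k y

/-- `g` is a Riemannian metric on `V ⊆ ℝⁿ` whose components are of class `C⁴` and whose
`C⁴` norm is at most `Λ`: the components and their derivatives of order at most four are bounded
by `Λ`, and `g` is bounded below by `Λ⁻¹` times the Euclidean metric of the coordinates. -/
structure MetricC4Bound {n : ℕ} (V : Set (Euc n)) (g : Euc n → Matrix (Fin n) (Fin n) ℝ)
    (Λ : ℝ) : Prop where
  posDef : ∀ y ∈ V, (g y).PosDef
  contDiffOn : ∀ i j, ContDiffOn ℝ 4 (fun y => g y i j) V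
  norm_le : ∀ y ∈ V, ∀ i j, ∀ m ≤ 4, ‖iteratedFDeriv ℝ m (fun z => g z i j) y‖ ≤ Λ
  lower : ∀ y ∈ V, ∀ v : Fin n → ℝ, ∑ i, v i ^ 2 ≤ Λ * ∑ i, ∑ j, g y i j * v i * v j

/-- `X` is an isometric immersion of class `C⁴` of `(V, g)` into `ℝⁿ⁺¹`. -/
structure IsIsometricImmersion {n : ℕ} (V : Set (Euc n))
    (g : Euc n → Matrix (Fin n) (Fin n) ℝ) (X : Euc n → Euc (n + 1)) : Prop where
  contDiffOn : ContDiffOn ℝ 4 X V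
  injective : ∀ y ∈ V, Function.Injective (fderiv ℝ X y)
  isometric : ∀ y ∈ V, ∀ i j,
    g y i j = inner ℝ (fderiv ℝ X y (basisVec i)) (fderiv ℝ X y (basisVec j))

/-- The point `(x, u x)` of `ℝⁿ⁺¹ = ℝⁿ × ℝ`. -/
noncomputable def graphPoint {n : ℕ} (u : Euc n → ℝ) (x : Euc n) : Euc (n + 1) :=
  WithLp.toLp 2 (Fin.snoc (α := fun _ => ℝ) (fun i => x i) (u x))

/-- `u` is of class `C¹` on `B` and `|u|` and `|∇u|` are at most `K` there. -/
structure C1Bound {n : ℕ} (B : Set (Euc n)) (u : Euc n → ℝ) (K : ℝ) : Prop where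
  contDiffOn : ContDiffOn ℝ 1 u B
  abs_le : ∀ x ∈ B, |u x| ≤ K
  grad_le : ∀ x ∈ B, ‖fderiv ℝ u x‖ ≤ K

/-- `κ` is a principal curvature of the immersed hypersurface `X` at the parameter `y`, with
respect to one of the two unit normals `ν`: for some tangent vector `v ≠ 0`, the second
fundamental form `II (v, w) = ⟨D²X (v, w), ν⟩` satisfies `II (v, ·) = κ g (v, ·)`. -/
def IsPrincipalCurvature {n : ℕ} (X : Euc n → Euc (n + 1)) (y : Euc n) (κ : ℝ) : Prop :=
  ∃ ν : Euc (n + 1), ‖ν‖ = 1 ∧ (∀ w, inner ℝ (fderiv ℝ X y w) ν = 0) ∧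
    ∃ v : Euc n, v ≠ 0 ∧ ∀ w : Euc n,
      inner ℝ (fderiv ℝ (fderiv ℝ X) y v w) ν
        = κ * inner ℝ (fderiv ℝ X y v) (fderiv ℝ X y w)

end HeinzEstimate

/-! ### Algebra of the eigenvalues and of the third-order terms -/

namespace HeinzEstimate

section ThirdOrder

variable {ι : Type*} [Fintype ι] [DecidableEq ι]

/-! At most one principal curvature can be large. By the Gauss equation κ_a κ_b (a ≠ b) is a
sectional curvature, hence bounded by the metric alone (`FramedPoint.unifBdd_curvature_mul`). If λ =
κ_{i₀} is large, the other curvatures are O(1/λ), and R_g ≥ δ forces s = ∑_{j≠i₀} κ_j to be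
comparable to 1/λ (`largeEigenvalue_of_gauss`). The linearized Gauss equation has coefficients F_c =
∑κ - κ_c, so F_{i₀} = s ~ 1/λ while F_j ~ λ for j ≠ i₀: elliptic, but degenerate in the direction
i₀.

The scalar curvature of a C⁴ metric has two bounded derivatives. Differentiating the Gauss equation
once bounds ∑ F_c U_{cca}; differentiating it twice in the direction i₀ yields the Jacobi inequality
∑ F_c (log λ)_{cc} ≥ ½ ∑ F_c (log λ)_c² - C (`jacobi_inequality`).

The maximum principle is applied to log log λ + 2 log ρ + A|∇u|²/2 + βS, with ρ = R² - |x - x₀|² and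
S = (x - x₀)·∇u - u. The gradient term contributes about A s λ² ≥ A d λ. The term βS contributes
only O(1) to the second-order condition, but it enters the first-order condition. If α_c and T_c
are, up to the factors -2 and κ_c, the derivatives of ρ and S, then ∑ α_c T_c = |x - x₀|²/w, where w
is the vertical component of the normal (`TangentGraph.cutoff_dichotomy`). So at a maximum either ρ
is bounded below, or ρ has a definite derivative transverse to i₀, where F_j is large, or T_{i₀} is
definite, and then criticality makes (log log λ)_{i₀} of size λ. In every case ρ log λ is bounded
(`cutoff_mul_log_le_of_max`).

These computations are made at a single point. There the hypersurface is written as a graph of U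
over its tangent plane in a principal frame (`exists_tangentGraph`), where the Gauss equation reads
R(1 + |∇U|²) = (tr P)² - tr P² with P = G⁻¹D²U, and only two-jets along coordinate lines are needed.
Globally the largest curvature need not be smooth, and u is only C¹. One therefore maximizes over
points and directions a continuous function built from the normal curvature
(`GraphImmersion.exists_globalTest_max`); near the maximum it is touched from below by the smooth
test function of the tangent graph (`TangentGraph.eventually_globalTest`). -/

theorem sum_sq_symm_ge (i₀ : ι) (τ : ι → ι → ℝ) (hτ : ∀ a b, τ a b = τ b a) :
    τ i₀ i₀ ^ 2 + 2 * ∑ j ∈ Finset.univ.erase i₀, τ i₀ j ^ 2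
      + ∑ j ∈ Finset.univ.erase i₀, τ j j ^ 2 ≤ ∑ a, ∑ b, τ a b ^ 2 := by
  have h1 : ∀ φ : ι → ℝ, ∑ a, φ a = φ i₀ + ∑ a ∈ Finset.univ.erase i₀, φ a := fun φ =>
    (Finset.add_sum_erase _ _ (Finset.mem_univ i₀)).symm
  rw [h1 (fun a => ∑ b, τ a b ^ 2), h1 (fun b => τ i₀ b ^ 2)]
  -- By symmetry the row of a ≠ i₀ contains τ i₀ a once more, so these entries are counted twice in
  -- total.
  have h2 : ∀ a ∈ Finset.univ.erase i₀, τ i₀ a ^ 2 + τ a a ^ 2 ≤ ∑ b, τ a b ^ 2 := by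
    intro a ha
    have hne : i₀ ≠ a := (Finset.ne_of_mem_erase ha).symm
    have := Finset.sum_le_sum_of_subset_of_nonneg (Finset.subset_univ ({i₀, a} : Finset ι))
      (f := fun b => τ a b ^ 2) (fun _ _ _ => sq_nonneg _)
    rw [Finset.sum_pair hne, hτ a i₀] at this
    exact this
  have h3 := Finset.sum_le_sum h2
  rw [Finset.sum_add_distrib] at h3
  linarith

theorem two_mul_mul_le_div (a b : ℝ) {S : ℝ} (hS : 0 < S) :
    2 * a * b ≤ S * a ^ 2 / 10 + 10 * (b ^ 2 / S) := by
  have h2 : S * (a - 10 * (b / S)) ^ 2 / 10 = S * a ^ 2 / 10 + 10 * (b ^ 2 / S) - 2 * a * b := by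
    field_simp; ring
  have : 0 ≤ S * (a - 10 * (b / S)) ^ 2 / 10 := by positivity
  linarith

set_option maxHeartbeats 1000000 in
/-- The elementary inequality behind the third-order estimate. -/
theorem third_order_scalar {D d : ℝ} (hD : 1 ≤ D) (hd : 0 < d) :
    ∃ lam₀ C : ℝ, 1 ≤ lam₀ ∧ 0 ≤ C ∧ ∀ lam s m t f₁ e σ : ℝ, lam₀ ≤ lam → d ≤ lam * s →
      |f₁| ≤ D → 0 ≤ σ → |e| ≤ D / lam * σ → |s| ≤ D / lam → lam * t = f₁ - s * m - e →
      3 / 2 * (s / lam * m ^ 2) - C ≤ σ ^ 2 - 2 * m * t - t ^ 2 := by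
  -- The threshold makes `lam` exceed both 10 D² and 10 D²/d. This gives S ≤ 1/100 and makes the
  -- error η²/S a small multiple of σ².
  refine ⟨10 * D ^ 2 * (1 + 1 / d) + 10, 100 * D ^ 2 * (1 + 1 / d), by
    have : 0 ≤ D ^ 2 * (1 + 1 / d) := by positivity
    linarith, by positivity, ?_⟩
  intro lam s m t f₁ e σ hl hs hf hσ he hsb ht
  have hd1 : 0 < 1 / d := by positivity
  have hDD : 1 ≤ D ^ 2 := by nlinarith
  have hbig : 10 * D ^ 2 ≤ lam ∧ 10 * D ^ 2 ≤ lam * d := by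
    constructor
    · nlinarith [mul_nonneg (sq_nonneg D) hd1.le]
    · have : 10 * D ^ 2 * (1 + 1 / d) * d ≤ lam * d := by
        apply mul_le_mul_of_nonneg_right _ hd.le; linarith
      have h2 : 10 * D ^ 2 * (1 + 1 / d) * d = 10 * D ^ 2 * d + 10 * D ^ 2 := by field_simp
      nlinarith [mul_nonneg (sq_nonneg D) hd.le]
  have hl0 : 0 < lam := by linarith [hbig.1]
  set S := s / lam with hS
  have hS0 : d / lam ^ 2 ≤ S := by
    rw [hS, div_le_div_iff₀ (by positivity) hl0]; nlinarith
  have hSpos : 0 < S := lt_of_lt_of_le (by positivity) hS0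
  have hSle : S ≤ D / lam ^ 2 := by
    rw [hS, div_le_div_iff₀ hl0 (by positivity)]
    have := (abs_le.1 hsb).2
    rw [le_div_iff₀ hl0] at this
    nlinarith
  set φ := f₁ / lam with hφ
  set η := e / lam with hη
  -- Up to φ and η, t equals -S m, so -2mt supplies 2 S m². The cross terms may use up to half of S
  -- m², leaving the factor 3/2.
  have ht' : t = φ - S * m - η := by
    rw [hφ, hη, hS]; field_simp; linarith
  have hφ2 : φ ^ 2 ≤ D ^ 2 / lam ^ 2 := by
    rw [hφ, div_pow]
    exact div_le_div_of_nonneg_right (sq_le_sq' (abs_le.1 hf).1 (abs_le.1 hf).2) (by positivity)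
  have hη2 : η ^ 2 ≤ D ^ 2 / lam ^ 4 * σ ^ 2 := by
    have h1 : e ^ 2 ≤ (D / lam * σ) ^ 2 := sq_le_sq' (by linarith [(abs_le.1 he).1]) (abs_le.1 he).2
    rw [hη, div_pow, div_le_iff₀ (by positivity)]
    calc e ^ 2 ≤ (D / lam * σ) ^ 2 := h1
      _ = _ := by field_simp
  clear_value S φ η
  -- Here the positive lower bound on the scalar curvature is used: φ is O(1/lam), and S is at least
  -- d/lam².
  have hq1 : φ ^ 2 / S ≤ D ^ 2 / d := by
    rw [div_le_iff₀ hSpos]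
    calc φ ^ 2 ≤ D ^ 2 / lam ^ 2 := hφ2
      _ = D ^ 2 / d * (d / lam ^ 2) := by field_simp
      _ ≤ D ^ 2 / d * S := by gcongr
  have hq2 : η ^ 2 / S ≤ 1 / 10 * σ ^ 2 * (1 / 10) := by
    rw [div_le_iff₀ hSpos]
    have : D ^ 2 / lam ^ 4 ≤ 1 / 100 * S := by
      have h1 : D ^ 2 / lam ^ 4 ≤ 1 / 100 * (d / lam ^ 2) := by
        rw [div_le_iff₀ (by positivity)]
        have h2 : 1 / 100 * (d / lam ^ 2) * lam ^ 4 = 1 / 100 * (lam * d) * lam := by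
          field_simp
        rw [h2]
        nlinarith [hbig.1, hbig.2, mul_le_mul hbig.2 hbig.1 (by positivity) (by positivity)]
      linarith
    nlinarith [mul_le_mul_of_nonneg_right this (sq_nonneg σ)]
  have hS1 : S ≤ 1 / 100 := by
    refine hSle.trans ?_
    rw [div_le_iff₀ (by positivity)]
    nlinarith [hbig.1]
  have hφ3 : φ ^ 2 ≤ D ^ 2 := by
    refine hφ2.trans (div_le_self (by positivity) ?_)
    nlinarith [hbig.1]
  have hη3 : η ^ 2 ≤ 1 / 10 * σ ^ 2 := by
    have h0 : η ^ 2 = η ^ 2 / S * S := by field_simp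
    have h1 := mul_le_mul hq2 hS1 hSpos.le (by positivity)
    linarith [sq_nonneg σ]
  have hc1 := two_mul_mul_le_div m φ hSpos
  have hc2 := two_mul_mul_le_div (-m) η hSpos
  have hc3 : t ^ 2 ≤ 3 * φ ^ 2 + 3 * S * (S * m ^ 2) + 3 * η ^ 2 := by
    have h0 : 3 * φ ^ 2 + 3 * S * (S * m ^ 2) + 3 * η ^ 2 - t ^ 2
      = (φ + S * m) ^ 2 + (φ + η) ^ 2 + (S * m - η) ^ 2 := by rw [ht']; ring
    linarith [sq_nonneg (φ + S * m), sq_nonneg (φ + η), sq_nonneg (S * m - η)]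
  have hSm : S * (S * m ^ 2) ≤ 1 / 100 * (S * m ^ 2) := by
    apply mul_le_mul_of_nonneg_right hS1 (by positivity)
  have hSm0 : 0 ≤ S * m ^ 2 := by positivity
  have hkey : -2 * m * t = -(2 * m * φ) + 2 * (S * m ^ 2) + 2 * m * η := by rw [ht']; ring
  have hcon : 10 * (D ^ 2 / d) + 3 * D ^ 2 ≤ 100 * D ^ 2 * (1 + 1 / d) := by
    have h1 : 100 * D ^ 2 * (1 + 1 / d) = 100 * D ^ 2 + 100 * (D ^ 2 / d) := by ring
    have h2 : 0 ≤ D ^ 2 / d := by positivity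
    linarith
  rw [neg_sq] at hc2
  linarith [sq_nonneg σ]

/-- Structure of the eigenvalues when one of them is large. -/
structure LargeEigenvalue (i₀ : ι) (κ : ι → ℝ) (D d : ℝ) : Prop where
  pos : 1 ≤ κ i₀
  other : ∀ j, j ≠ i₀ → |κ j| ≤ D / κ i₀
  trace : |∑ a, κ a - κ i₀| ≤ D / κ i₀
  lower : d ≤ κ i₀ * (∑ a, κ a - κ i₀)
  coef : ∀ j, j ≠ i₀ → |∑ a, κ a - κ j - κ i₀| ≤ D / κ i₀

/-- With s = ∑κ - κ i₀, the products κ i₀ κ_j give s = O(1/κ i₀), and the curvature bound gives δ ≤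
2 κ i₀ s + s². Once κ i₀ is so large that s² ≤ δ/4, the product κ i₀ s is at least 3δ/8. -/
theorem largeEigenvalue_of_gauss (N : ℕ) {A δ : ℝ} (hδ : 0 < δ) (hA : 1 ≤ A) :
    ∃ lam₀ D : ℝ, 1 ≤ lam₀ ∧ 1 ≤ D ∧ (N : ℝ) ≤ D ∧ A ≤ D ∧
      ∀ (ι : Type) [Fintype ι] [DecidableEq ι] (i₀ : ι) (κ : ι → ℝ), Fintype.card ι = N →
        (∀ j, j ≠ i₀ → |κ i₀ * κ j| ≤ A) → δ ≤ (∑ a, κ a) ^ 2 - ∑ a, κ a ^ 2 → lam₀ ≤ κ i₀ →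
        LargeEigenvalue i₀ κ D (δ / 4) := by
  refine ⟨1 + 4 * (N + 1) ^ 2 * A ^ 2 / δ + 4 * (N + 1) ^ 2 * A ^ 2, (N + 2) * A, ?_, ?_, ?_, ?_, ?_⟩
  · have : (0 : ℝ) ≤ 4 * (N + 1) ^ 2 * A ^ 2 / δ := by positivity
    nlinarith [mul_nonneg (sq_nonneg ((N : ℝ) + 1)) (sq_nonneg A)]
  · have : (0 : ℝ) ≤ N := Nat.cast_nonneg _
    nlinarith
  · have : (0 : ℝ) ≤ N := Nat.cast_nonneg _
    nlinarith
  · have : (0 : ℝ) ≤ N := Nat.cast_nonneg _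
    nlinarith
  intro ι _ _ i₀ κ hN hoff hs hl
  have hN0 : (0 : ℝ) ≤ N := Nat.cast_nonneg _
  set lam := κ i₀ with hlam
  have hc1 : (0 : ℝ) ≤ 4 * (N + 1) ^ 2 * A ^ 2 / δ := by positivity
  have hc2 : (0 : ℝ) ≤ 4 * (N + 1) ^ 2 * A ^ 2 := by positivity
  have hl1 : 1 ≤ lam := by linarith
  have hl0 : 0 < lam := by linarith
  have hoth : ∀ j, j ≠ i₀ → |κ j| ≤ A / lam := by
    intro j hj
    rw [le_div_iff₀ hl0]
    have := hoff j hj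
    rw [abs_mul, abs_of_pos hl0] at this
    linarith
  have hsplit : ∀ φ : ι → ℝ, ∑ a, φ a = φ i₀ + ∑ a ∈ Finset.univ.erase i₀, φ a := fun φ =>
    (Finset.add_sum_erase _ _ (Finset.mem_univ i₀)).symm
  have hcard : ((Finset.univ.erase i₀).card : ℝ) ≤ N := by
    rw [← hN, ← Finset.card_univ]; exact_mod_cast Finset.card_erase_le
  have hAl : 0 ≤ A / lam := by positivity
  have htr : |∑ a, κ a - lam| ≤ N * (A / lam) := by
    rw [hsplit κ, ← hlam, add_sub_cancel_left]
    refine (Finset.abs_sum_le_sum_abs _ _).trans ?_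
    refine (Finset.sum_le_card_nsmul _ _ (A / lam) fun j hj => hoth j (Finset.ne_of_mem_erase hj)).trans ?_
    rw [nsmul_eq_mul]; gcongr
  have hD1 : N * (A / lam) + A / lam ≤ (N + 2) * A / lam := by
    have : (N + 2) * A / lam = N * (A / lam) + 2 * (A / lam) := by ring
    rw [this]; linarith
  refine ⟨hl1, fun j hj => (hoth j hj).trans ?_, htr.trans ?_, ?_, fun j hj => ?_⟩
  · have := mul_nonneg hN0 hAl; linarith
  · linarith
  · set s := ∑ a, κ a - lam with hsdef
    have e1 : (∑ a, κ a) = lam + s := by rw [hsdef]; ring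
    have e2 : lam ^ 2 ≤ ∑ a, κ a ^ 2 := by
      rw [hsplit]; have : 0 ≤ ∑ a ∈ Finset.univ.erase i₀, κ a ^ 2 := Finset.sum_nonneg fun _ _ => sq_nonneg _
      linarith
    have e3 : δ ≤ 2 * (lam * s) + s ^ 2 := by rw [e1] at hs; nlinarith
    have e4 : s ^ 2 ≤ (N * (A / lam)) ^ 2 := sq_le_sq' (by linarith [(abs_le.1 htr).1]) (abs_le.1 htr).2
    have e5 : (N * (A / lam)) ^ 2 ≤ δ / 4 := by
      have : (N * (A / lam)) ^ 2 = N ^ 2 * A ^ 2 / lam ^ 2 := by field_simp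
      rw [this, div_le_iff₀ (by positivity)]
      have h1 : 4 * (N + 1) ^ 2 * A ^ 2 ≤ lam * δ := by
        have : 4 * (N + 1) ^ 2 * A ^ 2 / δ ≤ lam := by linarith
        rwa [div_le_iff₀ hδ] at this
      have h2 : lam * δ ≤ lam ^ 2 * δ := by nlinarith
      have h3 : (N : ℝ) ^ 2 * A ^ 2 ≤ (N + 1) ^ 2 * A ^ 2 := by gcongr; linarith
      linarith
    linarith
  · have h1 := hoth j hj
    have : ∑ a, κ a - κ j - lam = (∑ a, κ a - lam) - κ j := by ring
    rw [← hlam, this]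
    exact (abs_sub _ _).trans (by linarith)

end ThirdOrder
end HeinzEstimate

/-! ### The Jacobi inequality for the logarithm of the largest curvature -/

namespace HeinzEstimate

theorem sum_eq_add_sum_erase {ι : Type*} [Fintype ι] [DecidableEq ι] (i₀ : ι) (φ : ι → ℝ) :
    ∑ a, φ a = φ i₀ + ∑ a ∈ Finset.univ.erase i₀, φ a :=
  (Finset.add_sum_erase _ _ (Finset.mem_univ i₀)).symm

theorem sum_erase_le_mul {ι : Type*} [Fintype ι] [DecidableEq ι] (i₀ : ι) (φ : ι → ℝ) {D c : ℝ}
    (hcard : (Fintype.card ι : ℝ) ≤ D) (hc : 0 ≤ c) (h : ∀ j, j ≠ i₀ → φ j ≤ c) :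
    ∑ j ∈ Finset.univ.erase i₀, φ j ≤ D * c := by
  refine (Finset.sum_le_card_nsmul _ _ c fun j hj => h j (Finset.ne_of_mem_erase hj)).trans ?_
  rw [nsmul_eq_mul]
  refine mul_le_mul_of_nonneg_right (le_trans ?_ hcard) hc
  exact_mod_cast Finset.card_erase_le

set_option maxHeartbeats 1000000 in
/-- Jacobi inequality for the logarithm of the largest eigenvalue. -/
theorem jacobi_inequality {D d : ℝ} (hD : 1 ≤ D) (hd : 0 < d) :
    ∃ lam₀ C : ℝ, 1 ≤ lam₀ ∧ 0 ≤ C ∧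
      ∀ (ι : Type) [Fintype ι] [DecidableEq ι] (i₀ : ι) (κ : ι → ℝ) (τ : ι → ι → ℝ) (q : ι → ℝ)
        (R f₁ f₂ : ℝ), (Fintype.card ι : ℝ) ≤ D → LargeEigenvalue i₀ κ D d → lam₀ ≤ κ i₀ →
        (∀ a b, τ a b = τ b a) → |f₁| ≤ D → |f₂| ≤ D →
        R = (∑ a, κ a) ^ 2 - ∑ a, κ a ^ 2 →
        f₁ = ∑ a, (∑ b, κ b - κ a) * τ a a →
        f₂ = (∑ a, τ a a) ^ 2 - ∑ a, ∑ b, τ a b ^ 2 + ∑ a, (∑ b, κ b - κ a) * q a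
          - R * κ i₀ ^ 2 - 2 * κ i₀ ^ 3 * (∑ b, κ b - κ i₀) →
        1 / 2 * ∑ c, (∑ b, κ b - κ c) * (τ i₀ c / κ i₀) ^ 2 - C ≤
          ∑ c, (∑ b, κ b - κ c) * ((q c - κ i₀ * κ c ^ 2 - if c = i₀ then 2 * κ i₀ ^ 3 else 0) / κ i₀
            - (τ i₀ c / κ i₀) ^ 2) := by
  -- D² instead of D: the error e collects one factor D from the coefficients and another from the
  -- Cauchy–Schwarz inequality over the indices.
  obtain ⟨l₁, C₁, hl₁, hC₁, H3⟩ := third_order_scalar (D := D ^ 2) (d := d) (by nlinarith) hd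
  refine ⟨max l₁ (3 * D), C₁ + D + 3 * D ^ 3, le_max_of_le_left hl₁, by positivity, ?_⟩
  have hDD : D ≤ D ^ 2 := by nlinarith
  intro ι _ _ i₀ κ τ q R f₁ f₂ hcard hL hlam hτ hf₁ hf₂ hR e₁ e₂
  set lam := κ i₀ with hlamdef
  set F : ι → ℝ := fun c => ∑ b, κ b - κ c with hF
  set s := ∑ b, κ b - lam with hs
  have hFs : F i₀ = s := rfl
  have hl1 : 1 ≤ lam := hL.pos
  have hl0 : 0 < lam := by linarith
  have hl3 : 3 * D ≤ lam := (le_max_right _ _).trans hlam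
  have hDl : D / lam ≤ lam / 3 := by
    rw [div_le_iff₀ hl0]
    calc D ≤ lam / 3 * 1 := by linarith
      _ ≤ lam / 3 * lam := by gcongr
  have hFj : ∀ j, j ≠ i₀ → F j ≤ 4 / 3 * lam := fun j hj => by
    have := (abs_le.1 (hL.coef j hj)).2
    simp only [hF]; linarith
  have hFj0 : ∀ j, j ≠ i₀ → 0 ≤ F j := fun j hj => by
    have := (abs_le.1 (hL.coef j hj)).1
    simp only [hF]; linarith
  have hκ2 : ∀ j, j ≠ i₀ → κ j ^ 2 ≤ D ^ 2 / lam ^ 2 := fun j hj => by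
    have := hL.other j hj
    rw [← div_pow]; exact sq_le_sq' (by linarith [(abs_le.1 this).1]) (abs_le.1 this).2
  have hQ1 : ∑ j ∈ Finset.univ.erase i₀, F j * κ j ^ 2 ≤ D * (2 * D ^ 2 / lam) := by
    refine sum_erase_le_mul i₀ _ hcard (by positivity) fun j hj => ?_
    calc F j * κ j ^ 2 ≤ (4 / 3 * lam) * (D ^ 2 / lam ^ 2) :=
          mul_le_mul (hFj j hj) (hκ2 j hj) (sq_nonneg _) (by positivity)
      _ = 4 / 3 * (D ^ 2 / lam) := by field_simp
      _ ≤ 2 * (D ^ 2 / lam) := by gcongr; norm_num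
      _ = _ := by ring
  have hQ2 : ∑ j ∈ Finset.univ.erase i₀, κ j ^ 2 ≤ D * (D ^ 2 / lam ^ 2) :=
    sum_erase_le_mul i₀ _ hcard (by positivity) hκ2
  set Q₁ := ∑ j ∈ Finset.univ.erase i₀, F j * κ j ^ 2
  set Q₂ := ∑ j ∈ Finset.univ.erase i₀, κ j ^ 2 with hQ₂
  have eF : ∑ c, F c * κ c ^ 2 = s * lam ^ 2 + Q₁ := sum_eq_add_sum_erase i₀ _
  have eK : ∑ c, κ c ^ 2 = lam ^ 2 + Q₂ := sum_eq_add_sum_erase i₀ _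
  have eR : R = 2 * (lam * s) + s ^ 2 - Q₂ := by
    have : ∑ b, κ b = lam + s := by rw [hs]; ring
    rw [hR, eK, this]; ring
  set m := τ i₀ i₀ with hm
  set t := ∑ j ∈ Finset.univ.erase i₀, τ j j with ht
  set σ := √(∑ j ∈ Finset.univ.erase i₀, τ j j ^ 2) with hσ
  set e := ∑ j ∈ Finset.univ.erase i₀, (s - κ j) * τ j j with he
  have hσ0 : 0 ≤ ∑ j ∈ Finset.univ.erase i₀, τ j j ^ 2 := Finset.sum_nonneg fun _ _ => sq_nonneg _
  have hσ2 : σ ^ 2 = ∑ j ∈ Finset.univ.erase i₀, τ j j ^ 2 := Real.sq_sqrt hσ0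
  have etr : ∑ a, τ a a = m + t := sum_eq_add_sum_erase i₀ _
  have hDl0 : 0 ≤ D / lam := by positivity
  have heb : |e| ≤ D ^ 2 / lam * σ := by
    have h1 : |e| ≤ ∑ j ∈ Finset.univ.erase i₀, D / lam * |τ j j| := by
      refine (Finset.abs_sum_le_sum_abs _ _).trans (Finset.sum_le_sum fun j hj => ?_)
      rw [abs_mul]
      refine mul_le_mul_of_nonneg_right ?_ (abs_nonneg _)
      have := hL.coef j (Finset.ne_of_mem_erase hj)
      have h2 : s - κ j = ∑ a, κ a - κ j - κ i₀ := by rw [hs]; ring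
      rw [h2]; exact this
    rw [← Finset.mul_sum] at h1
    have h2 : ∑ j ∈ Finset.univ.erase i₀, |τ j j| ≤ D * σ := by
      apply le_of_sq_le_sq _ (by positivity)
      have h3 := sq_sum_le_card_mul_sum_sq (s := Finset.univ.erase i₀) (f := fun j => |τ j j|)
      simp only [sq_abs] at h3
      rw [mul_pow, hσ2]
      refine h3.trans (mul_le_mul_of_nonneg_right ?_ hσ0)
      have : ((Finset.univ.erase i₀).card : ℝ) ≤ D :=
        le_trans (by exact_mod_cast Finset.card_erase_le) hcard
      exact this.trans hDD
    calc |e| ≤ D / lam * ∑ j ∈ Finset.univ.erase i₀, |τ j j| := h1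
      _ ≤ D / lam * (D * σ) := by gcongr
      _ = _ := by ring
  have hte : lam * t = f₁ - s * m - e := by
    have h1 : f₁ = s * m + ∑ j ∈ Finset.univ.erase i₀, F j * τ j j := by
      rw [e₁]; exact sum_eq_add_sum_erase i₀ (fun a => F a * τ a a)
    have h2 : ∑ j ∈ Finset.univ.erase i₀, F j * τ j j = lam * t + e := by
      rw [ht, he, Finset.mul_sum, ← Finset.sum_add_distrib]
      refine Finset.sum_congr rfl fun j _ => ?_
      simp only [hF, hs]; ring
    linarith
  have h3 := H3 lam s m t f₁ e σ ((le_max_left _ _).trans hlam) hL.lower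
    (hf₁.trans hDD) (Real.sqrt_nonneg _) heb
    (hL.trace.trans (by gcongr)) hte
  have h4 := sum_sq_symm_ge i₀ τ hτ
  rw [← hσ2] at h4
  set J := ∑ j ∈ Finset.univ.erase i₀, τ i₀ j ^ 2 with hJ
  have eV : ∑ c, F c * ((q c - lam * κ c ^ 2 - if c = i₀ then 2 * lam ^ 3 else 0) / lam
      - (τ i₀ c / lam) ^ 2)
      = (∑ c, F c * q c - lam * (s * lam ^ 2 + Q₁) - 2 * lam ^ 3 * s) / lam
        - ∑ c, F c * (τ i₀ c / lam) ^ 2 := by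
    rw [← eF]
    have h5 : 2 * lam ^ 3 * s = ∑ c, F c * (if c = i₀ then 2 * lam ^ 3 else 0) := by
      simp [hFs]; ring
    rw [h5, Finset.mul_sum, ← Finset.sum_sub_distrib, ← Finset.sum_sub_distrib, Finset.sum_div,
      ← Finset.sum_sub_distrib]
    refine Finset.sum_congr rfl fun c _ => ?_
    ring
  have eT : ∑ c, F c * (τ i₀ c / lam) ^ 2 * lam = s / lam * m ^ 2
      + ∑ j ∈ Finset.univ.erase i₀, F j / lam * τ i₀ j ^ 2 := by
    rw [sum_eq_add_sum_erase i₀]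
    congr 1
    · rw [hFs, ← hm]; field_simp
    · refine Finset.sum_congr rfl fun c _ => ?_
      field_simp
  -- The ratio 4/3 is the right one: 3/2 · 4/3 = 2 is exactly the weight of J in `sum_sq_symm_ge`.
  have hT : ∑ j ∈ Finset.univ.erase i₀, F j / lam * τ i₀ j ^ 2 ≤ 4 / 3 * J := by
    rw [hJ, Finset.mul_sum]
    refine Finset.sum_le_sum fun j hj => mul_le_mul_of_nonneg_right ?_ (sq_nonneg _)
    rw [div_le_iff₀ hl0]; exact hFj j (Finset.ne_of_mem_erase hj)
  rw [eV]
  rw [← Finset.sum_mul] at eT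
  set Q := ∑ c, F c * (τ i₀ c / lam) ^ 2
  have eq : ∑ c, F c * q c = f₂ - (m + t) ^ 2 + ∑ a, ∑ b, τ a b ^ 2 + R * lam ^ 2 + 2 * lam ^ 3 * s := by
    rw [e₂, etr]; ring
  rw [eq]
  have hlq : lam * Q₁ ≤ 2 * D ^ 3 := by
    calc lam * Q₁ ≤ lam * (D * (2 * D ^ 2 / lam)) := by gcongr
      _ = _ := by field_simp
  have hlq2 : lam ^ 2 * Q₂ ≤ D ^ 3 := by
    calc lam ^ 2 * Q₂ ≤ lam ^ 2 * (D * (D ^ 2 / lam ^ 2)) := by gcongr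
      _ = _ := by field_simp
  have hls : 0 ≤ lam ^ 2 * (lam * s) := mul_nonneg (sq_nonneg _) (hd.le.trans hL.lower)
  have hss : 0 ≤ lam ^ 2 * s ^ 2 := by positivity
  -- The terms 2 lam³ s from the Gauss equation and from the logarithm of the curvature cancel. What
  -- is left of the curvature terms is lam³ s + lam² s² ≥ 0, up to the bounded errors lam Q₁ and
  -- lam² Q₂.
  have key : 3 / 2 * (Q * lam) - (C₁ + D + 3 * D ^ 3) ≤ f₂ - (m + t) ^ 2 + ∑ a, ∑ b, τ a b ^ 2
      + R * lam ^ 2 + 2 * lam ^ 3 * s - lam * (s * lam ^ 2 + Q₁) - 2 * lam ^ 3 * s := by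
    rw [eR, eT]
    have := (abs_le.1 hf₂).1
    linarith
  have hC0 : 0 ≤ C₁ + D + 3 * D ^ 3 := by positivity
  have hfin : (3 / 2 * (Q * lam) - (C₁ + D + 3 * D ^ 3)) / lam ≤ _ :=
    div_le_div_of_nonneg_right key hl0.le
  have h6 : (3 / 2 * (Q * lam) - (C₁ + D + 3 * D ^ 3)) / lam
      = 3 / 2 * Q - (C₁ + D + 3 * D ^ 3) / lam := by field_simp
  have h7 : (C₁ + D + 3 * D ^ 3) / lam ≤ C₁ + D + 3 * D ^ 3 := div_le_self hC0 hl1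
  linarith

end HeinzEstimate

/-! ### The maximum principle as an inequality between numbers -/

namespace HeinzEstimate

set_option maxHeartbeats 2000000 in
/-- At an interior maximum of the test function, the cut-off times the logarithm of the largest
eigenvalue is bounded. -/
theorem cutoff_mul_log_le_of_max {D d : ℝ} (hD : 1 ≤ D) (hd : 0 < d) :
    ∃ A β lam₀ B : ℝ, 0 ≤ A ∧ 0 ≤ β ∧
      ∀ (ι : Type) [Fintype ι] [DecidableEq ι] (i₀ : ι) (κ θ ll ρ₁ ρ₂ a T p₂ S₂ η : ι → ℝ) (ρ : ℝ),
        (Fintype.card ι : ℝ) ≤ D → LargeEigenvalue i₀ κ D d → lam₀ ≤ κ i₀ →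
        1 / 2 * ∑ c, (∑ b, κ b - κ c) * (Real.log (κ i₀) * θ c) ^ 2 - D ≤
          Real.log (κ i₀) * ∑ c, (∑ b, κ b - κ c) * (ll c + θ c ^ 2) →
        0 < ρ → ρ ≤ D → (∀ c, |ρ₁ c| ≤ D) → (∀ c, |ρ₂ c| ≤ D * (1 + |κ c|)) → (∀ c, |a c| ≤ D) →
        (∀ c, |T c| ≤ D) → (∀ c, |η c| ≤ D) →
        (d ≤ ρ ∨ (∃ j, j ≠ i₀ ∧ d ≤ |ρ₁ j|) ∨ d ≤ |T i₀|) →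
        (∑ b, κ b - κ i₀) * κ i₀ ^ 2 - D ≤
          ∑ c, (∑ b, κ b - κ c) * (p₂ c - 2 * κ c * η c * (κ c * a c)) →
        -D ≤ ∑ c, (∑ b, κ b - κ c) * (S₂ c - 2 * κ c * η c * (κ c * T c)) →
        (∀ c, θ c + 2 * (ρ₁ c / ρ) + A * (κ c * a c) + β * (κ c * T c) = 0) →
        (∀ c, ll c + 2 * (ρ₂ c / ρ - (ρ₁ c / ρ) ^ 2) + A * p₂ c + β * S₂ c ≤ 0) →
        ρ * Real.log (κ i₀) ≤ B := by
  have hD0 : 0 < D := by linarith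
  have hDD : D ≤ D ^ 2 := by nlinarith
  -- A d exceeds by 2 the total coefficient of `lam` on the other side of the inequality `hI` when ρ
  -- ≥ d. Next, β d = A D + 1 makes β T outweigh A a in the direction i₀.
  set A := (2 * D ^ 5 + 24 * D ^ 4 / d + 4 * D ^ 3 / d ^ 2 + 2) / d with hA
  have hA0 : 0 ≤ A := by positivity
  have hAd : A * d = 2 * D ^ 5 + 24 * D ^ 4 / d + 4 * D ^ 3 / d ^ 2 + 2 := by
    rw [hA]; field_simp
  set β := (A * D + 1) / d with hβ
  have hβ0 : 0 ≤ β := by positivity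
  have hβd : β * d = A * D + 1 := by rw [hβ]; field_simp
  clear_value A β
  set Y := (A + β) * D with hY
  have hY0 : 0 ≤ Y := by positivity
  clear_value Y
  -- The first term of B comes from the case where T is large; 4D makes 1/ρ ≤ b/(4D), and 1 makes
  -- 1/ρ ≤ b. In b₀ below, 416 D⁵/d² excludes the transverse case, and 8 lets b Q absorb multiples
  -- of Q.
  set B := 832 * D ^ 4 / d + 4 * D + 1 with hB
  have hB1 : 1 ≤ B := by
    have : 0 ≤ 832 * D ^ 4 / d := by positivity
    linarith
  set b₀ := 416 * D ^ 5 / d ^ 2 + 8 with hb₀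
  have hb8' : 8 ≤ b₀ := by
    have : 0 ≤ 416 * D ^ 5 / d ^ 2 := by positivity
    linarith
  refine ⟨A, β, Real.exp (b₀ + 1) + ((A + β + 1) * D + 2 * D ^ 3 * Y ^ 2) + D ^ 2 * Y / d + 2 * D, B,
    hA0, hβ0, ?_⟩
  intro ι _ _ i₀ κ θ ll ρ₁ ρ₂ a T p₂ S₂ η ρ hcard hL hlam hJ hρ0 hρD hρ₁ hρ₂ ha hT hη hdich hp hS h1 h2
  set lam := κ i₀ with hlamdef
  set F : ι → ℝ := fun c => ∑ b, κ b - κ c with hF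
  set s := ∑ b, κ b - lam with hs
  have hFs : F i₀ = s := rfl
  set b := Real.log lam with hb
  have hexp0 := Real.exp_pos (b₀ + 1)
  have hpA : 0 ≤ (A + β + 1) * D + 2 * D ^ 3 * Y ^ 2 := by positivity
  have hpY : 0 ≤ D ^ 2 * Y / d := by positivity
  have hl1 : 1 ≤ lam := hL.pos
  have hl0 : 0 < lam := by linarith
  have hlA : (A + β + 1) * D + 2 * D ^ 3 * Y ^ 2 ≤ lam := by linarith
  have hlY : D ^ 2 * Y / d ≤ lam := by linarith
  have hlD : 2 * D ≤ lam := by linarith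
  have hbb : b₀ + 1 ≤ b := by
    rw [hb, Real.le_log_iff_exp_le hl0]; linarith
  have hb8 : 8 ≤ b := by linarith
  have hblam : b ≤ lam := by
    have := Real.log_le_sub_one_of_pos hl0; linarith
  have hDl : D / lam ≤ 1 / 2 := by rw [div_le_iff₀ hl0]; linarith
  have hDl0 : 0 ≤ D / lam := by positivity
  have hFj : ∀ j, j ≠ i₀ → F j ≤ 2 * lam := fun j hj => by
    have := (abs_le.1 (hL.coef j hj)).2
    simp only [hF]; linarith
  have hFj0 : ∀ j, j ≠ i₀ → lam / 2 ≤ F j := fun j hj => by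
    have := (abs_le.1 (hL.coef j hj)).1
    simp only [hF]; linarith
  have hds : d ≤ lam * s := hL.lower
  have hs0 : 0 < s := by
    by_contra hcon
    push Not at hcon
    have := mul_nonpos_of_nonneg_of_nonpos hl0.le hcon
    linarith
  have hsD : s ≤ D / lam := (abs_le.1 hL.trace).2
  have hsD' : lam * s ≤ D := by rw [le_div_iff₀ hl0] at hsD; linarith
  have hF0 : ∀ c, 0 ≤ F c := fun c => by
    by_cases hc : c = i₀
    · rw [hc]; exact hs0.le
    · linarith [hFj0 c hc]
  have hF2 : ∀ c, F c ≤ 2 * lam := fun c => by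
    by_cases hc : c = i₀
    · rw [hc, hFs]; linarith
    · exact hFj c hc
  have hFκ : ∀ c, F c * |κ c| ≤ 2 * D := fun c => by
    by_cases hc : c = i₀
    · rw [hc, hFs, ← hlamdef, abs_of_pos hl0]; linarith
    · calc F c * |κ c| ≤ 2 * lam * (D / lam) :=
            mul_le_mul (hFj c hc) (hL.other c hc) (abs_nonneg _) (by positivity)
        _ = 2 * D := by field_simp
  have hFκ2 : ∀ c, F c * κ c ^ 2 ≤ 2 * D ^ 2 * lam := fun c => by
    have e : F c * κ c ^ 2 = F c * |κ c| * |κ c| := by rw [mul_assoc, ← sq, sq_abs]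
    rw [e]
    have h3 : |κ c| ≤ D * lam := by
      by_cases hc : c = i₀
      · rw [hc, ← hlamdef, abs_of_pos hl0]
        exact le_mul_of_one_le_left hl0.le hD
      · refine (hL.other c hc).trans ?_
        rw [div_eq_mul_inv]
        refine mul_le_mul_of_nonneg_left ?_ hD0.le
        exact (inv_le_one_of_one_le₀ hl1).trans hl1
    calc F c * |κ c| * |κ c| ≤ 2 * D * (D * lam) :=
          mul_le_mul (hFκ c) h3 (abs_nonneg _) (by positivity)
      _ = _ := by ring
  have hsum : ∀ (φ : ι → ℝ) (M : ℝ), 0 ≤ M → (∀ c, φ c ≤ M) → ∑ c, φ c ≤ D * M := by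
    intro φ M hM hφ
    refine (Finset.sum_le_card_nsmul _ _ M fun c _ => hφ c).trans ?_
    rw [nsmul_eq_mul, Finset.card_univ]
    exact mul_le_mul_of_nonneg_right hcard hM
  set Q := ∑ c, F c * θ c ^ 2 with hQ
  have hQ0 : 0 ≤ Q := Finset.sum_nonneg fun c _ => mul_nonneg (hF0 c) (sq_nonneg _)
  set R := ∑ c, F c * (ρ₁ c / ρ) ^ 2 with hR
  -- The second-order conditions are summed with the weights F c ≥ 0. The first-order condition
  -- trades the drift terms 2κη·κ(Aa + βT) for terms in θ and ρ₁.
  have hmain : ∑ c, F c * ll c + 2 * (∑ c, F c * ρ₂ c) / ρ - 2 * R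
      + A * ∑ c, F c * (p₂ c - 2 * κ c * η c * (κ c * a c))
      + β * ∑ c, F c * (S₂ c - 2 * κ c * η c * (κ c * T c))
      - 2 * ∑ c, F c * (κ c * η c * θ c) - 4 * (∑ c, F c * (κ c * η c * ρ₁ c)) / ρ ≤ 0 := by
    have e : ∑ c, F c * ll c + 2 * (∑ c, F c * ρ₂ c) / ρ - 2 * R
      + A * ∑ c, F c * (p₂ c - 2 * κ c * η c * (κ c * a c))
      + β * ∑ c, F c * (S₂ c - 2 * κ c * η c * (κ c * T c))
      - 2 * ∑ c, F c * (κ c * η c * θ c) - 4 * (∑ c, F c * (κ c * η c * ρ₁ c)) / ρ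
      = ∑ c, F c * (ll c + 2 * (ρ₂ c / ρ - (ρ₁ c / ρ) ^ 2) + A * p₂ c + β * S₂ c) := by
      rw [hR]
      simp only [Finset.mul_sum, Finset.sum_div]
      simp only [← Finset.sum_add_distrib, ← Finset.sum_sub_distrib]
      refine Finset.sum_congr rfl fun c _ => ?_
      have := h1 c
      have e3 : θ c = -(2 * (ρ₁ c / ρ) + A * (κ c * a c) + β * (κ c * T c)) := by linarith
      rw [e3]; ring
    rw [e]
    exact Finset.sum_nonpos fun c _ => mul_nonpos_of_nonneg_of_nonpos (hF0 c) (h2 c)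
  -- The gain from the iterated logarithm: after division by b the Jacobi inequality keeps the large
  -- factor b/2 in front of Q.
  have hll : b / 2 * Q - Q - D / b ≤ ∑ c, F c * ll c := by
    have e1 : ∑ c, F c * (b * θ c) ^ 2 = b ^ 2 * Q := by
      rw [hQ, Finset.mul_sum]; exact Finset.sum_congr rfl fun c _ => by ring
    have e2 : ∑ c, F c * (ll c + θ c ^ 2) = ∑ c, F c * ll c + Q := by
      rw [hQ, ← Finset.sum_add_distrib]; exact Finset.sum_congr rfl fun c _ => by ring
    have h3 : 1 / 2 * (b ^ 2 * Q) - D ≤ b * (∑ c, F c * ll c + Q) := by rw [← e1, ← e2]; exact hJ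
    have hb0 : 0 < b := by linarith
    have h4 : (1 / 2 * (b ^ 2 * Q) - D) / b ≤ ∑ c, F c * ll c + Q := by
      rw [div_le_iff₀ hb0]; linarith
    have e5 : (1 / 2 * (b ^ 2 * Q) - D) / b = b / 2 * Q - D / b := by field_simp
    linarith
  have hb0 : 0 < b := by linarith
  have hρ2 : -(8 * D ^ 3 * lam) ≤ ∑ c, F c * ρ₂ c := by
    have : ∑ c, -(F c * ρ₂ c) ≤ D * (8 * D ^ 2 * lam) := by
      refine hsum _ _ (by positivity) fun c => ?_
      have h3 : -(F c * ρ₂ c) ≤ F c * (D * (1 + |κ c|)) := by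
        have := (abs_le.1 (hρ₂ c)).1
        have := mul_le_mul_of_nonneg_left this (hF0 c)
        linarith
      have h4 : F c * (D * (1 + |κ c|)) = D * F c + D * (F c * |κ c|) := by ring
      have h5 : D * F c ≤ D * (2 * lam) := mul_le_mul_of_nonneg_left (hF2 c) hD0.le
      have h6 : D * (F c * |κ c|) ≤ D * (2 * D) := mul_le_mul_of_nonneg_left (hFκ c) hD0.le
      have h7 : D * lam ≤ D ^ 2 * lam := mul_le_mul_of_nonneg_right hDD hl0.le
      have h8 : D ^ 2 * 1 ≤ D ^ 2 * lam := mul_le_mul_of_nonneg_left hl1 (sq_nonneg _)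
      linarith
    rw [Finset.sum_neg_distrib] at this
    linarith
  have hcr : ∑ c, F c * (κ c * η c * ρ₁ c) ≤ 2 * D ^ 4 := by
    have : ∑ c, F c * (κ c * η c * ρ₁ c) ≤ D * (2 * D ^ 3) := by
      refine hsum _ _ (by positivity) fun c => ?_
      calc F c * (κ c * η c * ρ₁ c) ≤ |F c * (κ c * η c * ρ₁ c)| := le_abs_self _
        _ = F c * |κ c| * (|η c| * |ρ₁ c|) := by
            rw [abs_mul, abs_mul, abs_mul, abs_of_nonneg (hF0 c)]; ring
        _ ≤ 2 * D * (D * D) := by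
            refine mul_le_mul (hFκ c) (mul_le_mul (hη c) (hρ₁ c) (abs_nonneg _) hD0.le)
              (by positivity) (by positivity)
        _ = _ := by ring
    linarith
  have hth : 2 * ∑ c, F c * (κ c * η c * θ c) ≤ b / 8 * Q + 16 * D ^ 5 * lam / b := by
    have : ∑ c, (2 * (F c * (κ c * η c * θ c)) - b / 8 * (F c * θ c ^ 2)) ≤ D * (16 * D ^ 4 * lam / b) := by
      refine hsum _ _ (by positivity) fun c => ?_
      have h3 : 2 * (F c * (κ c * η c * θ c)) - b / 8 * (F c * θ c ^ 2)
          = 8 * (F c * κ c ^ 2) * η c ^ 2 / b - F c * (b / 8) * (θ c - 8 * κ c * η c / b) ^ 2 := by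
        field_simp; ring
      have h4 : 0 ≤ F c * (b / 8) * (θ c - 8 * κ c * η c / b) ^ 2 :=
        mul_nonneg (mul_nonneg (hF0 c) (by positivity)) (sq_nonneg _)
      have h5 : η c ^ 2 ≤ D ^ 2 := sq_le_sq' (by linarith [(abs_le.1 (hη c)).1]) (abs_le.1 (hη c)).2
      have h6 : 8 * (F c * κ c ^ 2) * η c ^ 2 / b ≤ 8 * (2 * D ^ 2 * lam) * D ^ 2 / b := by
        refine div_le_div_of_nonneg_right (mul_le_mul ?_ h5 (sq_nonneg _) (by positivity)) hb0.le
        exact mul_le_mul_of_nonneg_left (hFκ2 c) (by norm_num)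
      have h7 : 8 * (2 * D ^ 2 * lam) * D ^ 2 / b = 16 * D ^ 4 * lam / b := by ring
      linarith
    rw [Finset.sum_sub_distrib, ← Finset.mul_sum, ← Finset.mul_sum, ← hQ] at this
    have e : D * (16 * D ^ 4 * lam / b) = 16 * D ^ 5 * lam / b := by ring
    linarith
  have hAp : A * (d * lam) - A * D ≤ A * ∑ c, F c * (p₂ c - 2 * κ c * η c * (κ c * a c)) := by
    have h3 : d * lam - D ≤ ∑ c, F c * (p₂ c - 2 * κ c * η c * (κ c * a c)) := by
      refine le_trans ?_ hp
      have : d * lam ≤ lam * s * lam := by gcongr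
      linarith
    have := mul_le_mul_of_nonneg_left h3 hA0
    linarith
  have hβS : -(β * D) ≤ β * ∑ c, F c * (S₂ c - 2 * κ c * η c * (κ c * T c)) := by
    have := mul_le_mul_of_nonneg_left hS hβ0
    linarith
  have hbD : D / b ≤ D := div_le_self hD0.le (by linarith)
  have hI : b / 4 * Q + A * d * lam ≤ (A + β + 1) * D + 16 * D ^ 5 * lam / b
      + 24 * D ^ 4 * lam / ρ + 2 * R := by
    have h3 : -(16 * D ^ 3 * lam / ρ) ≤ 2 * (∑ c, F c * ρ₂ c) / ρ := by
      rw [← neg_div]; apply div_le_div_of_nonneg_right _ hρ0.le; linarith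
    have h4 : 4 * (∑ c, F c * (κ c * η c * ρ₁ c)) / ρ ≤ 8 * D ^ 4 / ρ := by
      apply div_le_div_of_nonneg_right _ hρ0.le; linarith
    have h5 : 8 * D ^ 4 / ρ ≤ 8 * D ^ 4 * lam / ρ := by
      apply div_le_div_of_nonneg_right _ hρ0.le
      exact le_mul_of_one_le_right (by positivity) hl1
    have h6 : 16 * D ^ 3 * lam / ρ ≤ 16 * D ^ 4 * lam / ρ := by
      have : D ^ 3 ≤ D ^ 4 := pow_le_pow_right₀ hD (by norm_num)
      gcongr
    have h7 : 24 * D ^ 4 * lam / ρ = 16 * D ^ 4 * lam / ρ + 8 * D ^ 4 * lam / ρ := by ring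
    have h8 : 8 * Q ≤ b * Q := mul_le_mul_of_nonneg_right hb8 hQ0
    linarith
  clear hmain hll hρ2 hcr hth hAp hβS hp hS hJ h2
  have hb16 : 16 * D ^ 5 * lam / b ≤ 2 * D ^ 5 * lam := by
    rw [div_le_iff₀ hb0]
    have : 2 * D ^ 5 * lam * 8 ≤ 2 * D ^ 5 * lam * b := by gcongr
    linarith
  -- For ρ ≥ d the term A d lam exceeds everything on the right-hand side, which is impossible.
  -- Hence ρ < d afterwards.
  by_cases hρd : d ≤ ρ
  · exfalso
    have hR1 : R ≤ 2 * D ^ 3 * lam / d ^ 2 := by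
      have : R ≤ D * (2 * lam * (D ^ 2 / d ^ 2)) := by
        refine hsum _ _ (by positivity) fun c => ?_
        refine mul_le_mul (hF2 c) ?_ (sq_nonneg _) (by positivity)
        rw [div_pow]
        have : ρ₁ c ^ 2 ≤ D ^ 2 := sq_le_sq' (by linarith [(abs_le.1 (hρ₁ c)).1]) (abs_le.1 (hρ₁ c)).2
        gcongr
      calc R ≤ _ := this
        _ = _ := by ring
    have h3 : 24 * D ^ 4 * lam / ρ ≤ 24 * D ^ 4 * lam / d := by gcongr
    have h4 : A * d * lam = 2 * D ^ 5 * lam + 24 * D ^ 4 * lam / d + 2 * (2 * D ^ 3 * lam / d ^ 2) + 2 * lam := by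
      rw [hAd]; ring
    have h5 : 0 ≤ b / 4 * Q := by positivity
    have h6 : 0 ≤ 2 * D ^ 3 * Y ^ 2 := by positivity
    linarith
  by_contra hcon
  push Not at hcon
  -- The contrary assumption ρ b > B ≥ 1 gives 1/ρ ≤ b ≤ lam, so one factor 1/ρ may be exchanged for
  -- `lam`.
  have hinv : 1 / ρ ≤ b := by
    rw [div_le_iff₀ hρ0]; linarith
  have hYb : ∀ c, |A * a c + β * T c| ≤ Y := fun c => by
    refine (abs_add_le _ _).trans ?_
    rw [abs_mul, abs_mul, abs_of_nonneg hA0, abs_of_nonneg hβ0]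
    have h3 := mul_le_mul_of_nonneg_left (ha c) hA0
    have h4 := mul_le_mul_of_nonneg_left (hT c) hβ0
    rw [hY]; linarith
  -- For j ≠ i₀ criticality expresses ρ₁/ρ by θ, up to a term with the small factor κ_j. For i₀ the
  -- small weight s suffices.
  have hR2 : 2 * R ≤ Q + 2 * D ^ 3 * Y ^ 2 + 2 * D ^ 3 * lam / ρ := by
    have hj : ∑ j ∈ Finset.univ.erase i₀, (2 * (F j * (ρ₁ j / ρ) ^ 2) - F j * θ j ^ 2)
        ≤ D * (2 * D ^ 2 * Y ^ 2) := by
      refine sum_erase_le_mul i₀ _ hcard (by positivity) fun j hj => ?_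
      have e : 4 * (ρ₁ j / ρ) ^ 2 ≤ 2 * θ j ^ 2 + 2 * (κ j * (A * a j + β * T j)) ^ 2 := by
        have : 2 * (ρ₁ j / ρ) = -(θ j + κ j * (A * a j + β * T j)) := by linarith [h1 j]
        have e4 : 4 * (ρ₁ j / ρ) ^ 2 = (θ j + κ j * (A * a j + β * T j)) ^ 2 := by
          rw [← neg_sq (θ j + _), ← this]; ring
        rw [e4]
        linarith [sq_nonneg (θ j - κ j * (A * a j + β * T j))]
      have e5 : (A * a j + β * T j) ^ 2 ≤ Y ^ 2 := sq_le_sq' (abs_le.1 (hYb j)).1 (abs_le.1 (hYb j)).2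
      have e6 : F j * κ j ^ 2 ≤ 2 * D ^ 2 := by
        have e7 : F j * κ j ^ 2 = F j * |κ j| * |κ j| := by rw [mul_assoc, ← sq, sq_abs]
        rw [e7]
        calc F j * |κ j| * |κ j| ≤ 2 * D * (1 / 2) :=
              mul_le_mul (hFκ j) ((hL.other j hj).trans hDl) (abs_nonneg _) (by positivity)
          _ ≤ 2 * D ^ 2 := by linarith
      have e8 : F j * κ j ^ 2 * (A * a j + β * T j) ^ 2 ≤ 2 * D ^ 2 * Y ^ 2 :=
        mul_le_mul e6 e5 (sq_nonneg _) (by positivity)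
      have e9 := mul_le_mul_of_nonneg_left e (hF0 j)
      linarith
    rw [Finset.sum_sub_distrib, ← Finset.mul_sum] at hj
    have hR' : R = s * (ρ₁ i₀ / ρ) ^ 2 + ∑ j ∈ Finset.univ.erase i₀, F j * (ρ₁ j / ρ) ^ 2 :=
      sum_eq_add_sum_erase i₀ _
    have hQ' : Q = s * θ i₀ ^ 2 + ∑ j ∈ Finset.univ.erase i₀, F j * θ j ^ 2 :=
      sum_eq_add_sum_erase i₀ _
    have h0 : s * (ρ₁ i₀ / ρ) ^ 2 ≤ D ^ 3 * lam / ρ := by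
      have h3 : (ρ₁ i₀ / ρ) ^ 2 ≤ D ^ 2 * (1 / ρ) * (1 / ρ) := by
        have : ρ₁ i₀ ^ 2 ≤ D ^ 2 := sq_le_sq' (by linarith [(abs_le.1 (hρ₁ i₀)).1]) (abs_le.1 (hρ₁ i₀)).2
        calc (ρ₁ i₀ / ρ) ^ 2 = ρ₁ i₀ ^ 2 * (1 / ρ) * (1 / ρ) := by ring
          _ ≤ _ := by gcongr
      have h4 : s ≤ D := hsD.trans (div_le_self hD0.le hl1)
      calc s * (ρ₁ i₀ / ρ) ^ 2 ≤ D * (D ^ 2 * (1 / ρ) * lam) := by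
            refine mul_le_mul h4 (h3.trans ?_) (sq_nonneg _) hD0.le
            exact mul_le_mul_of_nonneg_left (hinv.trans hblam) (by positivity)
        _ = _ := by ring
    have h5 : 0 ≤ s * θ i₀ ^ 2 := by positivity
    have h6 : 2 * D ^ 3 * lam / ρ = 2 * (D ^ 3 * lam / ρ) := by ring
    linarith
  have hII : b * Q ≤ 208 * D ^ 4 * lam / ρ := by
    have h3 : 0 ≤ 24 * D ^ 4 / d * lam := by positivity
    have h4 : 0 ≤ 4 * D ^ 3 / d ^ 2 * lam := by positivity
    have h5 : A * d * lam = 2 * D ^ 5 * lam + 24 * D ^ 4 / d * lam + 4 * D ^ 3 / d ^ 2 * lam + 2 * lam := by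
      rw [hAd]; ring
    have h6 : 2 * D ^ 3 * lam / ρ ≤ 2 * D ^ 4 * lam / ρ := by
      have : D ^ 3 ≤ D ^ 4 := pow_le_pow_right₀ hD (by norm_num)
      gcongr
    have h7 : 8 * Q ≤ b * Q := mul_le_mul_of_nonneg_right hb8 hQ0
    have h8 : 208 * D ^ 4 * lam / ρ = 8 * (24 * D ^ 4 * lam / ρ + 2 * D ^ 4 * lam / ρ) := by ring
    linarith
  have hQge : ∀ c, F c * θ c ^ 2 ≤ Q := fun c =>
    Finset.single_le_sum (f := fun c => F c * θ c ^ 2)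
      (fun c _ => mul_nonneg (hF0 c) (sq_nonneg _)) (Finset.mem_univ c)
  rcases hdich with h | ⟨j, hj, hdj⟩ | hT0
  · exact hρd h
  -- Transverse case: F j ≥ lam/2 gives Q ≥ lam d²/(2ρ²). This is one power of 1/ρ more than `hII`
  -- allows, so b would be bounded by 416 D⁵/d² < b₀.
  · have h3 : d / ρ ≤ |θ j| := by
      have e1 : 2 * (ρ₁ j / ρ) + θ j = -(κ j * (A * a j + β * T j)) := by linarith [h1 j]
      have e2 : 2 * (|ρ₁ j| / ρ) ≤ |θ j| + |κ j| * |A * a j + β * T j| := by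
        have : 2 * (|ρ₁ j| / ρ) = |2 * (ρ₁ j / ρ)| := by
          rw [abs_mul, abs_div, abs_of_pos hρ0, abs_two]
        rw [this, ← abs_mul]
        have e3 : 2 * (ρ₁ j / ρ) = -(θ j + κ j * (A * a j + β * T j)) := by linarith
        rw [e3, abs_neg]; exact abs_add_le _ _
      have e4 : |κ j| * |A * a j + β * T j| ≤ d / ρ := by
        calc |κ j| * |A * a j + β * T j| ≤ D / lam * Y :=
              mul_le_mul (hL.other j hj) (hYb j) (abs_nonneg _) hDl0
          _ ≤ d / D := by
              rw [div_le_iff₀ hd] at hlY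
              rw [div_mul_eq_mul_div, div_le_div_iff₀ hl0 hD0]
              linarith
          _ ≤ d / ρ := by gcongr
      have e5 : d / ρ ≤ |ρ₁ j| / ρ := by gcongr
      linarith
    have h4 : lam / 2 * (d / ρ) ^ 2 ≤ Q := by
      refine le_trans ?_ (hQge j)
      refine mul_le_mul (hFj0 j hj) ?_ (sq_nonneg _) (hF0 j)
      rw [← sq_abs (θ j)]
      gcongr
    have h5 : b * (lam / 2 * (d / ρ) ^ 2) ≤ 208 * D ^ 4 * lam / ρ :=
      (mul_le_mul_of_nonneg_left h4 hb0.le).trans hII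
    have h6 : b * d ^ 2 ≤ 416 * D ^ 4 * ρ := by
      have e1 : b * (lam / 2 * (d / ρ) ^ 2) = b * d ^ 2 * (lam / (2 * ρ ^ 2)) := by field_simp
      have e2 : 208 * D ^ 4 * lam / ρ = 416 * D ^ 4 * ρ * (lam / (2 * ρ ^ 2)) := by field_simp; ring
      rw [e1, e2] at h5
      exact le_of_mul_le_mul_right h5 (by positivity)
    have h7 : 416 * D ^ 4 * ρ ≤ 416 * D ^ 5 := by
      have : 416 * D ^ 4 * ρ ≤ 416 * D ^ 4 * D := by gcongr
      linarith
    have h8 : b ≤ 416 * D ^ 5 / d ^ 2 := by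
      rw [le_div_iff₀ (by positivity)]; linarith
    linarith
  -- Case of T: since |A a + β T| ≥ 1 at i₀, criticality forces θ i₀ to be of size lam. Even with
  -- the small weight s ≥ d/lam this gives Q ≥ d lam/4, and `hII` bounds ρ b.
  · have h3 : lam / 2 ≤ |θ i₀| := by
      have e1 : θ i₀ = -(2 * (ρ₁ i₀ / ρ) + lam * (A * a i₀ + β * T i₀)) := by linarith [h1 i₀]
      have e2 : lam * 1 ≤ |lam * (A * a i₀ + β * T i₀)| := by
        rw [abs_mul, abs_of_pos hl0]
        refine mul_le_mul_of_nonneg_left ?_ hl0.le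
        have e3 : β * d ≤ |β * T i₀| := by
          rw [abs_mul, abs_of_nonneg hβ0]; gcongr
        have e4 : |A * a i₀| ≤ A * D := by
          rw [abs_mul, abs_of_nonneg hA0]; exact mul_le_mul_of_nonneg_left (ha i₀) hA0
        have e5 : |β * T i₀| ≤ |A * a i₀ + β * T i₀| + |A * a i₀| := by
          have := abs_sub (A * a i₀ + β * T i₀) (A * a i₀)
          rwa [add_sub_cancel_left] at this
        linarith
      have e6 : |2 * (ρ₁ i₀ / ρ)| ≤ lam / 2 := by
        rw [abs_mul, abs_div, abs_of_pos hρ0, abs_two]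
        have e7 : 1 / ρ ≤ b / (4 * D) := by
          rw [div_le_div_iff₀ hρ0 (by positivity)]
          have : 0 ≤ 832 * D ^ 4 / d := by positivity
          linarith
        calc 2 * (|ρ₁ i₀| / ρ) = 2 * |ρ₁ i₀| * (1 / ρ) := by ring
          _ ≤ 2 * D * (b / (4 * D)) := by
              refine mul_le_mul ?_ e7 (by positivity) (by positivity)
              linarith [hρ₁ i₀]
          _ = b / 2 := by field_simp; norm_num
          _ ≤ lam / 2 := by linarith
      have e8 : |lam * (A * a i₀ + β * T i₀)| ≤ |θ i₀| + |2 * (ρ₁ i₀ / ρ)| := by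
        have : lam * (A * a i₀ + β * T i₀) = -(θ i₀ + 2 * (ρ₁ i₀ / ρ)) := by linarith
        rw [this, abs_neg]; exact abs_add_le _ _
      linarith
    have h4 : d / lam * (lam / 2) ^ 2 ≤ Q := by
      refine le_trans ?_ (hQge i₀)
      rw [hFs, ← sq_abs (θ i₀)]
      refine mul_le_mul ?_ (by gcongr) (sq_nonneg _) hs0.le
      rw [div_le_iff₀ hl0]; linarith
    have h5 : b * (d / lam * (lam / 2) ^ 2) ≤ 208 * D ^ 4 * lam / ρ :=
      (mul_le_mul_of_nonneg_left h4 hb0.le).trans hII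
    have h6 : ρ * b ≤ 832 * D ^ 4 / d := by
      rw [le_div_iff₀ hd]
      have e1 : b * (d / lam * (lam / 2) ^ 2) = ρ * b * d * (lam / (4 * ρ)) := by field_simp; ring
      have e2 : 208 * D ^ 4 * lam / ρ = 832 * D ^ 4 * (lam / (4 * ρ)) := by field_simp; ring
      rw [e1, e2] at h5
      exact le_of_mul_le_mul_right h5 (by positivity)
    linarith

end HeinzEstimate

/-! ### Two-jets of functions of one variable -/

namespace HeinzEstimate
open Filter Topology

/-- `φ` has value `a`, first derivative `b` and second derivative `c` at `0`. -/
def Jet2 (φ : ℝ → ℝ) (a b c : ℝ) : Prop :=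
  φ 0 = a ∧ ∃ φ' : ℝ → ℝ, (∀ᶠ t in 𝓝 0, HasDerivAt φ (φ' t) t) ∧ φ' 0 = b ∧ HasDerivAt φ' c 0

namespace Jet2

variable {φ ψ : ℝ → ℝ} {a b c a' b' c' : ℝ}

theorem congr' (h : Jet2 φ a b c) (ha : a = a') (hb : b = b') (hc : c = c') : Jet2 φ a' b' c' := by
  subst ha hb hc; exact h

theorem congr_fun (h : Jet2 φ a b c) (he : ψ =ᶠ[𝓝 0] φ) : Jet2 ψ a b c := by
  obtain ⟨h0, φ', h1, h2, h3⟩ := h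
  refine ⟨he.eq_of_nhds.trans h0, φ', ?_, h2, h3⟩
  filter_upwards [h1, he.eventually_nhds] with t ht het
  exact ht.congr_of_eventuallyEq het

theorem hasDerivAt (h : Jet2 φ a b c) : HasDerivAt φ b 0 := by
  obtain ⟨h0, φ', h1, h2, h3⟩ := h
  rw [← h2]; exact h1.self_of_nhds

theorem unique (h : Jet2 φ a b c) (h' : Jet2 φ a' b' c') : a = a' ∧ b = b' ∧ c = c' := by
  refine ⟨h.1.symm.trans h'.1, h.hasDerivAt.unique h'.hasDerivAt, ?_⟩
  obtain ⟨h0, φ', h1, h2, h3⟩ := h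
  obtain ⟨k0, ψ', k1, k2, k3⟩ := h'
  have : φ' =ᶠ[𝓝 0] ψ' := by
    filter_upwards [h1, k1] with t ht kt using ht.unique kt
  exact (h3.congr_of_eventuallyEq this.symm).unique k3

theorem const (k : ℝ) : Jet2 (fun _ => k) k 0 0 :=
  ⟨rfl, fun _ => 0, Eventually.of_forall fun t => hasDerivAt_const t k, rfl, hasDerivAt_const 0 0⟩

theorem linear (k : ℝ) : Jet2 (fun t => t * k) 0 k 0 :=
  ⟨by simp, fun _ => k, Eventually.of_forall fun t => by simpa using (hasDerivAt_id t).mul_const k,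
    rfl, hasDerivAt_const 0 k⟩

theorem add (h : Jet2 φ a b c) (k : Jet2 ψ a' b' c') :
    Jet2 (fun t => φ t + ψ t) (a + a') (b + b') (c + c') := by
  obtain ⟨h0, φ', h1, h2, h3⟩ := h
  obtain ⟨k0, ψ', k1, k2, k3⟩ := k
  refine ⟨by simp only [h0, k0], fun t => φ' t + ψ' t, ?_, by simp only [h2, k2], h3.add k3⟩
  filter_upwards [h1, k1] with t ht kt using ht.add kt

theorem mul (h : Jet2 φ a b c) (k : Jet2 ψ a' b' c') :
    Jet2 (fun t => φ t * ψ t) (a * a') (b * a' + a * b') (c * a' + 2 * (b * b') + a * c') := by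
  have hφ := h.hasDerivAt
  have hψ := k.hasDerivAt
  obtain ⟨h0, φ', h1, h2, h3⟩ := h
  obtain ⟨k0, ψ', k1, k2, k3⟩ := k
  refine ⟨by simp only [h0, k0], fun t => φ' t * ψ t + φ t * ψ' t, ?_, by simp only [h2, k2, h0, k0], ?_⟩
  · filter_upwards [h1, k1] with t ht kt using ht.mul kt
  · refine ((h3.mul hψ).add (hφ.mul k3)).congr_deriv ?_
    rw [h2, k2, h0, k0]; ring

theorem const_mul (k : ℝ) (h : Jet2 φ a b c) :
    Jet2 (fun t => k * φ t) (k * a) (k * b) (k * c) :=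
  ((const k).mul h).congr' rfl (by ring) (by ring)

theorem neg (h : Jet2 φ a b c) : Jet2 (fun t => -φ t) (-a) (-b) (-c) := by
  have := h.const_mul (-1)
  simpa only [neg_mul, one_mul] using this

theorem sub (h : Jet2 φ a b c) (k : Jet2 ψ a' b' c') :
    Jet2 (fun t => φ t - ψ t) (a - a') (b - b') (c - c') := by
  have := h.add k.neg
  simpa only [← sub_eq_add_neg] using this

theorem sum {ι : Type*} (s : Finset ι) {φ : ι → ℝ → ℝ} {a b c : ι → ℝ}
    (h : ∀ i ∈ s, Jet2 (φ i) (a i) (b i) (c i)) :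
    Jet2 (fun t => ∑ i ∈ s, φ i t) (∑ i ∈ s, a i) (∑ i ∈ s, b i) (∑ i ∈ s, c i) := by
  classical
  induction s using Finset.induction_on with
  | empty => simpa using const 0
  | insert i s hi ih =>
    simp only [Finset.sum_insert hi]
    exact (h i (Finset.mem_insert_self i s)).add (ih fun j hj => h j (Finset.mem_insert_of_mem hj))

theorem comp {g g' : ℝ → ℝ} {g'' : ℝ} (h : Jet2 φ a b c)
    (hg : ∀ᶠ x in 𝓝 a, HasDerivAt g (g' x) x) (hg' : HasDerivAt g' g'' a) :
    Jet2 (fun t => g (φ t)) (g a) (g' a * b) (g'' * b ^ 2 + g' a * c) := by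
  have hφ := h.hasDerivAt
  obtain ⟨h0, φ', h1, h2, h3⟩ := h
  refine ⟨by simp only [h0], fun t => g' (φ t) * φ' t, ?_, by simp only [h0, h2], ?_⟩
  · have hc : Tendsto φ (𝓝 0) (𝓝 a) := by rw [← h0]; exact hφ.continuousAt
    filter_upwards [h1, hc.eventually hg] with t ht hgt using hgt.comp t ht
  · rw [← h0] at hg'
    refine ((hg'.comp 0 hφ).mul h3).congr_deriv ?_
    rw [h2, Function.comp_apply, h0]; ring

theorem log (h : Jet2 φ a b c) (ha : 0 < a) :
    Jet2 (fun t => Real.log (φ t)) (Real.log a) (b / a) (c / a - (b / a) ^ 2) := by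
  have h1 : ∀ᶠ x in 𝓝 a, HasDerivAt Real.log (x⁻¹) x := by
    filter_upwards [lt_mem_nhds ha] with x hx using Real.hasDerivAt_log hx.ne'
  refine (h.comp h1 (hasDerivAt_inv ha.ne')).congr' rfl ?_ ?_ <;> field_simp
  ring

theorem inv (h : Jet2 φ a b c) (ha : a ≠ 0) :
    Jet2 (fun t => (φ t)⁻¹) a⁻¹ (-b / a ^ 2) (2 * b ^ 2 / a ^ 3 - c / a ^ 2) := by
  have h1 : ∀ᶠ x in 𝓝 a, HasDerivAt (fun y : ℝ => y⁻¹) (-(x ^ 2)⁻¹) x := by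
    filter_upwards [isOpen_ne.mem_nhds ha] with x hx using hasDerivAt_inv hx
  have h2 : HasDerivAt (fun x : ℝ => -(x ^ 2)⁻¹) (2 / a ^ 3) a := by
    refine ((hasDerivAt_pow 2 a).inv (pow_ne_zero 2 ha)).neg.congr_deriv ?_
    push_cast; field_simp
  refine (h.comp h1 h2).congr' rfl ?_ ?_ <;> field_simp
  ring

/-- The last entry is written so that -2 b'/a' times the first derivative stands apart. For slopes
and support function this is the drift term that the critical point equation removes. -/
theorem div (h : Jet2 φ a b c) (k : Jet2 ψ a' b' c') (ha : a' ≠ 0) :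
    Jet2 (fun t => φ t / ψ t) (a / a') ((b * a' - a * b') / a' ^ 2)
      ((c - a / a' * c') / a' - 2 * b' / a' * ((b * a' - a * b') / a' ^ 2)) := by
  have := h.mul (k.inv ha)
  simp only [← div_eq_mul_inv] at this
  refine this.congr' rfl ?_ ?_ <;> field_simp <;> ring

/-- If c were positive, 0 would also be a local minimum by the second derivative test. Then φ would
be constant near 0 and c would vanish. -/
theorem isLocalMax (h : Jet2 φ a b c) (hm : IsLocalMax φ 0) : b = 0 ∧ c ≤ 0 := by
  have hb : b = 0 := hm.hasDerivAt_eq_zero h.hasDerivAt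
  refine ⟨hb, ?_⟩
  by_contra hc
  push Not at hc
  have hφc := h.hasDerivAt.continuousAt
  obtain ⟨h0, φ', h1, h2, h3⟩ := h
  have hd : deriv φ =ᶠ[𝓝 0] φ' := by filter_upwards [h1] with t ht using ht.deriv
  have hdd : deriv (deriv φ) 0 = c := by rw [hd.deriv_eq]; exact h3.deriv
  have hmin := isLocalMin_of_deriv_deriv_pos (by rw [hdd]; exact hc)
    (by rw [hd.eq_of_nhds, h2, hb]) hφc
  have hconst : φ =ᶠ[𝓝 0] fun _ => φ 0 := by
    filter_upwards [hm, hmin] with t h4 h5 using le_antisymm h4 h5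
  have hz : φ' =ᶠ[𝓝 0] fun _ => 0 := by
    filter_upwards [h1, hconst.eventually_nhds] with t ht het
    exact ht.unique ((hasDerivAt_const t (φ 0)).congr_of_eventuallyEq het)
  have := (h3.congr_of_eventuallyEq hz.symm).unique (hasDerivAt_const 0 (0 : ℝ))
  linarith

end Jet2

theorem hasDerivAt_line {n : ℕ} (ξ : Euc n) (c : Fin n) (t : ℝ) :
    HasDerivAt (fun t : ℝ => ξ + t • basisVec (n := n) c) (basisVec c) t := by
  simpa using ((hasDerivAt_id t).smul_const (basisVec (n := n) c)).const_add ξ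

theorem jet2_line {n : ℕ} {φ : Euc n → ℝ} {ξ : Euc n} (h : ContDiffAt ℝ 2 φ ξ) (c : Fin n) :
    Jet2 (fun t => φ (ξ + t • basisVec c)) (φ ξ) (pderiv c φ ξ) (pderiv c (pderiv c φ) ξ) := by
  have h0 : ξ + (0 : ℝ) • basisVec (n := n) c = ξ := by simp
  have hl : Tendsto (fun t : ℝ => ξ + t • basisVec (n := n) c) (𝓝 0) (𝓝 ξ) := by
    have := (hasDerivAt_line ξ c 0).continuousAt.tendsto
    rwa [h0] at this
  refine ⟨by simp only [h0], fun t => pderiv c φ (ξ + t • basisVec c), ?_, by simp only [h0], ?_⟩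
  · have h1 : ∀ᶠ z in 𝓝 ξ, DifferentiableAt ℝ φ z := by
      filter_upwards [h.eventually (by simp)] with z hz using hz.differentiableAt (by simp)
    filter_upwards [hl.eventually h1] with t ht
    exact ht.hasFDerivAt.comp_hasDerivAt t (hasDerivAt_line ξ c t)
  · have h1 : DifferentiableAt ℝ (pderiv c φ) ξ := by
      have h2 : ContDiffAt ℝ 1 (fderiv ℝ φ) ξ := h.fderiv_right (by norm_num)
      exact (h2.differentiableAt (by simp)).clm_apply (differentiableAt_const _)
    have h3 : HasFDerivAt (pderiv c φ) (fderiv ℝ (pderiv c φ) ξ) (ξ + (0 : ℝ) • basisVec c) := by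
      rw [h0]; exact h1.hasFDerivAt
    exact h3.comp_hasDerivAt (f := fun t : ℝ => ξ + t • basisVec c) 0 (hasDerivAt_line ξ c 0)

end HeinzEstimate

/-! ### Partial derivatives and bounds uniform over all admissible metrics -/

namespace HeinzEstimate
open Filter Topology

section PartialDerivatives

variable {n : ℕ}

theorem pderiv_congr {φ ψ : Euc n → ℝ} {y : Euc n} (h : φ =ᶠ[𝓝 y] ψ) (j : Fin n) :
    pderiv j φ y = pderiv j ψ y := by
  unfold pderiv; rw [h.fderiv_eq]

theorem pderiv_const (c : ℝ) (j : Fin n) (y : Euc n) : pderiv j (fun _ => c) y = 0 := by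
  simp [pderiv]

theorem pderiv_add {φ ψ : Euc n → ℝ} {y : Euc n} (hφ : DifferentiableAt ℝ φ y)
    (hψ : DifferentiableAt ℝ ψ y) (j : Fin n) :
    pderiv j (fun z => φ z + ψ z) y = pderiv j φ y + pderiv j ψ y := by
  unfold pderiv; rw [fderiv_fun_add hφ hψ]; rfl

theorem pderiv_mul {φ ψ : Euc n → ℝ} {y : Euc n} (hφ : DifferentiableAt ℝ φ y)
    (hψ : DifferentiableAt ℝ ψ y) (j : Fin n) :
    pderiv j (fun z => φ z * ψ z) y = φ y * pderiv j ψ y + ψ y * pderiv j φ y := by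
  unfold pderiv; rw [fderiv_fun_mul hφ hψ]; simp

theorem pderiv_sum {ι : Type*} (s : Finset ι) {φ : ι → Euc n → ℝ} {y : Euc n}
    (hφ : ∀ i ∈ s, DifferentiableAt ℝ (φ i) y) (j : Fin n) :
    pderiv j (fun z => ∑ i ∈ s, φ i z) y = ∑ i ∈ s, pderiv j (φ i) y := by
  unfold pderiv; rw [fderiv_fun_sum hφ]; simp

theorem norm_basisVec (j : Fin n) : ‖basisVec j‖ = 1 := by simp [basisVec]

theorem differentiableAt_det {m : Type*} [Fintype m] [DecidableEq m] {M : Euc n → Matrix m m ℝ}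
    {y : Euc n} (h : ∀ a b, DifferentiableAt ℝ (fun z => M z a b) y) :
    DifferentiableAt ℝ (fun z => (M z).det) y := by
  simp only [Matrix.det_apply]
  exact DifferentiableAt.fun_sum fun σ _ =>
    (HasFDerivAt.finsetProd fun i _ => (h _ _).hasFDerivAt).differentiableAt.const_smul _

theorem differentiableAt_inv_apply {m : Type*} [Fintype m] [DecidableEq m]
    {M : Euc n → Matrix m m ℝ} {y : Euc n} (h : ∀ a b, DifferentiableAt ℝ (fun z => M z a b) y)
    (hdet : (M y).det ≠ 0) (k l : m) : DifferentiableAt ℝ (fun z => (M z)⁻¹ k l) y := by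
  have e : (fun z => (M z)⁻¹ k l)
      = fun z => ((M z).det)⁻¹ * ((M z).updateRow l (Pi.single k 1)).det := by
    funext z
    rw [Matrix.inv_def, Matrix.smul_apply, Matrix.adjugate_apply, Ring.inverse_eq_inv', smul_eq_mul]
  rw [e]
  refine ((differentiableAt_det h).inv hdet).mul (differentiableAt_det fun a b => ?_)
  by_cases ha : a = l
  · subst ha; simp only [Matrix.updateRow_self]; exact differentiableAt_const _
  · simp only [Matrix.updateRow_ne ha]; exact h a b

/-- Differentiate M M⁻¹ = 1 and multiply by M⁻¹ on the left. -/
theorem pderiv_inv_apply {m : Type*} [Fintype m] [DecidableEq m]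
    {M : Euc n → Matrix m m ℝ} {y : Euc n} (h : ∀ a b, DifferentiableAt ℝ (fun z => M z a b) y)
    (hdet : ∀ᶠ z in 𝓝 y, (M z).det ≠ 0) (k l : m) (j : Fin n) :
    pderiv j (fun z => (M z)⁻¹ k l) y
      = -∑ a, ∑ b, (M y)⁻¹ k a * pderiv j (fun z => M z a b) y * (M y)⁻¹ b l := by
  have hd := hdet.self_of_nhds
  have hi := fun a b => differentiableAt_inv_apply h hd a b
  set M' : Matrix m m ℝ := Matrix.of fun a b => pderiv j (fun z => M z a b) y
  set N' : Matrix m m ℝ := Matrix.of fun a b => pderiv j (fun z => (M z)⁻¹ a b) y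
  have hu : IsUnit (M y).det := isUnit_iff_ne_zero.2 hd
  have key : M' * (M y)⁻¹ + M y * N' = 0 := by
    ext a b
    have h1 : (fun z => ∑ c, M z a c * (M z)⁻¹ c b) =ᶠ[𝓝 y] fun _ => (1 : Matrix m m ℝ) a b := by
      filter_upwards [hdet] with z hz
      rw [← Matrix.mul_apply, Matrix.mul_nonsing_inv _ (isUnit_iff_ne_zero.2 hz)]
    have h2 := pderiv_congr h1 j
    rw [pderiv_const, pderiv_sum _ fun c _ => (h a c).fun_mul (hi c b)] at h2
    simp only [fun c => pderiv_mul (h a c) (hi c b) j] at h2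
    rw [Finset.sum_add_distrib] at h2
    rw [Matrix.add_apply, Matrix.mul_apply, Matrix.mul_apply, Matrix.zero_apply, ← h2, add_comm]
    congr 1
    exact Finset.sum_congr rfl fun c _ => mul_comm _ _
  have key2 : N' = -((M y)⁻¹ * M' * (M y)⁻¹) := by
    have h1 : M y * N' = -(M' * (M y)⁻¹) := by
      rw [add_comm] at key; exact eq_neg_of_add_eq_zero_left key
    calc N' = (M y)⁻¹ * (M y * N') := by
          rw [← Matrix.mul_assoc, Matrix.nonsing_inv_mul _ hu, Matrix.one_mul]
      _ = _ := by rw [h1, Matrix.mul_neg, Matrix.mul_assoc]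
  have := congrFun (congrFun key2 k) l
  simp only [N', Matrix.of_apply, Matrix.neg_apply, Matrix.mul_apply] at this
  rw [this, neg_inj, Finset.sum_comm]
  exact Finset.sum_congr rfl fun b _ => by rw [Finset.sum_mul]; rfl

end PartialDerivatives

section UniformBounds

variable {I : Type*} {n : ℕ} {V : I → Set (Euc n)}

/-- The functions `φ i` and their partial derivatives of order at most `k` are bounded on `V i`,
uniformly in `i`. -/
def UBdd (V : I → Set (Euc n)) : ℕ → (I → Euc n → ℝ) → Prop
  | 0, φ => ∃ C : ℝ, ∀ i, ∀ y ∈ V i, |φ i y| ≤ C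
  | k + 1, φ => (∃ C : ℝ, ∀ i, ∀ y ∈ V i, |φ i y| ≤ C) ∧
      (∀ i, ∀ y ∈ V i, DifferentiableAt ℝ (φ i) y) ∧ ∀ j, UBdd V k (fun i => pderiv j (φ i))

namespace UBdd

theorem bdd : ∀ {k : ℕ} {φ : I → Euc n → ℝ}, UBdd V k φ → ∃ C : ℝ, ∀ i, ∀ y ∈ V i, |φ i y| ≤ C
  | 0, _, h => h
  | _ + 1, _, h => h.1

theorem mono : ∀ {k : ℕ} {φ : I → Euc n → ℝ}, UBdd V (k + 1) φ → UBdd V k φ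
  | 0, _, h => h.1
  | _ + 1, _, h => ⟨h.1, h.2.1, fun j => mono (h.2.2 j)⟩

theorem congr (hV : ∀ i, IsOpen (V i)) : ∀ {k : ℕ} {φ ψ : I → Euc n → ℝ}, UBdd V k φ →
    (∀ i, ∀ y ∈ V i, ψ i y = φ i y) → UBdd V k ψ
  | 0, _, _, ⟨C, hC⟩, h => ⟨C, fun i y hy => by rw [h i y hy]; exact hC i y hy⟩
  | k + 1, φ, ψ, ⟨⟨C, hC⟩, hd, hp⟩, h => by
    have he : ∀ i, ∀ y ∈ V i, ψ i =ᶠ[𝓝 y] φ i := fun i y hy => by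
      filter_upwards [(hV i).mem_nhds hy] with z hz using h i z hz
    exact ⟨⟨C, fun i y hy => by rw [h i y hy]; exact hC i y hy⟩,
      fun i y hy => (hd i y hy).congr_of_eventuallyEq (he i y hy),
      fun j => congr hV (hp j) fun i y hy => pderiv_congr (he i y hy) j⟩

theorem const (hV : ∀ i, IsOpen (V i)) : ∀ (k : ℕ) (c : ℝ), UBdd V k (fun _ _ => c)
  | 0, c => ⟨|c|, fun _ _ _ => le_rfl⟩
  | k + 1, c => ⟨⟨|c|, fun _ _ _ => le_rfl⟩, fun _ _ _ => differentiableAt_const _,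
      fun j => (const hV k 0).congr hV fun _ _ _ => pderiv_const c j _⟩

theorem add (hV : ∀ i, IsOpen (V i)) : ∀ {k : ℕ} {φ ψ : I → Euc n → ℝ}, UBdd V k φ → UBdd V k ψ →
    UBdd V k (fun i y => φ i y + ψ i y)
  | 0, _, _, ⟨C, hC⟩, ⟨C', hC'⟩ => ⟨C + C', fun i y hy =>
      (abs_add_le _ _).trans (add_le_add (hC i y hy) (hC' i y hy))⟩
  | _ + 1, _, _, ⟨⟨C, hC⟩, hd, hp⟩, ⟨⟨C', hC'⟩, hd', hp'⟩ =>
      ⟨⟨C + C', fun i y hy => (abs_add_le _ _).trans (add_le_add (hC i y hy) (hC' i y hy))⟩,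
        fun i y hy => (hd i y hy).add (hd' i y hy),
        fun j => (add hV (hp j) (hp' j)).congr hV fun i y hy => pderiv_add (hd i y hy) (hd' i y hy) j⟩

theorem bdd_mul {φ ψ : I → Euc n → ℝ} (h : ∃ C : ℝ, ∀ i, ∀ y ∈ V i, |φ i y| ≤ C)
    (h' : ∃ C : ℝ, ∀ i, ∀ y ∈ V i, |ψ i y| ≤ C) :
    ∃ C : ℝ, ∀ i, ∀ y ∈ V i, |φ i y * ψ i y| ≤ C := by
  obtain ⟨C, hC⟩ := h
  obtain ⟨C', hC'⟩ := h'
  refine ⟨C * C', fun i y hy => ?_⟩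
  rw [abs_mul]
  exact mul_le_mul (hC i y hy) (hC' i y hy) (abs_nonneg _) ((abs_nonneg _).trans (hC i y hy))

theorem mul (hV : ∀ i, IsOpen (V i)) : ∀ {k : ℕ} {φ ψ : I → Euc n → ℝ}, UBdd V k φ → UBdd V k ψ →
    UBdd V k (fun i y => φ i y * ψ i y)
  | 0, _, _, h, h' => bdd_mul h h'
  | _ + 1, _, _, h, h' =>
      ⟨bdd_mul h.1 h'.1, fun i y hy => (h.2.1 i y hy).mul (h'.2.1 i y hy),
        fun j => (add hV (mul hV h.mono (h'.2.2 j)) (mul hV h'.mono (h.2.2 j))).congr hV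
          fun i y hy => pderiv_mul (h.2.1 i y hy) (h'.2.1 i y hy) j⟩

theorem neg (hV : ∀ i, IsOpen (V i)) {k : ℕ} {φ : I → Euc n → ℝ} (h : UBdd V k φ) :
    UBdd V k (fun i y => -φ i y) :=
  ((const hV k (-1)).mul hV h).congr hV fun _ _ _ => (neg_one_mul _).symm

theorem sub (hV : ∀ i, IsOpen (V i)) {k : ℕ} {φ ψ : I → Euc n → ℝ} (h : UBdd V k φ)
    (h' : UBdd V k ψ) : UBdd V k (fun i y => φ i y - ψ i y) :=
  (h.add hV (h'.neg hV)).congr hV fun _ _ _ => sub_eq_add_neg _ _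

theorem sum (hV : ∀ i, IsOpen (V i)) {k : ℕ} {ι : Type*} (s : Finset ι) {φ : ι → I → Euc n → ℝ}
    (h : ∀ a ∈ s, UBdd V k (φ a)) : UBdd V k (fun i y => ∑ a ∈ s, φ a i y) := by
  classical
  induction s using Finset.induction_on with
  | empty => simpa using const hV k 0
  | insert a s ha ih =>
    simp only [Finset.sum_insert ha]
    exact (h a (Finset.mem_insert_self a s)).add hV
      (ih fun b hb => h b (Finset.mem_insert_of_mem hb))

/-- By the formula for the derivative of an inverse, each further derivative of M⁻¹ is a polynomial
in M⁻¹ and derivatives of M. Beyond the bounds on M, a supremum bound on M⁻¹ is therefore enough. -/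
theorem inv_apply (hV : ∀ i, IsOpen (V i)) {m : Type*} [Fintype m] [DecidableEq m]
    {M : I → Euc n → Matrix m m ℝ} (hdet : ∀ i, ∀ y ∈ V i, (M i y).det ≠ 0)
    (hb : ∀ a b, ∃ C : ℝ, ∀ i, ∀ y ∈ V i, |(M i y)⁻¹ a b| ≤ C) :
    ∀ {k : ℕ}, (∀ a b, UBdd V k (fun i y => M i y a b)) →
      ∀ a b, UBdd V k (fun i y => (M i y)⁻¹ a b)
  | 0, _, a, b => hb a b
  | k + 1, h, a, b => by
    have ih := inv_apply hV hdet hb (k := k) fun a b => (h a b).mono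
    refine ⟨hb a b, fun i y hy => differentiableAt_inv_apply (fun a b => (h a b).2.1 i y hy)
      (hdet i y hy) a b, fun j => ?_⟩
    have h1 : UBdd V k (fun i y => -∑ c, ∑ e, (M i y)⁻¹ a c * pderiv j (fun z => M i z c e) y
        * (M i y)⁻¹ e b) :=
      (sum hV _ fun c _ => sum hV _ fun e _ =>
        ((ih a c).mul hV ((h c e).2.2 j)).mul hV (ih e b)).neg hV
    refine h1.congr hV fun i y hy => pderiv_inv_apply (fun a b => (h a b).2.1 i y hy) ?_ a b j
    filter_upwards [(hV i).mem_nhds hy] with z hz using hdet i z hz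

theorem of_iteratedFDeriv (hV : ∀ i, IsOpen (V i)) {C : ℝ} : ∀ {k : ℕ} {φ : I → Euc n → ℝ},
    (∀ i, ContDiffOn ℝ k (φ i) (V i)) →
    (∀ i, ∀ y ∈ V i, ∀ m ≤ k, ‖iteratedFDeriv ℝ m (φ i) y‖ ≤ C) → UBdd V k φ
  | 0, φ, _, h => ⟨C, fun i y hy => by simpa using h i y hy 0 le_rfl⟩
  | k + 1, φ, hc, h => by
    have hca : ∀ i, ∀ y ∈ V i, ContDiffAt ℝ (k + 1) (φ i) y := fun i y hy =>
      (hc i).contDiffAt ((hV i).mem_nhds hy)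
    refine ⟨⟨C, fun i y hy => by simpa using h i y hy 0 (Nat.zero_le _)⟩,
      fun i y hy => (hca i y hy).differentiableAt (by simp), fun j => ?_⟩
    refine of_iteratedFDeriv hV (C := C) (k := k) (φ := fun i => pderiv j (φ i)) (fun i y hy => ?_) fun i y hy m hm => ?_
    · have h1 : ContDiffAt ℝ k (fderiv ℝ (φ i)) y := (hca i y hy).fderiv_right le_rfl
      exact (h1.clm_apply contDiffAt_const).contDiffWithinAt
    · have h1 : ContDiffAt ℝ k (fderiv ℝ (φ i)) y := (hca i y hy).fderiv_right le_rfl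
      have e : pderiv j (φ i)
          = (ContinuousLinearMap.apply ℝ ℝ (basisVec j)) ∘ fderiv ℝ (φ i) := rfl
      rw [e]
      have h2 := ContinuousLinearMap.norm_iteratedFDeriv_comp_left
        (ContinuousLinearMap.apply ℝ ℝ (basisVec j)) (h1.of_le (m := m) (by exact_mod_cast hm))
        le_rfl
      rw [norm_iteratedFDeriv_fderiv] at h2
      have h3 : ‖ContinuousLinearMap.apply ℝ ℝ (basisVec (n := n) j)‖ ≤ 1 := by
        refine ContinuousLinearMap.opNorm_le_bound _ zero_le_one fun L => ?_
        have := L.le_opNorm (basisVec j)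
        rw [norm_basisVec, mul_one] at this
        simpa using this
      have h4 := h i y hy (m + 1) (by omega)
      calc _ ≤ _ := h2
        _ ≤ 1 * ‖iteratedFDeriv ℝ (m + 1) (φ i) y‖ := by gcongr
        _ ≤ C := by rw [one_mul]; exact h4

end UBdd

/-- The pairs consisting of an open set and a metric on it with `C⁴` norm at most `Λ`. -/
def BoundedMetric (n : ℕ) (Λ : ℝ) : Type :=
  {p : Set (Euc n) × (Euc n → Matrix (Fin n) (Fin n) ℝ) // IsOpen p.1 ∧ MetricC4Bound p.1 p.2 Λ}

/-- The component `Rⁱⱼₗₖ` of the Riemann curvature tensor. -/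
noncomputable def riemann {n : ℕ} (g : Euc n → Matrix (Fin n) (Fin n) ℝ)
    (i j l k : Fin n) (y : Euc n) : ℝ :=
  pderiv l (christoffel g i j k) y - pderiv k (christoffel g i l j) y +
    ∑ p, (christoffel g i l p y * christoffel g p j k y
      - christoffel g i k p y * christoffel g p l j y)

theorem ricci_eq_sum_riemann {n : ℕ} (g : Euc n → Matrix (Fin n) (Fin n) ℝ) (j k : Fin n)
    (y : Euc n) : ricci g j k y = ∑ i, riemann g i j i k y := by
  simp only [ricci, riemann, Finset.sum_add_distrib]

/-- Apply the coercivity of g to the column v = g⁻¹ e_b, for which g(v, v) = v_b. Then |v|² ≤ |Λ|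
|v_b|, so |v| ≤ |Λ|. -/
theorem MetricC4Bound.inv_bound {n : ℕ} {Λ : ℝ} {V : Set (Euc n)}
    {g : Euc n → Matrix (Fin n) (Fin n) ℝ} (h : MetricC4Bound V g Λ) {y : Euc n} (hy : y ∈ V)
    (a b : Fin n) : |(g y)⁻¹ a b| ≤ |Λ| := by
  set v : Fin n → ℝ := fun i => (g y)⁻¹ i b with hv
  have hdet : (g y).det ≠ 0 := (h.posDef y hy).det_pos.ne'
  have h1 := h.lower y hy v
  have h2 : ∑ i, ∑ j, g y i j * v i * v j = v b := by
    have : ∀ i, ∑ j, g y i j * v i * v j = v i * (1 : Matrix (Fin n) (Fin n) ℝ) i b := fun i => by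
      rw [← Matrix.mul_nonsing_inv _ (isUnit_iff_ne_zero.2 hdet), Matrix.mul_apply, Finset.mul_sum]
      exact Finset.sum_congr rfl fun j _ => by ring
    simp only [this, Matrix.one_apply]
    simp
  rw [h2] at h1
  have h3 : ∀ c, v c ^ 2 ≤ ∑ i, v i ^ 2 := fun c =>
    Finset.single_le_sum (f := fun i => v i ^ 2) (fun _ _ => sq_nonneg _) (Finset.mem_univ c)
  set S := ∑ i, v i ^ 2
  have hS0 : 0 ≤ S := (sq_nonneg _).trans (h3 b)
  have h4 : S ≤ |Λ| * |v b| := h1.trans (by rw [← abs_mul]; exact le_abs_self _)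
  have h5 : S ≤ Λ ^ 2 := by
    have e1 : S ^ 2 ≤ (|Λ| * |v b|) ^ 2 := by gcongr
    rw [mul_pow, sq_abs, sq_abs] at e1
    have e2 : Λ ^ 2 * v b ^ 2 ≤ Λ ^ 2 * S := by gcongr; exact h3 b
    rcases hS0.eq_or_lt with h0 | h0
    · rw [← h0]; positivity
    · nlinarith
  exact sq_le_sq.1 ((h3 a).trans h5)

section

variable (n : ℕ) (Λ : ℝ)

theorem ubdd_metric (i j : Fin n) :
    UBdd (I := BoundedMetric n Λ) (fun p => p.1.1) 4 (fun p y => p.1.2 y i j) :=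
  UBdd.of_iteratedFDeriv (fun p => p.2.1) (C := Λ) (fun p => p.2.2.contDiffOn i j)
    fun p y hy m hm => p.2.2.norm_le y hy i j m (by exact_mod_cast hm)

theorem ubdd_metric_inv (i j : Fin n) :
    UBdd (I := BoundedMetric n Λ) (fun p => p.1.1) 4 (fun p y => (p.1.2 y)⁻¹ i j) :=
  UBdd.inv_apply (fun p => p.2.1) (fun p y hy => (p.2.2.posDef y hy).det_pos.ne')
    (fun a b => ⟨|Λ|, fun p _ hy => p.2.2.inv_bound hy a b⟩) (ubdd_metric n Λ) i j

theorem ubdd_christoffel (k i j : Fin n) :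
    UBdd (I := BoundedMetric n Λ) (fun p => p.1.1) 3 (fun p => christoffel p.1.2 k i j) := by
  have hV : ∀ p : BoundedMetric n Λ, IsOpen p.1.1 := fun p => p.2.1
  exact (UBdd.const hV 3 (1 / 2)).mul hV (UBdd.sum hV _ fun l _ =>
    (ubdd_metric_inv n Λ k l).mono.mul hV
      ((((ubdd_metric n Λ j l).2.2 i).add hV ((ubdd_metric n Λ i l).2.2 j)).sub hV
        ((ubdd_metric n Λ i j).2.2 l)))

theorem ubdd_riemann (i j l k : Fin n) :
    UBdd (I := BoundedMetric n Λ) (fun p => p.1.1) 2 (fun p => riemann p.1.2 i j l k) := by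
  have hV : ∀ p : BoundedMetric n Λ, IsOpen p.1.1 := fun p => p.2.1
  have hΓ := ubdd_christoffel n Λ
  exact (((hΓ i j k).2.2 l).sub hV ((hΓ i l j).2.2 k)).add hV (UBdd.sum hV _ fun p _ =>
    ((hΓ i l p).mono.mul hV (hΓ p j k).mono).sub hV ((hΓ i k p).mono.mul hV (hΓ p l j).mono))

/-- Curvature uses up two of the four controlled derivatives of the metric. The remaining two are
those needed to differentiate the Gauss equation twice. -/
theorem ubdd_scalarCurvature :
    UBdd (I := BoundedMetric n Λ) (fun p => p.1.1) 2 (fun p => scalarCurvature p.1.2) := by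
  have hV : ∀ p : BoundedMetric n Λ, IsOpen p.1.1 := fun p => p.2.1
  refine UBdd.sum hV _ fun j _ => UBdd.sum hV _ fun k _ =>
    (ubdd_metric_inv n Λ j k).mono.mono.mul hV ?_
  exact (UBdd.sum hV _ fun i _ => ubdd_riemann n Λ i j i k).congr hV fun _ _ _ =>
    ricci_eq_sum_riemann _ _ _ _

end

end UniformBounds
end HeinzEstimate

/-! ### The Gauss equation and the theorema egregium -/

namespace HeinzEstimate
open Filter Topology

section Gauss

variable {n : ℕ} {E : Type*} [NormedAddCommGroup E] [InnerProductSpace ℝ E]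

/-- Partial derivative of a vector valued map. -/
noncomputable def vderiv (i : Fin n) (F : Euc n → E) (y : Euc n) : E := fderiv ℝ F y (basisVec i)

theorem vderiv_congr {F G : Euc n → E} {y : Euc n} (h : F =ᶠ[𝓝 y] G) (j : Fin n) :
    vderiv j F y = vderiv j G y := by
  unfold vderiv; rw [h.fderiv_eq]

theorem pderiv_inner {F G : Euc n → E} {y : Euc n} (hF : DifferentiableAt ℝ F y)
    (hG : DifferentiableAt ℝ G y) (i : Fin n) :
    pderiv i (fun z => inner ℝ (F z) (G z)) y
      = inner ℝ (F y) (vderiv i G y) + inner ℝ (vderiv i F y) (G y) :=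
  fderiv_inner_apply ℝ hF hG _

theorem contDiffAt_vderiv {F : Euc n → E} {y : Euc n} {k m : WithTop ℕ∞}
    (h : ContDiffAt ℝ k F y) (hm : m + 1 ≤ k) (i : Fin n) :
    ContDiffAt ℝ m (vderiv i F) y :=
  (h.fderiv_right hm).clm_apply contDiffAt_const

theorem contDiffAt_pderiv {F : Euc n → ℝ} {y : Euc n} {k m : WithTop ℕ∞}
    (h : ContDiffAt ℝ k F y) (hm : m + 1 ≤ k) (i : Fin n) :
    ContDiffAt ℝ m (pderiv i F) y :=
  (h.fderiv_right hm).clm_apply contDiffAt_const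

theorem vderiv_vderiv {F : Euc n → E} {y : Euc n} (h : ContDiffAt ℝ 2 F y) (i j : Fin n) :
    vderiv i (vderiv j F) y = fderiv ℝ (fderiv ℝ F) y (basisVec i) (basisVec j) := by
  have h2 : ContDiffAt ℝ 1 (fderiv ℝ F) y := h.fderiv_right (by norm_num)
  have h3 := (h2.differentiableAt (by simp)).hasFDerivAt.clm_apply (hasFDerivAt_const (basisVec j) y)
  unfold vderiv
  rw [HasFDerivAt.fderiv h3]
  simp

theorem vderiv_comm {F : Euc n → E} {y : Euc n} (h : ContDiffAt ℝ 2 F y) (i j : Fin n) :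
    vderiv i (vderiv j F) y = vderiv j (vderiv i F) y := by
  rw [vderiv_vderiv h, vderiv_vderiv h]
  exact (h.isSymmSndFDerivAt (by simp)).eq _ _

theorem pderiv_comm {F : Euc n → ℝ} {y : Euc n} (h : ContDiffAt ℝ 2 F y) (i j : Fin n) :
    pderiv i (pderiv j F) y = pderiv j (pderiv i F) y := vderiv_comm h i j

variable {V : Set (Euc n)} {g : Euc n → Matrix (Fin n) (Fin n) ℝ} {X : Euc n → Euc (n + 1)}

theorem IsIsometricImmersion.contDiffAt (hX : IsIsometricImmersion V g X) (hV : IsOpen V)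
    {y : Euc n} (hy : y ∈ V) : ContDiffAt ℝ 4 X y :=
  hX.contDiffOn.contDiffAt (hV.mem_nhds hy)

theorem IsIsometricImmersion.pderiv_metric (hX : IsIsometricImmersion V g X) (hV : IsOpen V)
    {y : Euc n} (hy : y ∈ V) (i j l : Fin n) :
    pderiv i (fun z => g z j l) y = inner ℝ (vderiv i (vderiv j X) y) (vderiv l X y)
      + inner ℝ (vderiv i (vderiv l X) y) (vderiv j X y) := by
  have h1 : (fun z => g z j l) =ᶠ[𝓝 y] fun z => inner ℝ (vderiv j X z) (vderiv l X z) := by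
    filter_upwards [hV.mem_nhds hy] with z hz using hX.isometric z hz j l
  have hd : ∀ k, DifferentiableAt ℝ (vderiv k X) y := fun k =>
    (contDiffAt_vderiv (m := 1) (hX.contDiffAt hV hy) (by norm_num) k).differentiableAt (by simp)
  rw [pderiv_congr h1, pderiv_inner (hd j) (hd l), real_inner_comm, add_comm]

/-- Koszul's computation: each derivative of g is a sum of two inner products, and by the symmetry
of second derivatives four of the six products cancel. -/
theorem IsIsometricImmersion.christoffel_eq (hX : IsIsometricImmersion V g X) (hV : IsOpen V)
    {y : Euc n} (hy : y ∈ V) (k i j : Fin n) :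
    christoffel g k i j y = ∑ l, (g y)⁻¹ k l * inner ℝ (vderiv i (vderiv j X) y) (vderiv l X y) := by
  have hc : ∀ a b, vderiv a (vderiv b X) y = vderiv b (vderiv a X) y := fun a b =>
    vderiv_comm ((hX.contDiffAt hV hy).of_le (by norm_num)) a b
  unfold christoffel
  rw [Finset.mul_sum]
  refine Finset.sum_congr rfl fun l _ => ?_
  rw [hX.pderiv_metric hV hy, hX.pderiv_metric hV hy, hX.pderiv_metric hV hy, hc j i, hc l i, hc l j]
  ring

theorem IsIsometricImmersion.metric_mul_christoffel (hX : IsIsometricImmersion V g X)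
    (hV : IsOpen V) {y : Euc n} (hy : y ∈ V) (hdet : (g y).det ≠ 0) (l i j : Fin n) :
    ∑ k, g y l k * christoffel g k i j y = inner ℝ (vderiv i (vderiv j X) y) (vderiv l X y) := by
  simp only [hX.christoffel_eq hV hy, Finset.mul_sum, ← mul_assoc]
  rw [Finset.sum_comm]
  simp only [← Finset.sum_mul, ← Matrix.mul_apply, Matrix.mul_nonsing_inv _ (isUnit_iff_ne_zero.2 hdet),
    Matrix.one_apply]
  simp

/-- The normal part of the inner product of two second derivatives of the immersion. -/
theorem IsIsometricImmersion.metric_mul_riemann (hX : IsIsometricImmersion V g X)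
    (hV : IsOpen V) (hdet : ∀ z ∈ V, (g z).det ≠ 0) (hg : ∀ a b, ContDiffOn ℝ 4 (fun z => g z a b) V)
    {y : Euc n} (hy : y ∈ V) (m j l k : Fin n) :
    ∑ i, g y m i * riemann g i j l k y
      = (inner ℝ (vderiv j (vderiv k X) y) (vderiv l (vderiv m X) y)
          - ∑ p, inner ℝ (vderiv l (vderiv m X) y) (vderiv p X y) * christoffel g p j k y)
        - (inner ℝ (vderiv l (vderiv j X) y) (vderiv k (vderiv m X) y)
          - ∑ p, inner ℝ (vderiv k (vderiv m X) y) (vderiv p X y) * christoffel g p l j y) := by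
  have hX4 := hX.contDiffAt hV hy
  have hX3 : ∀ a, ContDiffAt ℝ 3 (vderiv a X) y := fun a => contDiffAt_vderiv hX4 (by norm_num) a
  have hX2 : ∀ a b, ContDiffAt ℝ 2 (vderiv a (vderiv b X)) y := fun a b =>
    contDiffAt_vderiv (hX3 b) (by norm_num) a
  have hd1 : ∀ a, DifferentiableAt ℝ (vderiv a X) y := fun a => (hX3 a).differentiableAt (by simp)
  have hd2 : ∀ a b, DifferentiableAt ℝ (vderiv a (vderiv b X)) y := fun a b =>
    (hX2 a b).differentiableAt (by simp)
  have hgd : ∀ a b, DifferentiableAt ℝ (fun z => g z a b) y := fun a b =>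
    ((hg a b).contDiffAt (hV.mem_nhds hy)).differentiableAt (by simp)
  have hΓd : ∀ a b c, DifferentiableAt ℝ (christoffel g a b c) y := by
    intro a b c
    have h1 : christoffel g a b c =ᶠ[𝓝 y] fun z =>
        ∑ l, (g z)⁻¹ a l * inner ℝ (vderiv b (vderiv c X) z) (vderiv l X z) := by
      filter_upwards [hV.mem_nhds hy] with z hz using hX.christoffel_eq hV hz a b c
    refine DifferentiableAt.congr_of_eventuallyEq ?_ h1
    exact DifferentiableAt.fun_sum fun l _ =>
      (differentiableAt_inv_apply hgd (hdet y hy) a l).mul ((hd2 b c).inner ℝ (hd1 l))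
  -- Differentiate ∑ g_{mi} Γⁱ_{jk} = ⟨X_{jk}, X_m⟩ in the direction l. Half of the derivative of
  -- g_{mi} supplies the quadratic term in Γ, the other half goes to the right-hand side.
  have step : ∀ l j k, ∑ i, g y m i * (pderiv l (christoffel g i j k) y
      + ∑ p, christoffel g i l p y * christoffel g p j k y)
      = inner ℝ (vderiv l (vderiv j (vderiv k X)) y) (vderiv m X y)
        + (inner ℝ (vderiv j (vderiv k X) y) (vderiv l (vderiv m X) y)
          - ∑ p, inner ℝ (vderiv l (vderiv m X) y) (vderiv p X y) * christoffel g p j k y) := by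
    intro l j k
    have h1 : (fun z => ∑ i, g z m i * christoffel g i j k z)
        =ᶠ[𝓝 y] fun z => inner ℝ (vderiv j (vderiv k X) z) (vderiv m X z) := by
      filter_upwards [hV.mem_nhds hy] with z hz
        using hX.metric_mul_christoffel hV hz (hdet z hz) m j k
    have h2 := pderiv_congr h1 l
    rw [pderiv_inner (hd2 j k) (hd1 m), pderiv_sum _ fun i _ => (hgd m i).fun_mul (hΓd i j k)] at h2
    simp only [fun i => pderiv_mul (hgd m i) (hΓd i j k) l, hX.pderiv_metric hV hy, mul_add,
      Finset.sum_add_distrib] at h2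
    have h3 : ∑ i, g y m i * ∑ p, christoffel g i l p y * christoffel g p j k y
        = ∑ p, inner ℝ (vderiv l (vderiv p X) y) (vderiv m X y) * christoffel g p j k y := by
      simp only [Finset.mul_sum, ← mul_assoc]
      rw [Finset.sum_comm]
      refine Finset.sum_congr rfl fun p _ => ?_
      rw [← Finset.sum_mul, hX.metric_mul_christoffel hV hy (hdet y hy)]
    simp only [mul_add, Finset.sum_add_distrib]
    rw [h3]
    simp only [mul_comm (christoffel g _ j k y)] at h2
    linarith
  -- Third derivatives of X are symmetric and drop out of the antisymmetrization in l and k.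
  have hsym : vderiv l (vderiv j (vderiv k X)) y = vderiv k (vderiv l (vderiv j X)) y := by
    have e1 : vderiv j (vderiv k X) =ᶠ[𝓝 y] vderiv k (vderiv j X) := by
      filter_upwards [hV.mem_nhds hy] with z hz
        using vderiv_comm ((hX.contDiffAt hV hz).of_le (by norm_num)) j k
    rw [vderiv_congr e1, vderiv_comm ((hX3 j).of_le (by norm_num))]
  have h1 := step l j k
  have h2 := step k l j
  have h3 : ∑ i, g y m i * riemann g i j l k y
      = ∑ i, g y m i * (pderiv l (christoffel g i j k) y
        + ∑ p, christoffel g i l p y * christoffel g p j k y)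
      - ∑ i, g y m i * (pderiv k (christoffel g i l j) y
        + ∑ p, christoffel g i k p y * christoffel g p l j y) := by
    rw [← Finset.sum_sub_distrib]
    refine Finset.sum_congr rfl fun i _ => ?_
    rw [riemann, Finset.sum_sub_distrib]; ring
  rw [h3, h1, h2, hsym]; ring

/-- `ν` spans the orthogonal complement of the tangent space of `X` at `y`. -/
structure IsUnitNormal (X : Euc n → Euc (n + 1)) (y : Euc n) (ν : Euc (n + 1)) : Prop where
  norm : ‖ν‖ = 1
  orth : ∀ v, inner ℝ (fderiv ℝ X y v) ν = 0
  span : ∀ z : Euc (n + 1), (∀ l, inner ℝ z (vderiv l X y) = 0) → z = inner ℝ z ν • ν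

/-- Subtracting ∑ Γᵖ_{jk} X_p from X_{jk} removes the tangential part, so the remainder is a
multiple of ν. -/
theorem IsIsometricImmersion.gauss_aux (hX : IsIsometricImmersion V g X)
    (hV : IsOpen V) {y : Euc n} (hy : y ∈ V) (hdet : (g y).det ≠ 0) {ν : Euc (n + 1)}
    (hν : IsUnitNormal X y ν) (j k l m : Fin n) :
    inner ℝ (vderiv j (vderiv k X) y) (vderiv l (vderiv m X) y)
          - ∑ p, inner ℝ (vderiv l (vderiv m X) y) (vderiv p X y) * christoffel g p j k y
      = inner ℝ (vderiv j (vderiv k X) y) ν * inner ℝ (vderiv l (vderiv m X) y) ν := by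
  set z := vderiv j (vderiv k X) y - ∑ p, christoffel g p j k y • vderiv p X y with hz
  have h1 : z = inner ℝ z ν • ν := by
    refine hν.span z fun l => ?_
    rw [hz, inner_sub_left, sum_inner, ← hX.metric_mul_christoffel hV hy hdet, sub_eq_zero]
    refine Finset.sum_congr rfl fun p _ => ?_
    rw [real_inner_smul_left, hX.isometric y hy l p, real_inner_comm, mul_comm]; rfl
  have h2 : inner ℝ z ν = inner ℝ (vderiv j (vderiv k X) y) ν := by
    rw [hz, inner_sub_left, sum_inner, sub_eq_self]
    refine Finset.sum_eq_zero fun p _ => ?_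
    rw [real_inner_smul_left]
    have := hν.orth (basisVec p)
    rw [vderiv, this, mul_zero]
  have h3 : inner ℝ z (vderiv l (vderiv m X) y) = inner ℝ (vderiv j (vderiv k X) y) (vderiv l (vderiv m X) y)
          - ∑ p, inner ℝ (vderiv l (vderiv m X) y) (vderiv p X y) * christoffel g p j k y := by
    rw [hz, inner_sub_left, sum_inner]
    congr 1
    refine Finset.sum_congr rfl fun p _ => ?_
    rw [real_inner_smul_left, real_inner_comm, mul_comm]
  rw [← h3, h1, real_inner_smul_left, h2, real_inner_comm _ ν]

/-- The Gauss equation. -/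
theorem IsIsometricImmersion.gauss (hX : IsIsometricImmersion V g X)
    (hV : IsOpen V) (hdet : ∀ z ∈ V, (g z).det ≠ 0) (hg : ∀ a b, ContDiffOn ℝ 4 (fun z => g z a b) V)
    {y : Euc n} (hy : y ∈ V) {ν : Euc (n + 1)} (hν : IsUnitNormal X y ν) (m j l k : Fin n) :
    ∑ i, g y m i * riemann g i j l k y
      = inner ℝ (vderiv j (vderiv k X) y) ν * inner ℝ (vderiv l (vderiv m X) y) ν
        - inner ℝ (vderiv l (vderiv j X) y) ν * inner ℝ (vderiv k (vderiv m X) y) ν := by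
  rw [hX.metric_mul_riemann hV hdet hg hy, hX.gauss_aux hV hy (hdet y hy) hν,
    hX.gauss_aux hV hy (hdet y hy) hν]

/-- Theorema egregium: the scalar curvature in terms of the second fundamental form. -/
theorem IsIsometricImmersion.scalarCurvature_eq (hX : IsIsometricImmersion V g X)
    (hV : IsOpen V) (hdet : ∀ z ∈ V, (g z).det ≠ 0) (hg : ∀ a b, ContDiffOn ℝ 4 (fun z => g z a b) V)
    {y : Euc n} (hy : y ∈ V) {ν : Euc (n + 1)} (hν : IsUnitNormal X y ν)
    {h : Matrix (Fin n) (Fin n) ℝ} (hh : ∀ a b, h a b = inner ℝ (vderiv a (vderiv b X) y) ν) :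
    scalarCurvature g y = ((g y)⁻¹ * h).trace ^ 2 - ((g y)⁻¹ * h * ((g y)⁻¹ * h)).trace := by
  have hu : IsUnit (g y).det := isUnit_iff_ne_zero.2 (hdet y hy)
  have hsym : ∀ a b, h a b = h b a := fun a b => by
    rw [hh, hh, vderiv_comm ((hX.contDiffAt hV hy).of_le (by norm_num))]
  have hgs : ∀ a b, g y a b = g y b a := fun a b => by
    rw [hX.isometric y hy, hX.isometric y hy, real_inner_comm]
  have hgT : (g y).transpose = g y := by ext a b; exact hgs b a
  have hgis : ∀ a b, (g y)⁻¹ a b = (g y)⁻¹ b a := fun a b => by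
    have : ((g y)⁻¹).transpose = (g y)⁻¹ := by rw [Matrix.transpose_nonsing_inv, hgT]
    conv_lhs => rw [← this]
    rfl
  have hR : ∀ i j l k, riemann g i j l k y = ∑ m, (g y)⁻¹ i m * (h j k * h l m - h l j * h k m) := by
    intro i j l k
    have h1 : ∀ m, h j k * h l m - h l j * h k m = ∑ i, g y m i * riemann g i j l k y := fun m => by
      rw [hX.gauss hV hdet hg hy hν]; simp only [hh]
    simp only [h1, Finset.mul_sum, ← mul_assoc]
    rw [Finset.sum_comm]
    simp only [← Finset.sum_mul, ← Matrix.mul_apply, Matrix.nonsing_inv_mul _ hu, Matrix.one_apply]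
    simp
  set G := (g y)⁻¹
  have e1 : (G * h).trace = ∑ j, ∑ k, G j k * h j k := by
    simp only [Matrix.trace, Matrix.diag, Matrix.mul_apply]
    exact Finset.sum_congr rfl fun j _ => Finset.sum_congr rfl fun k _ => by rw [hsym]
  have e2 : (G * h * (G * h)).trace = ∑ j, ∑ k, G j k * ∑ i, ∑ m, G i m * (h i j * h k m) := by
    simp only [Matrix.trace, Matrix.diag, Matrix.mul_apply]
    refine Finset.sum_congr rfl fun j _ => ?_
    simp only [Finset.sum_mul_sum]
    rw [Finset.sum_comm]
    refine Finset.sum_congr rfl fun k _ => ?_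
    rw [Finset.sum_comm, Finset.mul_sum]
    refine Finset.sum_congr rfl fun i _ => ?_
    rw [Finset.mul_sum]
    refine Finset.sum_congr rfl fun m _ => ?_
    rw [hgis m i]; ring
  rw [e1, e2, scalarCurvature, sq, Finset.sum_mul, ← Finset.sum_sub_distrib]
  refine Finset.sum_congr rfl fun j _ => ?_
  rw [Finset.sum_mul, ← Finset.sum_sub_distrib]
  refine Finset.sum_congr rfl fun k _ => ?_
  rw [mul_assoc, ← mul_sub, ricci_eq_sum_riemann]
  congr 1
  rw [Finset.mul_sum, ← Finset.sum_sub_distrib]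
  refine Finset.sum_congr rfl fun i _ => ?_
  rw [hR, Finset.mul_sum, ← Finset.sum_sub_distrib]
  refine Finset.sum_congr rfl fun m _ => ?_
  ring

end Gauss
end HeinzEstimate

/-! ### Principal frames and graphs over the tangent plane -/

namespace HeinzEstimate
open Filter Topology

section Frames

variable {n : ℕ}

/-- Simultaneous diagonalization of a symmetric form with respect to a pulled back inner product. -/
theorem exists_diagonalizing_frame {E : Type*} [NormedAddCommGroup E] [InnerProductSpace ℝ E]
    (L : Euc n →L[ℝ] E) (hL : Function.Injective L)
    (B : Euc n →ₗ[ℝ] Euc n →ₗ[ℝ] ℝ) (hB : ∀ v w, B v w = B w v) :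
    ∃ (v : Fin n → Euc n) (κ : Fin n → ℝ),
      (∀ a b, inner ℝ (L (v a)) (L (v b)) = if a = b then (1 : ℝ) else 0) ∧
      (∀ a b, B (v a) (v b) = if a = b then κ a else 0) ∧
      ∀ w, w = ∑ a, inner ℝ (L w) (L (v a)) • v a := by
  set T := LinearMap.range L.toLinearMap with hT
  let e : Euc n ≃ₗ[ℝ] T := LinearEquiv.ofInjective L.toLinearMap hL
  have he : ∀ v, ((e v : T) : E) = L v := fun v => rfl
  have : FiniteDimensional ℝ T := e.finiteDimensional
  have hn : Module.finrank ℝ T = n := by rw [← e.finrank_eq]; simp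
  let b := stdOrthonormalBasis ℝ T
  -- The self-adjoint operator representing the form on the image of L. Its eigenbasis is pulled
  -- back by e.
  let A : T →ₗ[ℝ] T := ∑ i, ((B.flip (e.symm (b i))).comp e.symm.toLinearMap).smulRight (b i)
  have hA : ∀ t s, inner ℝ (A t) s = B (e.symm t) (e.symm s) := by
    intro t s
    have h1 : A t = ∑ i, B (e.symm t) (e.symm (b i)) • b i := by simp [A]
    conv_rhs => rw [← b.sum_repr' s]
    simp only [h1, sum_inner, real_inner_smul_left, map_sum, map_smul, smul_eq_mul]
    exact Finset.sum_congr rfl fun i _ => mul_comm _ _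
  have hsym : A.IsSymmetric := fun t s => by
    rw [hA, real_inner_comm, hA, hB]
  let eb := hsym.eigenvectorBasis hn
  refine ⟨fun a => e.symm (eb a), hsym.eigenvalues hn, fun a b => ?_, fun a b => ?_, fun w => ?_⟩
  · have h1 : ∀ a, L (e.symm (eb a)) = ((eb a : T) : E) := fun a => by rw [← he, e.apply_symm_apply]
    rw [h1, h1, ← Submodule.coe_inner]
    exact orthonormal_iff_ite.1 eb.orthonormal a b
  · rw [← hA, hsym.apply_eigenvectorBasis, inner_smul_left, orthonormal_iff_ite.1 eb.orthonormal a b]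
    split_ifs <;> simp
  · have h1 : e w = ∑ a, inner ℝ (eb a) (e w) • eb a := (eb.sum_repr' (e w)).symm
    have h2 := congrArg e.symm h1
    rw [e.symm_apply_apply, map_sum] at h2
    conv_lhs => rw [h2]
    refine Finset.sum_congr rfl fun a _ => ?_
    rw [map_smul, ← he w, ← he, e.apply_symm_apply, ← Submodule.coe_inner, real_inner_comm]

/-- A local representation of an immersed hypersurface as a graph over its tangent plane, in an
orthonormal frame diagonalizing the second fundamental form. -/
structure TangentGraph (X : Euc n → Euc (n + 1)) (y₀ : Euc n) (v : Fin n → Euc n)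
    (N : Euc (n + 1)) (κ : Fin n → ℝ) (Y : Euc n → Euc n) (U : Euc n → ℝ) : Prop where
  base : Y 0 = y₀
  contDiffAt_param : ContDiffAt ℝ 4 Y 0
  contDiffAt_height : ContDiffAt ℝ 4 U 0
  eq : ∀ᶠ ξ in 𝓝 (0 : Euc n), X (Y ξ) = X y₀ + ∑ a, ξ a • fderiv ℝ X y₀ (v a) + U ξ • N
  inner_frame : ∀ a b, inner ℝ (fderiv ℝ X y₀ (v a)) (fderiv ℝ X y₀ (v b)) = if a = b then (1 : ℝ) else 0
  normal : IsUnitNormal X y₀ N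
  second : ∀ a b, inner ℝ (fderiv ℝ (fderiv ℝ X) y₀ (v a) (v b)) N = if a = b then κ a else 0
  expand : ∀ w, w = ∑ a, inner ℝ (fderiv ℝ X y₀ w) (fderiv ℝ X y₀ (v a)) • v a

/-- The tangential coordinates y ↦ ⟨E_a, X y - X y₀⟩ have an invertible differential at y₀. Y is
their local inverse, and U is the normal component of X ∘ Y - X y₀. -/
theorem exists_tangentGraph {X : Euc n → Euc (n + 1)} {y₀ : Euc n} (hX : ContDiffAt ℝ 4 X y₀)
    (hinj : Function.Injective (fderiv ℝ X y₀)) {N : Euc (n + 1)} (hN : IsUnitNormal X y₀ N) :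
    ∃ v κ Y U, TangentGraph X y₀ v N κ Y U := by
  let B : Euc n →ₗ[ℝ] Euc n →ₗ[ℝ] ℝ := LinearMap.mk₂ ℝ
    (fun v w => inner ℝ (fderiv ℝ (fderiv ℝ X) y₀ v w) N)
    (fun _ _ _ => by simp [inner_add_left]) (fun _ _ _ => by simp [real_inner_smul_left])
    (fun _ _ _ => by simp [inner_add_left]) (fun _ _ _ => by simp [real_inner_smul_left])
  have hB : ∀ v w, B v w = B w v := fun v w => by
    have := ((hX.of_le (by norm_num : (2 : WithTop ℕ∞) ≤ 4)).isSymmSndFDerivAt (by simp)).eq v w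
    simp only [B, LinearMap.mk₂_apply, this]
  obtain ⟨v, κ, h1, h2, h3⟩ := exists_diagonalizing_frame (fderiv ℝ X y₀) hinj B hB
  set E : Fin n → Euc (n + 1) := fun a => fderiv ℝ X y₀ (v a) with hE
  let C : Euc (n + 1) →L[ℝ] Euc n := LinearMap.toContinuousLinearMap
    ((WithLp.linearEquiv 2 ℝ (Fin n → ℝ)).symm.toLinearMap.comp
      (LinearMap.pi fun a => (innerSL ℝ (E a)).toLinearMap))
  have hC : ∀ z a, C z a = inner ℝ (E a) z := fun z a => rfl
  let F : Euc n → Euc n := fun y => C (X y - X y₀)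
  have hF : ContDiffAt ℝ 4 F y₀ := C.contDiff.contDiffAt.comp y₀ (hX.sub contDiffAt_const)
  have hF0 : F y₀ = 0 := by simp [F]
  let L : Euc n →L[ℝ] Euc n := C.comp (fderiv ℝ X y₀)
  have hFd : HasFDerivAt F L y₀ :=
    C.hasFDerivAt.comp y₀ ((hX.differentiableAt (by simp)).hasFDerivAt.sub_const _)
  have hLinj : Function.Injective L.toLinearMap := by
    rw [← LinearMap.ker_eq_bot, LinearMap.ker_eq_bot']
    intro w hw
    rw [h3 w]
    refine Finset.sum_eq_zero fun a _ => ?_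
    have : C (fderiv ℝ X y₀ w) a = 0 := by
      have : C (fderiv ℝ X y₀ w) = 0 := hw
      rw [this]; rfl
    rw [hC] at this
    rw [real_inner_comm, this, zero_smul]
  let Le : Euc n ≃L[ℝ] Euc n := (LinearEquiv.ofInjectiveEndo L.toLinearMap hLinj).toContinuousLinearEquiv
  have hLe : (Le : Euc n →L[ℝ] Euc n) = L := by ext w; rfl
  have hFd' : HasFDerivAt F (Le : Euc n →L[ℝ] Euc n) y₀ := by rw [hLe]; exact hFd
  have h4 : (4 : WithTop ℕ∞) ≠ 0 := by norm_num
  let Y := hF.localInverse hFd' h4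
  have hY4 : ContDiffAt ℝ 4 Y 0 := by
    have := hF.to_localInverse hFd' h4
    rwa [hF0] at this
  have hY0 : Y 0 = y₀ := by
    have := hF.localInverse_apply_image hFd' h4
    rwa [hF0] at this
  have hYr : ∀ᶠ ξ in 𝓝 0, F (Y ξ) = ξ := by
    have := (hF.hasStrictFDerivAt' hFd' h4).eventually_right_inverse
    rwa [hF0] at this
  refine ⟨v, κ, Y, fun ξ => inner ℝ N (X (Y ξ) - X y₀), hY0, hY4, ?_, ?_, h1, hN, h2, h3⟩
  · have hXY : ContDiffAt ℝ 4 (fun ξ => X (Y ξ)) 0 := by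
      refine ContDiffAt.comp (0 : Euc n) (g := X) ?_ hY4
      rw [hY0]; exact hX
    exact contDiffAt_const.inner ℝ (hXY.sub contDiffAt_const)
  · filter_upwards [hYr] with ξ hξ
    set z := X (Y ξ) - X y₀ with hz
    have hξa : ∀ a, ξ a = inner ℝ (E a) z := fun a => by
      rw [← hC]; exact congrFun (congrArg (fun z : Euc n => z.ofLp) hξ.symm) a
    have hzz : z - ∑ a, ξ a • E a = inner ℝ (z - ∑ a, ξ a • E a) N • N := by
      refine hN.span _ fun l => ?_
      have h5 : ∀ b, inner ℝ (z - ∑ a, ξ a • E a) (E b) = 0 := fun b => by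
        rw [inner_sub_left, sum_inner]
        simp only [real_inner_smul_left, hE, h1]
        simp only [mul_ite, mul_one, mul_zero, Finset.sum_ite_eq', Finset.mem_univ, if_true]
        rw [hξa b, real_inner_comm, sub_self]
      have h6 : vderiv l X y₀ = ∑ a, inner ℝ (fderiv ℝ X y₀ (basisVec l)) (E a) • E a := by
        unfold vderiv
        conv_lhs => rw [h3 (basisVec l)]
        simp [hE]
      rw [h6, inner_sum]
      refine Finset.sum_eq_zero fun a _ => ?_
      rw [real_inner_smul_right, h5, mul_zero]
    have h7 : inner ℝ (z - ∑ a, ξ a • E a) N = inner ℝ N z := by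
      rw [inner_sub_left, sum_inner, real_inner_comm, sub_eq_self]
      refine Finset.sum_eq_zero fun a _ => ?_
      rw [real_inner_smul_left, hE]
      simp only [hN.orth, mul_zero]
    rw [h7] at hzz
    have h8 : X (Y ξ) = X y₀ + z := by rw [hz]; abel
    rw [add_assoc, h8]
    congr 1
    rw [← hzz]; abel

end Frames
end HeinzEstimate

/-! ### Derivatives and normals of a tangent graph -/

namespace HeinzEstimate
open Filter Topology

variable {n : ℕ}

theorem eq_sum_smul_basisVec (w : Euc n) : w = ∑ i, w i • basisVec i := by
  ext j
  simp [basisVec, Finset.sum_apply, Pi.single_apply]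

theorem fderiv_apply_eq_sum {E : Type*} [NormedAddCommGroup E] [NormedSpace ℝ E]
    (L : Euc n →L[ℝ] E) (w : Euc n) : L w = ∑ i, w i • L (basisVec i) := by
  conv_lhs => rw [eq_sum_smul_basisVec w]
  simp

namespace TangentGraph

variable {X : Euc n → Euc (n + 1)} {y₀ : Euc n} {v : Fin n → Euc n} {N : Euc (n + 1)}
  {κ : Fin n → ℝ} {Y : Euc n → Euc n} {U : Euc n → ℝ}

theorem height_zero (h : TangentGraph X y₀ v N κ Y U) : U 0 = 0 := by
  have h1 := h.eq.self_of_nhds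
  rw [h.base] at h1
  have h2 : U 0 • N = 0 := by simpa using h1
  rcases smul_eq_zero.1 h2 with h3 | h3
  · exact h3
  · have := h.normal.norm; rw [h3] at this; simp at this

theorem inner_normal_self (h : TangentGraph X y₀ v N κ Y U) : inner ℝ N N = (1 : ℝ) := by
  rw [real_inner_self_eq_norm_sq, h.normal.norm]; norm_num

theorem inner_frame_normal (h : TangentGraph X y₀ v N κ Y U) (a : Fin n) :
    inner ℝ (fderiv ℝ X y₀ (v a)) N = 0 := h.normal.orth _

theorem frame_expand (h : TangentGraph X y₀ v N κ Y U) (z : Euc (n + 1)) :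
    z = ∑ a, inner ℝ z (fderiv ℝ X y₀ (v a)) • fderiv ℝ X y₀ (v a) + inner ℝ z N • N := by
  set E : Fin n → Euc (n + 1) := fun a => fderiv ℝ X y₀ (v a) with hE
  set z' := z - ∑ a, inner ℝ z (E a) • E a with hz'
  have h5 : ∀ b, inner ℝ z' (E b) = 0 := fun b => by
    rw [hz', inner_sub_left, sum_inner]
    simp only [real_inner_smul_left, hE, h.inner_frame]
    simp
  have h6 : z' = inner ℝ z' N • N := h.normal.span z' fun l => by
    have h6 : vderiv l X y₀ = ∑ a, inner ℝ (fderiv ℝ X y₀ (basisVec l)) (E a) • E a := by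
      unfold vderiv
      conv_lhs => rw [h.expand (basisVec l)]
      simp [hE]
    rw [h6, inner_sum]
    refine Finset.sum_eq_zero fun a _ => ?_
    rw [real_inner_smul_right, h5, mul_zero]
  have h7 : inner ℝ z' N = inner ℝ z N := by
    rw [hz', inner_sub_left, sum_inner, sub_eq_self]
    refine Finset.sum_eq_zero fun a _ => ?_
    rw [real_inner_smul_left, hE, h.inner_frame_normal, mul_zero]
  rw [h7] at h6
  change z = ∑ a, inner ℝ z (E a) • E a + inner ℝ z N • N
  rw [← h6, hz']; abel

theorem eventually_contDiffAt (h : TangentGraph X y₀ v N κ Y U) (hX : ContDiffAt ℝ 4 X y₀) :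
    ∀ᶠ ξ in 𝓝 (0 : Euc n), ContDiffAt ℝ 4 X (Y ξ) ∧ ContDiffAt ℝ 4 Y ξ ∧ ContDiffAt ℝ 4 U ξ := by
  have h1 : Tendsto Y (𝓝 0) (𝓝 y₀) := by
    have := h.contDiffAt_param.continuousAt.tendsto
    rwa [h.base] at this
  exact (h1.eventually (hX.eventually (by simp))).and
    ((h.contDiffAt_param.eventually (by simp)).and (h.contDiffAt_height.eventually (by simp)))

theorem eventually_tangent (h : TangentGraph X y₀ v N κ Y U) (hX : ContDiffAt ℝ 4 X y₀) :
    ∀ᶠ ξ in 𝓝 (0 : Euc n), ∀ a, fderiv ℝ X (Y ξ) (vderiv a Y ξ)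
      = fderiv ℝ X y₀ (v a) + pderiv a U ξ • N := by
  filter_upwards [h.eq.eventually_nhds, h.eventually_contDiffAt hX] with ξ hξ ⟨h1, h2, h3⟩ a
  have h4 : HasFDerivAt (fun ξ => X (Y ξ)) ((fderiv ℝ X (Y ξ)).comp (fderiv ℝ Y ξ)) ξ :=
    (h1.differentiableAt (by simp)).hasFDerivAt.comp ξ (h2.differentiableAt (by simp)).hasFDerivAt
  have h5 : HasFDerivAt (fun ξ : Euc n => ∑ a, ξ a • fderiv ℝ X y₀ (v a))
      (∑ a, (EuclideanSpace.proj a : Euc n →L[ℝ] ℝ).smulRight (fderiv ℝ X y₀ (v a))) ξ :=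
    HasFDerivAt.fun_sum fun a _ =>
      (EuclideanSpace.proj a : Euc n →L[ℝ] ℝ).hasFDerivAt.smul_const _
  have h6 := ((hasFDerivAt_const (X y₀) ξ).add h5).add
    ((h3.differentiableAt (by simp)).hasFDerivAt.smul_const N)
  have h7 := (h6.congr_of_eventuallyEq hξ).unique h4
  have h8 := congrArg (fun L => L (basisVec a)) h7
  simp only [ContinuousLinearMap.comp_apply] at h8
  rw [vderiv, ← h8]
  simp [basisVec, pderiv]

theorem eventually_second (h : TangentGraph X y₀ v N κ Y U) (hX : ContDiffAt ℝ 4 X y₀) :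
    ∀ᶠ ξ in 𝓝 (0 : Euc n), ∀ a b, fderiv ℝ (fderiv ℝ X) (Y ξ) (vderiv a Y ξ) (vderiv b Y ξ)
      + fderiv ℝ X (Y ξ) (vderiv a (vderiv b Y) ξ) = pderiv a (pderiv b U) ξ • N := by
  filter_upwards [(h.eventually_tangent hX).eventually_nhds, h.eventually_contDiffAt hX]
    with ξ hξ ⟨h1, h2, h3⟩ a b
  have h4 : HasFDerivAt (fderiv ℝ X) (fderiv ℝ (fderiv ℝ X) (Y ξ)) (Y ξ) :=
    ((h1.fderiv_right (m := 1) (by norm_num)).differentiableAt (by simp)).hasFDerivAt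
  have h5 := (h4.comp ξ (h2.differentiableAt (by simp)).hasFDerivAt).clm_apply
    ((contDiffAt_vderiv (m := 1) h2 (by norm_num) b).differentiableAt (by simp)).hasFDerivAt
  have h6 : HasFDerivAt (fun ξ => fderiv ℝ X y₀ (v b) + pderiv b U ξ • N) _ ξ :=
    (((contDiffAt_pderiv (m := 1) h3 (by norm_num) b).differentiableAt
      (by simp)).hasFDerivAt.smul_const N).const_add _
  have h7 := (h6.congr_of_eventuallyEq (hξ.mono fun z hz => hz b)).unique h5
  have h8 := congrArg (fun L => L (basisVec a)) h7
  simp only [add_apply, ContinuousLinearMap.comp_apply,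
    ContinuousLinearMap.flip_apply, ContinuousLinearMap.smulRight_apply] at h8
  rw [pderiv, h8]
  simp only [vderiv, Function.comp_apply, add_comm]

theorem pderiv_height_zero (h : TangentGraph X y₀ v N κ Y U) (hX : ContDiffAt ℝ 4 X y₀)
    (a : Fin n) : pderiv a U 0 = 0 := by
  have h1 := (h.eventually_tangent hX).self_of_nhds a
  rw [h.base] at h1
  have h2 := congrArg (fun z => inner ℝ z N) h1
  simp only [inner_add_left, real_inner_smul_left, h.inner_normal_self, h.normal.orth] at h2
  linarith

theorem vderiv_param_zero (h : TangentGraph X y₀ v N κ Y U) (hX : ContDiffAt ℝ 4 X y₀)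
    (a : Fin n) : vderiv a Y 0 = v a := by
  have h1 := (h.eventually_tangent hX).self_of_nhds a
  rw [h.base, h.pderiv_height_zero hX, zero_smul, add_zero] at h1
  rw [h.expand (vderiv a Y 0), h1]
  exact (h.expand (v a)).symm

theorem second_height_zero (h : TangentGraph X y₀ v N κ Y U) (hX : ContDiffAt ℝ 4 X y₀)
    (a b : Fin n) : pderiv a (pderiv b U) 0 = if a = b then κ a else 0 := by
  have h1 := (h.eventually_second hX).self_of_nhds a b
  rw [h.base, h.vderiv_param_zero hX, h.vderiv_param_zero hX] at h1
  have h2 := congrArg (fun z => inner ℝ z N) h1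
  simp only [inner_add_left, real_inner_smul_left, h.inner_normal_self, h.normal.orth, h.second] at h2
  linarith

/-- Take the tangential part of D²X(v_a, v_b) + DX(Y_{ab}) = U_{ab} N. The inner products that
appear are intrinsic, so the second derivatives of Y stay bounded however large the curvatures are.
-/
theorem second_param_zero (h : TangentGraph X y₀ v N κ Y U) (hX : ContDiffAt ℝ 4 X y₀)
    (a b : Fin n) : vderiv a (vderiv b Y) 0
      = -∑ c, inner ℝ (fderiv ℝ (fderiv ℝ X) y₀ (v a) (v b)) (fderiv ℝ X y₀ (v c)) • v c := by
  have h1 := (h.eventually_second hX).self_of_nhds a b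
  rw [h.base, h.vderiv_param_zero hX, h.vderiv_param_zero hX] at h1
  conv_lhs => rw [h.expand (vderiv a (vderiv b Y) 0)]
  rw [← Finset.sum_neg_distrib]
  refine Finset.sum_congr rfl fun c _ => ?_
  rw [← eq_sub_iff_add_eq'] at h1
  rw [h1, inner_sub_left, real_inner_smul_left, real_inner_comm, h.inner_frame_normal]
  simp

/-- The (unnormalized) normal `N - ∑ₐ Uₐ Eₐ` along the tangent graph. -/
noncomputable def conormal (X : Euc n → Euc (n + 1)) (y₀ : Euc n) (v : Fin n → Euc n)
    (N : Euc (n + 1)) (U : Euc n → ℝ) (ξ : Euc n) : Euc (n + 1) :=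
  N - ∑ a, pderiv a U ξ • fderiv ℝ X y₀ (v a)

/-- The squared length `1 + |∇U|²` of the conormal. -/
noncomputable def areaSq (U : Euc n → ℝ) (ξ : Euc n) : ℝ := 1 + ∑ a, pderiv a U ξ ^ 2

theorem areaSq_pos (U : Euc n → ℝ) (ξ : Euc n) : 0 < areaSq U ξ := by
  unfold areaSq; positivity

theorem inner_conormal (h : TangentGraph X y₀ v N κ Y U) (ξ : Euc n) :
    (∀ a, inner ℝ (fderiv ℝ X y₀ (v a)) (conormal X y₀ v N U ξ) = -pderiv a U ξ) ∧
      inner ℝ N (conormal X y₀ v N U ξ) = 1 ∧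
      inner ℝ (conormal X y₀ v N U ξ) (conormal X y₀ v N U ξ) = areaSq U ξ := by
  have h1 : ∀ a, inner ℝ (fderiv ℝ X y₀ (v a)) (conormal X y₀ v N U ξ) = -pderiv a U ξ := fun a => by
    simp [conormal, inner_sub_right, inner_sum, real_inner_smul_right, h.inner_frame,
      h.inner_frame_normal]
  have h2 : inner ℝ N (conormal X y₀ v N U ξ) = 1 := by
    have h3 : ∀ a, inner ℝ N (fderiv ℝ X y₀ (v a)) = 0 := fun a => by
      rw [real_inner_comm, h.inner_frame_normal]
    simp [conormal, inner_sub_right, inner_sum, real_inner_smul_right, h.normal.norm, h3]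
  refine ⟨h1, h2, ?_⟩
  conv_lhs => enter [2]; rw [conormal]
  rw [inner_sub_left, h2, sum_inner]
  simp only [real_inner_smul_left, h1, areaSq, mul_neg, Finset.sum_neg_distrib, sub_neg_eq_add, sq]

/-- The matrix of tangential components of DX is a left inverse of the Jacobian of Y. Both are
square, so it is also a right inverse. -/
theorem eventually_expand (h : TangentGraph X y₀ v N κ Y U) (hX : ContDiffAt ℝ 4 X y₀) :
    ∀ᶠ ξ in 𝓝 (0 : Euc n), ∀ w,
      w = ∑ a, inner ℝ (fderiv ℝ X (Y ξ) w) (fderiv ℝ X y₀ (v a)) • vderiv a Y ξ := by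
  filter_upwards [h.eventually_tangent hX] with ξ hξ w
  let J : Matrix (Fin n) (Fin n) ℝ := Matrix.of fun i a => vderiv a Y ξ i
  let L : Matrix (Fin n) (Fin n) ℝ := Matrix.of fun a i =>
    inner ℝ (fderiv ℝ X (Y ξ) (basisVec i)) (fderiv ℝ X y₀ (v a))
  have hL : ∀ w : Euc n, ∀ a, ∑ i, L a i * w i
      = inner ℝ (fderiv ℝ X (Y ξ) w) (fderiv ℝ X y₀ (v a)) := fun w a => by
    rw [fderiv_apply_eq_sum (fderiv ℝ X (Y ξ)) w, sum_inner]
    simp only [real_inner_smul_left]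
    exact Finset.sum_congr rfl fun i _ => mul_comm _ _
  have hLJ : L * J = 1 := by
    ext a b
    rw [Matrix.mul_apply]
    have := hL (vderiv b Y ξ) a
    simp only [J, Matrix.of_apply]
    rw [this, hξ b, inner_add_left, real_inner_smul_left, h.inner_frame, real_inner_comm,
      h.inner_frame_normal, Matrix.one_apply]
    simp [eq_comm]
  have hJL : J * L = 1 := mul_eq_one_comm.1 hLJ
  ext j
  have h1 : ∑ i, (J * L) j i * w i = w j := by rw [hJL]; simp [Matrix.one_apply]
  rw [← h1]
  simp only [Matrix.mul_apply, Finset.sum_mul]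
  rw [Finset.sum_comm]
  simp only [mul_assoc, ← Finset.mul_sum, hL]
  simp [J, mul_comm]

theorem eventually_normal (h : TangentGraph X y₀ v N κ Y U) (hX : ContDiffAt ℝ 4 X y₀) :
    ∀ᶠ ξ in 𝓝 (0 : Euc n), (∀ w, inner ℝ (fderiv ℝ X (Y ξ) w) (conormal X y₀ v N U ξ) = 0) ∧
      ∀ z, (∀ w, inner ℝ z (fderiv ℝ X (Y ξ) w) = 0) →
        z = inner ℝ z N • conormal X y₀ v N U ξ := by
  filter_upwards [h.eventually_tangent hX, h.eventually_expand hX] with ξ hξ hw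
  obtain ⟨h1, h2, -⟩ := h.inner_conormal ξ
  refine ⟨fun w => ?_, fun z hz => ?_⟩
  · rw [hw w, map_sum, sum_inner]
    refine Finset.sum_eq_zero fun a _ => ?_
    rw [map_smul, hξ, real_inner_smul_left, inner_add_left, real_inner_smul_left, h1, h2]
    ring
  · have h3 : ∀ a, inner ℝ z (fderiv ℝ X y₀ (v a)) = -(inner ℝ z N * pderiv a U ξ) := fun a => by
      have := hz (vderiv a Y ξ)
      rw [hξ, inner_add_right, real_inner_smul_right] at this
      linarith
    conv_lhs => rw [h.frame_expand z]
    simp only [h3, conormal, smul_sub, Finset.smul_sum, smul_smul, neg_smul, Finset.sum_neg_distrib]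
    abel

end TangentGraph
end HeinzEstimate

/-! ### The scalar curvature of a graph -/

namespace HeinzEstimate
open Filter Topology

variable {n : ℕ}

theorem bilin_apply_eq_sum {E : Type*} [NormedAddCommGroup E] [NormedSpace ℝ E]
    (B : Euc n →L[ℝ] Euc n →L[ℝ] E) (p q : Euc n) :
    B p q = ∑ i, ∑ j, (p i * q j) • B (basisVec i) (basisVec j) := by
  rw [fderiv_apply_eq_sum B p]
  simp only [sum_apply, smul_apply]
  refine Finset.sum_congr rfl fun i _ => ?_
  rw [fderiv_apply_eq_sum (B (basisVec i)) q, Finset.smul_sum]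
  simp only [smul_smul]

/-- The entries of `G⁻¹ D²U` where `G = 1 + ∇U ∇Uᵀ` is the metric of the graph of `U`. -/
noncomputable def raisedHessian (U : Euc n → ℝ) (a b : Fin n) (ξ : Euc n) : ℝ :=
  pderiv a (pderiv b U) ξ
    - pderiv a U ξ * (∑ c, pderiv c U ξ * pderiv c (pderiv b U) ξ) / TangentGraph.areaSq U ξ

/-- Sherman–Morrison: the inverse of 1 + ppᵀ is 1 - ppᵀ/(1 + |p|²). -/
theorem sum_metric_mul_raisedHessian (U : Euc n → ℝ) (a b : Fin n) (ξ : Euc n) :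
    ∑ c, ((if a = c then (1 : ℝ) else 0) + pderiv a U ξ * pderiv c U ξ) * raisedHessian U c b ξ
      = pderiv a (pderiv b U) ξ := by
  have hW := (TangentGraph.areaSq_pos U ξ).ne'
  set W := TangentGraph.areaSq U ξ with hWd
  set z := ∑ c, pderiv c U ξ * pderiv c (pderiv b U) ξ with hz
  have h1 : ∑ c, pderiv c U ξ * raisedHessian U c b ξ = z / W := by
    have : ∀ c, pderiv c U ξ * raisedHessian U c b ξ
        = pderiv c U ξ * pderiv c (pderiv b U) ξ - pderiv c U ξ ^ 2 * (z / W) := fun c => by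
      rw [raisedHessian, ← hz, ← hWd]; ring
    simp only [this, Finset.sum_sub_distrib, ← Finset.sum_mul, ← hz]
    have h2 : ∑ c, pderiv c U ξ ^ 2 = W - 1 := by rw [hWd, TangentGraph.areaSq]; ring
    rw [h2]; field_simp; ring
  simp only [add_mul, Finset.sum_add_distrib, mul_assoc, ← Finset.mul_sum, h1]
  simp only [ite_mul, one_mul, zero_mul, Finset.sum_ite_eq, Finset.mem_univ, if_true]
  rw [raisedHessian, ← hz, ← hWd]; ring

namespace TangentGraph

variable {X : Euc n → Euc (n + 1)} {y₀ : Euc n} {v : Fin n → Euc n} {N : Euc (n + 1)}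
  {κ : Fin n → ℝ} {Y : Euc n → Euc n} {U : Euc n → ℝ}

theorem isUnitNormal_conormal (h : TangentGraph X y₀ v N κ Y U) {ξ : Euc n}
    (h1 : ∀ w, inner ℝ (fderiv ℝ X (Y ξ) w) (conormal X y₀ v N U ξ) = 0)
    (h2 : ∀ z, (∀ w, inner ℝ z (fderiv ℝ X (Y ξ) w) = 0) →
        z = inner ℝ z N • conormal X y₀ v N U ξ) :
    IsUnitNormal X (Y ξ) ((√(areaSq U ξ))⁻¹ • conormal X y₀ v N U ξ) := by
  have hW := areaSq_pos U ξ
  have hs := Real.sq_sqrt hW.le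
  have hs0 : √(areaSq U ξ) ≠ 0 := (Real.sqrt_pos.2 hW).ne'
  obtain ⟨-, -, h3⟩ := h.inner_conormal ξ
  refine ⟨?_, fun w => ?_, fun z hz => ?_⟩
  · rw [norm_smul, norm_eq_sqrt_real_inner (conormal X y₀ v N U ξ), h3, norm_inv, Real.norm_of_nonneg (Real.sqrt_nonneg _),
      inv_mul_cancel₀ hs0]
  · rw [real_inner_smul_right, h1, mul_zero]
  · have h4 := h2 z fun w => by
      rw [fderiv_apply_eq_sum, inner_sum]
      exact Finset.sum_eq_zero fun i _ => by
        rw [real_inner_smul_right]; exact mul_eq_zero_of_right _ (hz i)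
    have h5 : inner ℝ z (conormal X y₀ v N U ξ) = inner ℝ z N * areaSq U ξ := by
      conv_lhs => rw [h4, real_inner_smul_left, h3]
    rw [real_inner_smul_right, smul_smul, h5]
    conv_lhs => rw [h4]
    congr 1
    field_simp
    rw [hs]

/-- In the coordinates ξ the second fundamental form is D²U/√(1 + |∇U|²). The Jacobian of Y
conjugates g⁻¹b to P/√(1 + |∇U|²), so the traces in `IsIsometricImmersion.scalarCurvature_eq` are
those of P. -/
theorem eventually_scalarCurvature {V : Set (Euc n)} {g : Euc n → Matrix (Fin n) (Fin n) ℝ}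
    (h : TangentGraph X y₀ v N κ Y U) (hX : IsIsometricImmersion V g X)
    (hV : IsOpen V) (hdet : ∀ z ∈ V, (g z).det ≠ 0) (hg : ∀ a b, ContDiffOn ℝ 4 (fun z => g z a b) V)
    (hy : y₀ ∈ V) :
    ∀ᶠ ξ in 𝓝 (0 : Euc n), scalarCurvature g (Y ξ) * areaSq U ξ
      = (∑ a, raisedHessian U a a ξ) ^ 2
        - ∑ a, ∑ b, raisedHessian U a b ξ * raisedHessian U b a ξ := by
  have hXy := hX.contDiffAt hV hy
  have hYt : Tendsto Y (𝓝 0) (𝓝 y₀) := by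
    have := h.contDiffAt_param.continuousAt.tendsto
    rwa [h.base] at this
  filter_upwards [h.eventually_tangent hXy, h.eventually_second hXy, h.eventually_expand hXy,
    h.eventually_normal hXy, hYt.eventually (hV.mem_nhds hy)] with ξ h1 h2 h3 ⟨h4, h5⟩ hyV
  have hν := h.isUnitNormal_conormal h4 h5
  set W := √(areaSq U ξ) with hWdef
  have hA := areaSq_pos U ξ
  have hW : W ≠ 0 := (Real.sqrt_pos.2 hA).ne'
  have hW2 : W ^ 2 = areaSq U ξ := Real.sq_sqrt hA.le
  set ν := W⁻¹ • conormal X y₀ v N U ξ with hνd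
  let b : Matrix (Fin n) (Fin n) ℝ := Matrix.of fun i j => inner ℝ (vderiv i (vderiv j X) (Y ξ)) ν
  rw [hX.scalarCurvature_eq hV hdet hg hyV hν (h := b) (fun _ _ => rfl)]
  let J : Matrix (Fin n) (Fin n) ℝ := Matrix.of fun i a => vderiv a Y ξ i
  let L : Matrix (Fin n) (Fin n) ℝ := Matrix.of fun a i =>
    inner ℝ (fderiv ℝ X (Y ξ) (basisVec i)) (fderiv ℝ X y₀ (v a))
  let P : Matrix (Fin n) (Fin n) ℝ := Matrix.of fun a b => raisedHessian U a b ξ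
  have hJL : J * L = 1 := by
    ext j i
    have := congrArg (fun w : Euc n => w j) (h3 (basisVec i))
    simp only [WithLp.ofLp_sum, Finset.sum_apply, PiLp.smul_apply, smul_eq_mul] at this
    rw [Matrix.mul_apply, Matrix.one_apply]
    simp only [J, L, Matrix.of_apply, mul_comm (vderiv _ Y ξ j)]
    rw [← this]
    simp [basisVec]
  have hLJ : L * J = 1 := mul_eq_one_comm.1 hJL
  have hG : J.transpose * g (Y ξ) * J
      = Matrix.of fun a c => (if a = c then (1 : ℝ) else 0) + pderiv a U ξ * pderiv c U ξ := by
    ext a c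
    have e1 : inner ℝ (fderiv ℝ X (Y ξ) (vderiv a Y ξ)) (fderiv ℝ X (Y ξ) (vderiv c Y ξ))
        = (if a = c then (1 : ℝ) else 0) + pderiv a U ξ * pderiv c U ξ := by
      rw [h1, h1]
      simp only [inner_add_left, inner_add_right, real_inner_smul_left, real_inner_smul_right,
        h.inner_frame, h.inner_normal_self, h.inner_frame_normal, real_inner_comm _ N]
      ring
    rw [Matrix.of_apply, ← e1, fderiv_apply_eq_sum _ (vderiv a Y ξ),
      fderiv_apply_eq_sum _ (vderiv c Y ξ), sum_inner]
    simp only [inner_sum, real_inner_smul_left, real_inner_smul_right, ← hX.isometric _ hyV]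
    simp only [Matrix.mul_apply, Finset.sum_mul, Matrix.transpose_apply]
    rw [Finset.sum_comm]
    refine Finset.sum_congr rfl fun i _ => Finset.sum_congr rfl fun j _ => ?_
    simp only [J, Matrix.of_apply]; ring
  have hB : J.transpose * b * J = W⁻¹ • Matrix.of fun a c => pderiv a (pderiv c U) ξ := by
    ext a c
    have e1 : inner ℝ (fderiv ℝ (fderiv ℝ X) (Y ξ) (vderiv a Y ξ) (vderiv c Y ξ)) ν
        = W⁻¹ * pderiv a (pderiv c U) ξ := by
      have e2 := congrArg (fun z => inner ℝ z ν) (h2 a c)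
      simp only [inner_add_left, hν.orth, add_zero, real_inner_smul_left] at e2
      rw [e2, hνd, real_inner_smul_right, (h.inner_conormal ξ).2.1]; ring
    rw [Matrix.smul_apply, Matrix.of_apply, smul_eq_mul, ← e1, bilin_apply_eq_sum, sum_inner]
    simp only [sum_inner, real_inner_smul_left]
    simp only [Matrix.mul_apply, Finset.sum_mul, Matrix.transpose_apply]
    rw [Finset.sum_comm]
    refine Finset.sum_congr rfl fun i _ => Finset.sum_congr rfl fun j _ => ?_
    simp only [J, b, Matrix.of_apply]
    rw [vderiv_vderiv ((hX.contDiffAt hV hyV).of_le (by norm_num))]; ring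
  have hGP : J.transpose * g (Y ξ) * J * P = Matrix.of fun a c => pderiv a (pderiv c U) ξ := by
    rw [hG]; ext a c
    rw [Matrix.mul_apply]
    exact sum_metric_mul_raisedHessian U a c ξ
  have hT : L.transpose * J.transpose = 1 := by
    rw [← Matrix.transpose_mul, hJL, Matrix.transpose_one]
  have hgJ : g (Y ξ) * (J * (W⁻¹ • P) * L) = b := by
    have e1 : J.transpose * (g (Y ξ) * J * (W⁻¹ • P)) = J.transpose * (b * J) := by
      rw [← Matrix.mul_assoc, ← Matrix.mul_assoc, ← Matrix.mul_assoc J.transpose b, hB, ← hGP, Matrix.mul_smul]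
    have e2 := congrArg (fun M => L.transpose * M) e1
    simp only [← Matrix.mul_assoc, hT, Matrix.one_mul] at e2
    rw [← Matrix.mul_assoc, ← Matrix.mul_assoc, e2, Matrix.mul_assoc, hJL, Matrix.mul_one]
  have hgb : (g (Y ξ))⁻¹ * b = J * (W⁻¹ • P) * L := by
    rw [← hgJ, ← Matrix.mul_assoc, Matrix.nonsing_inv_mul _ (isUnit_iff_ne_zero.2 (hdet _ hyV)),
      Matrix.one_mul]
  have hgb2 : J * (W⁻¹ • P) * L * (J * (W⁻¹ • P) * L) = J * ((W⁻¹ • P) * (W⁻¹ • P)) * L := by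
    calc _ = J * (W⁻¹ • P) * (L * J) * (W⁻¹ • P) * L := by simp only [Matrix.mul_assoc]
      _ = _ := by rw [hLJ, Matrix.mul_one]; simp only [Matrix.mul_assoc]
  have htr : ∀ M : Matrix (Fin n) (Fin n) ℝ, (J * M * L).trace = M.trace := fun M => by
    rw [Matrix.mul_assoc, Matrix.trace_mul_comm, Matrix.mul_assoc, hLJ, Matrix.mul_one]
  rw [hgb, hgb2, htr, htr, Matrix.smul_mul, Matrix.mul_smul, Matrix.trace_smul, Matrix.trace_smul,
    Matrix.trace_smul, ← hW2]
  have hP1 : P.trace = ∑ a, raisedHessian U a a ξ := rfl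
  have hP2 : (P * P).trace = ∑ a, ∑ b, raisedHessian U a b ξ * raisedHessian U b a ξ := by
    simp [Matrix.trace, Matrix.mul_apply, P]
  rw [← hP1, ← hP2, smul_eq_mul, smul_eq_mul, smul_eq_mul]
  field_simp

end TangentGraph
end HeinzEstimate

/-! ### The two-jet of the Gauss equation -/

namespace HeinzEstimate
open Filter Topology

variable {n : ℕ}

theorem hasDerivAt_comp_line {E : Type*} [NormedAddCommGroup E] [InnerProductSpace ℝ E] {F : Euc n → E}
    {ξ : Euc n} {c : Fin n} {t : ℝ} (h : DifferentiableAt ℝ F (ξ + t • basisVec c)) :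
    HasDerivAt (fun t : ℝ => F (ξ + t • basisVec c)) (vderiv c F (ξ + t • basisVec c)) t :=
  h.hasFDerivAt.comp_hasDerivAt t (hasDerivAt_line ξ c t)

theorem hasDerivAt_euc_apply {γ : ℝ → Euc n} {γ' : Euc n} {t : ℝ} (h : HasDerivAt γ γ' t)
    (j : Fin n) : HasDerivAt (fun t => γ t j) (γ' j) t :=
  (EuclideanSpace.proj j : Euc n →L[ℝ] ℝ).hasFDerivAt.comp_hasDerivAt t h

theorem tendsto_line (ξ : Euc n) (c : Fin n) :
    Tendsto (fun t : ℝ => ξ + t • basisVec (n := n) c) (𝓝 0) (𝓝 ξ) := by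
  have := (hasDerivAt_line ξ c 0).continuousAt.tendsto
  simpa using this

theorem hasDerivAt_comp_curve {φ : Euc n → ℝ} {γ : ℝ → Euc n} {γ' : Euc n} {t : ℝ}
    (hφ : DifferentiableAt ℝ φ (γ t)) (hγ : HasDerivAt γ γ' t) :
    HasDerivAt (fun t => φ (γ t)) (∑ j, γ' j * pderiv j φ (γ t)) t := by
  have h := hφ.hasFDerivAt.comp_hasDerivAt t hγ
  rw [fderiv_apply_eq_sum] at h
  exact h

/-- The regularity asked of φ is what `ubdd_scalarCurvature` provides for the scalar curvature:
differentiability nearby, and differentiable first partials at the point. -/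
theorem jet2_comp_line {φ : Euc n → ℝ} {Y : Euc n → Euc n} (hY : ContDiffAt ℝ 2 Y 0)
    (hφ : ∀ᶠ z in 𝓝 (Y 0), DifferentiableAt ℝ φ z)
    (hφ' : ∀ j, DifferentiableAt ℝ (pderiv j φ) (Y 0)) (c : Fin n) :
    Jet2 (fun t => φ (Y (0 + t • basisVec c))) (φ (Y 0)) (∑ j, vderiv c Y 0 j * pderiv j φ (Y 0))
      (∑ j, (vderiv c (vderiv c Y) 0 j * pderiv j φ (Y 0)
        + vderiv c Y 0 j * ∑ k, vderiv c Y 0 k * pderiv k (pderiv j φ) (Y 0))) := by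
  have h0 : (0 : Euc n) + (0 : ℝ) • basisVec (n := n) c = 0 := by simp
  have hl := tendsto_line (0 : Euc n) c
  refine ⟨by simp only [h0], fun t => ∑ j, vderiv c Y (0 + t • basisVec c) j *
    pderiv j φ (Y (0 + t • basisVec c)), ?_, by simp only [h0], ?_⟩
  · filter_upwards [(hY.continuousAt.tendsto.comp hl).eventually hφ,
      hl.eventually (hY.eventually (by simp))] with t ht htY
    exact hasDerivAt_comp_curve (γ := fun t => Y (0 + t • basisVec c)) ht
      (hasDerivAt_comp_line (htY.differentiableAt (by simp)))
  · have hY0 : ContDiffAt ℝ 2 Y (0 + (0 : ℝ) • basisVec c) := by rw [h0]; exact hY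
    have h1 := hasDerivAt_comp_line (c := c) (t := 0) (hY0.differentiableAt (by simp))
    have h2 := hasDerivAt_comp_line (c := c) (t := 0)
      ((contDiffAt_vderiv (m := 1) hY0 (by norm_num) c).differentiableAt (by simp))
    have h3 : ∀ j, HasDerivAt (fun t : ℝ => pderiv j φ (Y (0 + t • basisVec c))) _ 0 := fun j =>
      hasDerivAt_comp_curve (γ := fun t => Y (0 + t • basisVec c)) (t := 0)
        (by simp only [h0]; exact hφ' j) h1
    have h4 := HasDerivAt.fun_sum (u := Finset.univ) fun j (_ : j ∈ Finset.univ) =>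
      (hasDerivAt_euc_apply h2 j).mul (h3 j)
    simp only [h0] at h4
    exact h4

/-- The third derivative `∂_c ∂_a ∂_b U` at the origin. -/
noncomputable def thirdDeriv (U : Euc n → ℝ) (a b c : Fin n) : ℝ := pderiv c (pderiv a (pderiv b U)) 0

/-- The fourth derivative `∂_c ∂_c ∂_a ∂_a U` at the origin. -/
noncomputable def fourthDeriv (U : Euc n → ℝ) (a c : Fin n) : ℝ :=
  pderiv c (pderiv c (pderiv a (pderiv a U))) 0

theorem eventually_pderiv_comm {U : Euc n → ℝ} {ξ : Euc n} (hU : ContDiffAt ℝ 2 U ξ) (a b : Fin n) :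
    pderiv a (pderiv b U) =ᶠ[𝓝 ξ] pderiv b (pderiv a U) := by
  filter_upwards [hU.eventually (by simp)] with z hz using pderiv_comm hz a b

theorem pderiv_congr_eventually {φ ψ : Euc n → ℝ} {ξ : Euc n} (h : φ =ᶠ[𝓝 ξ] ψ) (j : Fin n) :
    pderiv j φ =ᶠ[𝓝 ξ] pderiv j ψ := by
  filter_upwards [h.eventually_nhds] with z hz using pderiv_congr hz j

theorem thirdDeriv_swap {U : Euc n → ℝ} (hU : ContDiffAt ℝ 4 U 0) (a b c : Fin n) :
    thirdDeriv U a b c = thirdDeriv U b a c :=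
  pderiv_congr (eventually_pderiv_comm (hU.of_le (by norm_num)) a b) c

theorem thirdDeriv_rotate {U : Euc n → ℝ} (hU : ContDiffAt ℝ 4 U 0) (a b c : Fin n) :
    thirdDeriv U a b c = thirdDeriv U c b a :=
  pderiv_comm ((contDiffAt_pderiv (m := 3) hU (by norm_num) b).of_le (by norm_num)) c a

/-- The Gauss equation differentiated in the direction i₀ produces U_{cc i₀i₀}, whereas the
logarithm of the curvature along the line c produces U_{i₀i₀ cc}. The two must be identified. -/
theorem fourthDeriv_comm {U : Euc n → ℝ} (hU : ContDiffAt ℝ 4 U 0) (a c : Fin n) :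
    fourthDeriv U a c = fourthDeriv U c a := by
  have h2 : ContDiffAt ℝ 2 U 0 := hU.of_le (by norm_num)
  have h1 : ∀ b, ContDiffAt ℝ 2 (pderiv b U) 0 := fun b =>
    (contDiffAt_pderiv (m := 3) hU (by norm_num) b).of_le (by norm_num)
  have e1 : pderiv c (pderiv a (pderiv a U)) =ᶠ[𝓝 0] pderiv a (pderiv a (pderiv c U)) :=
    (eventually_pderiv_comm (h1 a) c a).trans
      (pderiv_congr_eventually (eventually_pderiv_comm h2 c a) a)
  have h3 : ContDiffAt ℝ 2 (pderiv a (pderiv c U)) 0 :=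
    contDiffAt_pderiv (m := 2) (contDiffAt_pderiv (m := 3) hU (by norm_num) c) (by norm_num) a
  calc _ = pderiv c (pderiv a (pderiv a (pderiv c U))) 0 := pderiv_congr e1 c
    _ = pderiv a (pderiv c (pderiv a (pderiv c U))) 0 := pderiv_comm h3 c a
    _ = _ := pderiv_congr (eventually_pderiv_comm (h1 c) c a) a

namespace TangentGraph

variable {X : Euc n → Euc (n + 1)} {y₀ : Euc n} {v : Fin n → Euc n} {N : Euc (n + 1)}
  {κ : Fin n → ℝ} {Y : Euc n → Euc n} {U : Euc n → ℝ}

theorem jet_height (h : TangentGraph X y₀ v N κ Y U) (hX : ContDiffAt ℝ 4 X y₀) (c : Fin n) :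
    Jet2 (fun t => U (0 + t • basisVec c)) 0 0 (κ c) :=
  (jet2_line (h.contDiffAt_height.of_le (by norm_num)) c).congr' h.height_zero
    (h.pderiv_height_zero hX c) (by rw [h.second_height_zero hX, if_pos rfl])

theorem jet_gradient (h : TangentGraph X y₀ v N κ Y U) (hX : ContDiffAt ℝ 4 X y₀) (a c : Fin n) :
    Jet2 (fun t => pderiv a U (0 + t • basisVec c)) 0 (if a = c then κ c else 0)
      (thirdDeriv U c c a) := by
  refine (jet2_line ((contDiffAt_pderiv (m := 3) h.contDiffAt_height (by norm_num) a).of_le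
    (by norm_num)) c).congr' (h.pderiv_height_zero hX a) ?_ ?_
  · rw [h.second_height_zero hX]; simp only [eq_comm]
  · change thirdDeriv U c a c = _
    rw [thirdDeriv_swap h.contDiffAt_height, thirdDeriv_rotate h.contDiffAt_height]

theorem jet_hessian (h : TangentGraph X y₀ v N κ Y U) (hX : ContDiffAt ℝ 4 X y₀) (a b c : Fin n) :
    Jet2 (fun t => pderiv a (pderiv b U) (0 + t • basisVec c)) (if a = b then κ a else 0)
      (thirdDeriv U a b c) (pderiv c (pderiv c (pderiv a (pderiv b U))) 0) := by
  refine (jet2_line (contDiffAt_pderiv (m := 2) (contDiffAt_pderiv (m := 3) h.contDiffAt_height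
    (by norm_num) b) (by norm_num) a) c).congr' (h.second_height_zero hX a b) rfl rfl

theorem jet_areaSq (h : TangentGraph X y₀ v N κ Y U) (hX : ContDiffAt ℝ 4 X y₀) (c : Fin n) :
    Jet2 (fun t => areaSq U (0 + t • basisVec c)) 1 0 (2 * κ c ^ 2) := by
  have h1 := (Jet2.const 1).add (Jet2.sum Finset.univ fun a _ =>
    (h.jet_gradient hX a c).mul (h.jet_gradient hX a c))
  simp only [← sq] at h1
  refine h1.congr' ?_ ?_ ?_ <;> simp

/-- ∇U vanishes at the origin and its derivative in the direction c is κ_c e_c. The rank one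
correction is therefore of second order and is felt only for a = b = c. -/
theorem jet_raisedHessian (h : TangentGraph X y₀ v N κ Y U) (hX : ContDiffAt ℝ 4 X y₀)
    (a b c : Fin n) :
    Jet2 (fun t => raisedHessian U a b (0 + t • basisVec c)) (if a = b then κ a else 0)
      (thirdDeriv U a b c) (pderiv c (pderiv c (pderiv a (pderiv b U))) 0
        - if a = c then (if b = c then 2 * κ c ^ 3 else 0) else 0) := by
  have hz := Jet2.sum Finset.univ fun d _ => (h.jet_gradient hX d c).mul (h.jet_hessian hX d b c)
  have h1 := (h.jet_hessian hX a b c).sub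
    (((h.jet_gradient hX a c).mul hz).div (h.jet_areaSq hX c) one_ne_zero)
  refine h1.congr' (by simp) (by simp) ?_
  by_cases ha : a = c <;> by_cases hb : b = c
  · subst ha hb; simp; ring
  · simp [ha, hb]
  · simp [ha]
  · simp [ha]

/-- The Gauss equation and its first two derivatives at the centre of a tangent graph. -/
theorem gauss_jet {V : Set (Euc n)} {g : Euc n → Matrix (Fin n) (Fin n) ℝ}
    (h : TangentGraph X y₀ v N κ Y U) (hX : IsIsometricImmersion V g X)
    (hV : IsOpen V) (hdet : ∀ z ∈ V, (g z).det ≠ 0) (hg : ∀ a b, ContDiffOn ℝ 4 (fun z => g z a b) V)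
    (hy : y₀ ∈ V) {R₁ R₂ : ℝ} (c : Fin n)
    (hR : Jet2 (fun t => scalarCurvature g (Y (0 + t • basisVec c))) (scalarCurvature g y₀) R₁ R₂) :
    scalarCurvature g y₀ = (∑ a, κ a) ^ 2 - ∑ a, κ a ^ 2 ∧
    R₁ / 2 = ∑ a, (∑ b, κ b - κ a) * thirdDeriv U a a c ∧
    R₂ / 2 = (∑ a, thirdDeriv U a a c) ^ 2 - ∑ a, ∑ b, thirdDeriv U a b c ^ 2
      + ∑ a, (∑ b, κ b - κ a) * fourthDeriv U a c - scalarCurvature g y₀ * κ c ^ 2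
      - 2 * κ c ^ 3 * (∑ b, κ b - κ c) := by
  have hXy := hX.contDiffAt hV hy
  have hl := (tendsto_line (0 : Euc n) c).eventually
    (h.eventually_scalarCurvature hX hV hdet hg hy)
  have hP := h.jet_raisedHessian hXy
  have hs := Jet2.sum Finset.univ fun a _ => hP a a c
  have h1 := (hs.mul hs).sub (Jet2.sum Finset.univ fun a _ => Jet2.sum Finset.univ fun b _ =>
    (hP a b c).mul (hP b a c))
  have h2 := h1.congr_fun (hl.mono fun t ht => by simp only [← sq]; exact ht)
  obtain ⟨e0, e1, e2⟩ := (hR.mul (h.jet_areaSq hXy c)).unique h2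
  have e0' : scalarCurvature g y₀ = (∑ a, κ a) ^ 2 - ∑ a, κ a ^ 2 := by
    simp at e0; rw [e0]; simp only [sq]
  have hsw : ∀ a b, thirdDeriv U b a c = thirdDeriv U a b c := fun a b =>
    thirdDeriv_swap h.contDiffAt_height b a c
  refine ⟨e0', ?_, ?_⟩
  · simp only [sub_mul, Finset.sum_sub_distrib, ← Finset.mul_sum]
    simp [Finset.sum_add_distrib] at e1
    rw [e1]
    simp only [mul_comm (thirdDeriv U _ _ c)]
    ring
  · simp only [sub_mul, Finset.sum_sub_distrib, ← Finset.mul_sum]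
    simp [Finset.sum_add_distrib, Finset.sum_sub_distrib, hsw, mul_sub, sub_mul, ← Finset.mul_sum] at e2
    simp only [fourthDeriv]
    have e3 : ∑ x, pderiv c (pderiv c (pderiv x (pderiv x U))) 0 * κ x
        = ∑ x, κ x * pderiv c (pderiv c (pderiv x (pderiv x U))) 0 :=
      Finset.sum_congr rfl fun _ _ => mul_comm _ _
    rw [e3] at e2
    simp only [← sq] at e2
    linarith

end TangentGraph
end HeinzEstimate

/-! ### Bounds uniform over all framed points -/

namespace HeinzEstimate
open Filter Topology

/-- A family of reals indexed by `I` is bounded. -/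
def UnifBdd {I : Type*} (φ : I → ℝ) : Prop := ∃ C : ℝ, ∀ i, |φ i| ≤ C

namespace UnifBdd

variable {I : Type*} {φ ψ : I → ℝ}

theorem add (h : UnifBdd φ) (k : UnifBdd ψ) : UnifBdd fun i => φ i + ψ i := by
  obtain ⟨C, hC⟩ := h
  obtain ⟨D, hD⟩ := k
  exact ⟨C + D, fun i => (abs_add_le _ _).trans (add_le_add (hC i) (hD i))⟩

theorem mul (h : UnifBdd φ) (k : UnifBdd ψ) : UnifBdd fun i => φ i * ψ i := by
  obtain ⟨C, hC⟩ := h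
  obtain ⟨D, hD⟩ := k
  refine ⟨C * D, fun i => ?_⟩
  rw [abs_mul]
  exact mul_le_mul (hC i) (hD i) (abs_nonneg _) ((abs_nonneg _).trans (hC i))

theorem neg (h : UnifBdd φ) : UnifBdd fun i => -φ i := by
  obtain ⟨C, hC⟩ := h
  exact ⟨C, fun i => by rw [abs_neg]; exact hC i⟩

theorem const (c : ℝ) : UnifBdd fun _ : I => c := ⟨|c|, fun _ => le_rfl⟩

theorem sum {ι : Type*} (s : Finset ι) {φ : ι → I → ℝ} (h : ∀ a ∈ s, UnifBdd (φ a)) :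
    UnifBdd fun i => ∑ a ∈ s, φ a i := by
  classical
  induction s using Finset.induction_on with
  | empty => simpa using const 0
  | insert a s ha ih =>
    simp only [Finset.sum_insert ha]
    exact (h a (Finset.mem_insert_self a s)).add (ih fun b hb => h b (Finset.mem_insert_of_mem hb))

theorem of_sq_le {C : ℝ} (h : ∀ i, φ i ^ 2 ≤ C) : UnifBdd φ :=
  ⟨√C, fun i => Real.abs_le_sqrt (h i)⟩

theorem exists_forall {ι : Type*} [Finite ι] {φ : ι → I → ℝ} (h : ∀ a, UnifBdd (φ a)) :
    ∃ C : ℝ, ∀ a i, |φ a i| ≤ C := by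
  choose C hC using h
  obtain ⟨M, hM⟩ := Finite.bddAbove_range C
  exact ⟨M, fun a i => (hC a i).trans (hM ⟨a, rfl⟩)⟩

end UnifBdd

/-- An isometrically immersed hypersurface with bounded metric together with a tangent graph at one
of its points. -/
structure FramedPoint (n : ℕ) (Λ : ℝ) where
  V : Set (Euc n)
  g : Euc n → Matrix (Fin n) (Fin n) ℝ
  X : Euc n → Euc (n + 1)
  y₀ : Euc n
  v : Fin n → Euc n
  N : Euc (n + 1)
  κ : Fin n → ℝ
  Y : Euc n → Euc n
  U : Euc n → ℝ
  isOpen : IsOpen V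
  bound : MetricC4Bound V g Λ
  immersion : IsIsometricImmersion V g X
  mem : y₀ ∈ V
  graph : TangentGraph X y₀ v N κ Y U

namespace FramedPoint

variable {n : ℕ} {Λ : ℝ}

theorem unifBdd_comp {k : ℕ} {φ : BoundedMetric n Λ → Euc n → ℝ}
    (h : UBdd (I := BoundedMetric n Λ) (fun p => p.1.1) k φ) :
    UnifBdd fun p : FramedPoint n Λ => φ ⟨(p.V, p.g), p.isOpen, p.bound⟩ p.y₀ := by
  obtain ⟨C, hC⟩ := h.bdd
  exact ⟨C, fun p => hC ⟨(p.V, p.g), p.isOpen, p.bound⟩ p.y₀ p.mem⟩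

theorem det_ne_zero (p : FramedPoint n Λ) : ∀ z ∈ p.V, (p.g z).det ≠ 0 :=
  fun z hz => (p.bound.posDef z hz).det_pos.ne'

theorem contDiffAt (p : FramedPoint n Λ) : ContDiffAt ℝ 4 p.X p.y₀ :=
  p.immersion.contDiffAt p.isOpen p.mem

/-- The vector v_a has g-length one, and g is coercive. -/
theorem unifBdd_frame (a j : Fin n) : UnifBdd fun p : FramedPoint n Λ => p.v a j := by
  refine UnifBdd.of_sq_le (C := Λ) fun p => ?_
  have h1 := p.bound.lower p.y₀ p.mem fun i => p.v a i
  have h2 : ∑ i, ∑ j, p.g p.y₀ i j * p.v a i * p.v a j = 1 := by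
    have h3 := p.graph.inner_frame a a
    rw [if_pos rfl, fderiv_apply_eq_sum, sum_inner] at h3
    rw [← h3]
    simp only [inner_sum, real_inner_smul_left, real_inner_smul_right, ← p.immersion.isometric _ p.mem]
    exact Finset.sum_congr rfl fun i _ => Finset.sum_congr rfl fun j _ => by ring
  rw [h2, mul_one] at h1
  exact (Finset.single_le_sum (f := fun i => p.v a i ^ 2) (fun i _ => sq_nonneg _)
    (Finset.mem_univ j)).trans h1

/-- The tangential components of X_{ij} are Christoffel symbols lowered by g, hence intrinsic. -/
theorem unifBdd_second (i j k : Fin n) : UnifBdd fun p : FramedPoint n Λ =>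
    inner ℝ (vderiv i (vderiv j p.X) p.y₀) (vderiv k p.X p.y₀) := by
  have h : UnifBdd fun p : FramedPoint n Λ =>
      ∑ l, p.g p.y₀ k l * christoffel p.g l i j p.y₀ :=
    UnifBdd.sum _ fun l _ => (unifBdd_comp (ubdd_metric n Λ k l)).mul
      (unifBdd_comp (ubdd_christoffel n Λ l i j))
  obtain ⟨C, hC⟩ := h
  refine ⟨C, fun p => ?_⟩
  beta_reduce
  rw [← p.immersion.metric_mul_christoffel p.isOpen p.mem (p.det_ne_zero _ p.mem)]
  exact hC p

theorem unifBdd_param_second (c j : Fin n) : UnifBdd fun p : FramedPoint n Λ =>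
    vderiv c (vderiv c p.Y) 0 j := by
  have h : UnifBdd fun p : FramedPoint n Λ => -∑ d, (∑ i, ∑ j, (p.v c i * p.v c j) *
      ∑ k, p.v d k * inner ℝ (vderiv i (vderiv j p.X) p.y₀) (vderiv k p.X p.y₀)) * p.v d j := by
    refine (UnifBdd.sum _ fun d _ => UnifBdd.mul ?_ (unifBdd_frame d j)).neg
    refine UnifBdd.sum _ fun i _ => UnifBdd.sum _ fun j _ =>
      ((unifBdd_frame c i).mul (unifBdd_frame c j)).mul ?_
    exact UnifBdd.sum _ fun k _ => (unifBdd_frame d k).mul (unifBdd_second i j k)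
  obtain ⟨C, hC⟩ := h
  refine ⟨C, fun p => (le_of_eq ?_).trans (hC p)⟩
  beta_reduce
  rw [p.graph.second_param_zero p.contDiffAt]
  simp only [PiLp.neg_apply, WithLp.ofLp_sum, Finset.sum_apply, PiLp.smul_apply, smul_eq_mul]
  congr 2
  refine Finset.sum_congr rfl fun d _ => ?_
  congr 1
  rw [bilin_apply_eq_sum, sum_inner]
  refine Finset.sum_congr rfl fun i _ => ?_
  rw [sum_inner]
  refine Finset.sum_congr rfl fun j _ => ?_
  rw [real_inner_smul_left, fderiv_apply_eq_sum (fderiv ℝ p.X p.y₀) (p.v d), inner_sum,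
    ← vderiv_vderiv (p.contDiffAt.of_le (by norm_num))]
  simp only [real_inner_smul_right]
  rfl

/-- Contract the Gauss equation with v_a, v_a, v_b, v_b. The second product on its right-hand side
vanishes because the frame diagonalizes the second fundamental form. -/
theorem second_mul_second (p : FramedPoint n Λ) {a b : Fin n} (hab : a ≠ b) :
    p.κ a * p.κ b = ∑ j, ∑ k, ∑ l, ∑ m, p.v a j * p.v a k * (p.v b l * p.v b m) *
      ∑ i, p.g p.y₀ m i * riemann p.g i j l k p.y₀ := by
  have hB : ∀ c d, inner ℝ (fderiv ℝ (fderiv ℝ p.X) p.y₀ (p.v c) (p.v d)) p.N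
      = ∑ i, ∑ j, (p.v c i * p.v d j) * inner ℝ (vderiv i (vderiv j p.X) p.y₀) p.N := fun c d => by
    rw [bilin_apply_eq_sum, sum_inner]
    refine Finset.sum_congr rfl fun i _ => ?_
    rw [sum_inner]
    refine Finset.sum_congr rfl fun j _ => ?_
    rw [real_inner_smul_left, ← vderiv_vderiv (p.contDiffAt.of_le (by norm_num))]
  have h1 : p.κ a = ∑ j, ∑ k, (p.v a j * p.v a k) * inner ℝ (vderiv j (vderiv k p.X) p.y₀) p.N := by
    rw [← hB, p.graph.second, if_pos rfl]
  have h2 : p.κ b = ∑ l, ∑ m, (p.v b l * p.v b m) * inner ℝ (vderiv l (vderiv m p.X) p.y₀) p.N := by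
    rw [← hB, p.graph.second, if_pos rfl]
  have h3 : 0 = ∑ l, ∑ j, (p.v b l * p.v a j) * inner ℝ (vderiv l (vderiv j p.X) p.y₀) p.N := by
    rw [← hB, p.graph.second, if_neg hab.symm]
  have h4 : 0 = ∑ k, ∑ m, (p.v a k * p.v b m) * inner ℝ (vderiv k (vderiv m p.X) p.y₀) p.N := by
    rw [← hB, p.graph.second, if_neg hab]
  simp only [p.immersion.gauss p.isOpen p.det_ne_zero p.bound.contDiffOn p.mem p.graph.normal]
  set H : Fin n → Fin n → ℝ := fun i j => inner ℝ (vderiv i (vderiv j p.X) p.y₀) p.N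
  change _ = ∑ j, ∑ k, ∑ l, ∑ m, p.v a j * p.v a k * (p.v b l * p.v b m) *
    (H j k * H l m - H l j * H k m)
  have e1 : p.κ a * p.κ b = ∑ j, ∑ k, ∑ l, ∑ m, p.v a j * p.v a k * (p.v b l * p.v b m) *
      (H j k * H l m) := by
    rw [h1, h2, Finset.sum_mul]
    refine Finset.sum_congr rfl fun j _ => ?_
    rw [Finset.sum_mul]
    refine Finset.sum_congr rfl fun k _ => ?_
    rw [Finset.mul_sum]
    refine Finset.sum_congr rfl fun l _ => ?_
    rw [Finset.mul_sum]
    exact Finset.sum_congr rfl fun m _ => by ring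
  have e2 : (0 : ℝ) = ∑ j, ∑ k, ∑ l, ∑ m, p.v a j * p.v a k * (p.v b l * p.v b m) *
      (H l j * H k m) := by
    calc (0 : ℝ) = (∑ j, ∑ l, (p.v b l * p.v a j) * H l j) * ∑ k, ∑ m, (p.v a k * p.v b m) * H k m := by
          rw [Finset.sum_comm, ← h3, zero_mul]
      _ = _ := by
        rw [Finset.sum_mul]
        refine Finset.sum_congr rfl fun j _ => ?_
        rw [Finset.mul_sum]
        refine Finset.sum_congr rfl fun k _ => ?_
        rw [Finset.sum_mul]
        refine Finset.sum_congr rfl fun l _ => ?_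
        rw [Finset.mul_sum]
        exact Finset.sum_congr rfl fun m _ => by ring
  simp only [mul_sub, Finset.sum_sub_distrib]
  rw [← e1, ← e2, sub_zero]

theorem unifBdd_curvature_mul {a b : Fin n} (hab : a ≠ b) :
    UnifBdd fun p : FramedPoint n Λ => p.κ a * p.κ b := by
  simp only [fun p : FramedPoint n Λ => p.second_mul_second hab]
  refine UnifBdd.sum _ fun j _ => UnifBdd.sum _ fun k _ => UnifBdd.sum _ fun l _ =>
    UnifBdd.sum _ fun m _ => (((unifBdd_frame a j).mul (unifBdd_frame a k)).mul
      ((unifBdd_frame b l).mul (unifBdd_frame b m))).mul ?_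
  exact UnifBdd.sum _ fun i _ => (unifBdd_comp (ubdd_metric n Λ m i)).mul
    (unifBdd_comp (ubdd_riemann n Λ i j l k))

theorem jet_scalarCurvature (p : FramedPoint n Λ) (c : Fin n) :
    Jet2 (fun t => scalarCurvature p.g (p.Y (0 + t • basisVec c))) (scalarCurvature p.g p.y₀)
      (∑ j, p.v c j * pderiv j (scalarCurvature p.g) p.y₀)
      (∑ j, (vderiv c (vderiv c p.Y) 0 j * pderiv j (scalarCurvature p.g) p.y₀
        + p.v c j * ∑ k, p.v c k * pderiv k (pderiv j (scalarCurvature p.g)) p.y₀)) := by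
  have hu := ubdd_scalarCurvature n Λ
  let q : BoundedMetric n Λ := ⟨(p.V, p.g), p.isOpen, p.bound⟩
  have h := jet2_comp_line (φ := scalarCurvature p.g)
    (p.graph.contDiffAt_param.of_le (by norm_num)) (by
      rw [p.graph.base]
      filter_upwards [p.isOpen.mem_nhds p.mem] with z hz using hu.2.1 q z hz)
    (fun j => by rw [p.graph.base]; exact (hu.2.2 j).2.1 q p.y₀ p.mem) c
  simpa only [p.graph.base, p.graph.vderiv_param_zero p.contDiffAt] using h

/-- Uniform bounds for the Gauss equation and its derivatives. -/
theorem exists_bound (n : ℕ) (Λ : ℝ) : ∃ C : ℝ, 1 ≤ C ∧ ∀ p : FramedPoint n Λ,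
    |scalarCurvature p.g p.y₀| ≤ C ∧
    (∀ _ : Fin n, scalarCurvature p.g p.y₀ = (∑ a, p.κ a) ^ 2 - ∑ a, p.κ a ^ 2) ∧
    (∀ a b, a ≠ b → |p.κ a * p.κ b| ≤ C) ∧
    (∀ c, ∃ f, |f| ≤ C ∧ f = ∑ a, (∑ b, p.κ b - p.κ a) * thirdDeriv p.U a a c) ∧
    ∀ c, ∃ f, |f| ≤ C ∧ f = (∑ a, thirdDeriv p.U a a c) ^ 2 - ∑ a, ∑ b, thirdDeriv p.U a b c ^ 2
      + ∑ a, (∑ b, p.κ b - p.κ a) * fourthDeriv p.U a c - scalarCurvature p.g p.y₀ * p.κ c ^ 2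
      - 2 * p.κ c ^ 3 * (∑ b, p.κ b - p.κ c) := by
  have hu := ubdd_scalarCurvature n Λ
  obtain ⟨C₁, h₁⟩ := UnifBdd.exists_forall (I := FramedPoint n Λ)
    (φ := fun q : {q : Fin n × Fin n // q.1 ≠ q.2} => fun p => p.κ q.1.1 * p.κ q.1.2)
    fun q => unifBdd_curvature_mul q.2
  obtain ⟨C₂, h₂⟩ := UnifBdd.exists_forall (I := FramedPoint n Λ) (φ := fun c p =>
    (∑ j, p.v c j * pderiv j (scalarCurvature p.g) p.y₀) * (1 / 2)) fun c =>
    (UnifBdd.sum _ fun j _ => (unifBdd_frame c j).mul (unifBdd_comp (hu.2.2 j))).mul (UnifBdd.const _)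
  obtain ⟨C₃, h₃⟩ := UnifBdd.exists_forall (I := FramedPoint n Λ) (φ := fun c p =>
    (∑ j, (vderiv c (vderiv c p.Y) 0 j * pderiv j (scalarCurvature p.g) p.y₀
        + p.v c j * ∑ k, p.v c k * pderiv k (pderiv j (scalarCurvature p.g)) p.y₀)) * (1 / 2)) fun c =>
    (UnifBdd.sum _ fun j _ => ((unifBdd_param_second c j).mul (unifBdd_comp (hu.2.2 j))).add
      ((unifBdd_frame c j).mul (UnifBdd.sum _ fun k _ => (unifBdd_frame c k).mul
        (unifBdd_comp ((hu.2.2 j).2.2 k))))).mul (UnifBdd.const _)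
  obtain ⟨C₄, h₄⟩ := unifBdd_comp hu
  refine ⟨max 1 (max (max C₁ C₄) (max C₂ C₃)), le_max_left _ _, fun p => ?_⟩
  -- The undifferentiated equation also comes out of `gauss_jet`, which asks for a direction c;
  -- hence its quantification over `Fin n` in the statement.
  have hG := fun c => p.graph.gauss_jet p.immersion p.isOpen p.det_ne_zero p.bound.contDiffOn p.mem c
    (p.jet_scalarCurvature c)
  refine ⟨(h₄ p).trans ((le_max_right _ _).trans ((le_max_left _ _).trans (le_max_right _ _))),
    fun c => (hG c).1, fun a b hab => ?_, fun c => ?_, fun c => ?_⟩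
  · exact (h₁ ⟨(a, b), hab⟩ p).trans ((le_max_left _ _).trans ((le_max_left _ _).trans
      (le_max_right _ _)))
  · refine ⟨_, (h₂ c p).trans ((le_max_left _ _).trans ((le_max_right _ _).trans
      (le_max_right _ _))), ?_⟩
    rw [← (hG c).2.1]; ring
  · refine ⟨_, (h₃ c p).trans ((le_max_right _ _).trans ((le_max_right _ _).trans
      (le_max_right _ _))), ?_⟩
    rw [← (hG c).2.2]; ring

end FramedPoint
end HeinzEstimate

/-! ### Two-jets of the ingredients of the test function -/

namespace HeinzEstimate
open Filter Topology

variable {n : ℕ}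

theorem euc_inner_eq {m : ℕ} (x y : Euc m) : inner ℝ x y = ∑ k, x k * y k := by
  simp [PiLp.inner_apply, mul_comm]

namespace TangentGraph

/-- The orthonormal tangent vector `E_a = DX v_a`. -/
noncomputable def frame (X : Euc n → Euc (n + 1)) (y₀ : Euc n) (v : Fin n → Euc n) (a : Fin n) :
    Euc (n + 1) := fderiv ℝ X y₀ (v a)

/-- The position vector, relative to an origin from which the base point has position `Z`. -/
noncomputable def position (X : Euc n → Euc (n + 1)) (y₀ : Euc n) (v : Fin n → Euc n)
    (N : Euc (n + 1)) (U : Euc n → ℝ) (Z : Euc (n + 1)) (ξ : Euc n) : Euc (n + 1) :=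
  Z + ∑ a, ξ a • frame X y₀ v a + U ξ • N

/-- The slope in the direction `k` of the hypersurface, seen as a graph over the first `n`
coordinates. -/
noncomputable def slope (X : Euc n → Euc (n + 1)) (y₀ : Euc n) (v : Fin n → Euc n)
    (N : Euc (n + 1)) (U : Euc n → ℝ) (k : Fin n) (ξ : Euc n) : ℝ :=
  -(conormal X y₀ v N U ξ k.castSucc) / conormal X y₀ v N U ξ (Fin.last n)

/-- Minus the support function, normalized by the vertical component of the normal. -/
noncomputable def support (X : Euc n → Euc (n + 1)) (y₀ : Euc n) (v : Fin n → Euc n)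
    (N : Euc (n + 1)) (U : Euc n → ℝ) (Z : Euc (n + 1)) (ξ : Euc n) : ℝ :=
  -(∑ k, position X y₀ v N U Z ξ k * conormal X y₀ v N U ξ k) / conormal X y₀ v N U ξ (Fin.last n)

variable {X : Euc n → Euc (n + 1)} {y₀ : Euc n} {v : Fin n → Euc n} {N : Euc (n + 1)}
  {κ : Fin n → ℝ} {Y : Euc n → Euc n} {U : Euc n → ℝ}

theorem jet_position (h : TangentGraph X y₀ v N κ Y U) (hX : ContDiffAt ℝ 4 X y₀) (Z : Euc (n + 1))
    (c : Fin n) (k : Fin (n + 1)) :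
    Jet2 (fun t => position X y₀ v N U Z (0 + t • basisVec c) k) (Z k) (frame X y₀ v c k)
      (κ c * N k) := by
  have h1 := ((Jet2.const (Z k)).add (Jet2.linear (frame X y₀ v c k))).add
    ((h.jet_height hX c).mul (Jet2.const (N k)))
  refine (h1.congr' (by simp) (by simp) (by simp)).congr_fun (Eventually.of_forall fun t => ?_)
  simp [position, basisVec]

theorem jet_conormal (h : TangentGraph X y₀ v N κ Y U) (hX : ContDiffAt ℝ 4 X y₀)
    (c : Fin n) (k : Fin (n + 1)) :
    Jet2 (fun t => conormal X y₀ v N U (0 + t • basisVec c) k) (N k) (-(κ c * frame X y₀ v c k))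
      (-∑ a, thirdDeriv U c c a * frame X y₀ v a k) := by
  have h1 := (Jet2.const (N k)).sub (Jet2.sum Finset.univ fun a _ =>
    (h.jet_gradient hX a c).mul (Jet2.const (frame X y₀ v a k)))
  refine (h1.congr' (by simp) (by simp) (by simp)).congr_fun (Eventually.of_forall fun t => ?_)
  simp [conormal, frame, Finset.sum_apply]

/-- The derivative of the slopes in the direction `E_c` divided by `κ_c`. -/
noncomputable def slopeRate (X : Euc n → Euc (n + 1)) (y₀ : Euc n) (v : Fin n → Euc n)
    (N : Euc (n + 1)) (c k : Fin n) : ℝ :=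
  (frame X y₀ v c k.castSucc * N (Fin.last n) - N k.castSucc * frame X y₀ v c (Fin.last n))
    / N (Fin.last n) ^ 2

/-- A slope is a quotient of components of the conormal. Its second derivative splits into a part
linear in the third derivatives of U and the drift, proportional to the first derivative, caused by
the varying denominator. -/
theorem jet_slope (h : TangentGraph X y₀ v N κ Y U) (hX : ContDiffAt ℝ 4 X y₀)
    (hw : N (Fin.last n) ≠ 0) (c k : Fin n) :
    Jet2 (fun t => slope X y₀ v N U k (0 + t • basisVec c)) (-(N k.castSucc) / N (Fin.last n))
      (κ c * slopeRate X y₀ v N c k)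
      (∑ a, thirdDeriv U c c a * ((frame X y₀ v a k.castSucc
          + -(N k.castSucc) / N (Fin.last n) * frame X y₀ v a (Fin.last n)) / N (Fin.last n))
        + 2 * κ c * (frame X y₀ v c (Fin.last n) / N (Fin.last n))
          * (κ c * slopeRate X y₀ v N c k)) := by
  refine ((h.jet_conormal hX c k.castSucc).neg.div (h.jet_conormal hX c (Fin.last n)) hw).congr'
    rfl ?_ ?_
  · rw [slopeRate]; field_simp
  · have e : ((- -(κ c * frame X y₀ v c k.castSucc)) * N (Fin.last n)
        - -N k.castSucc * -(κ c * frame X y₀ v c (Fin.last n))) / N (Fin.last n) ^ 2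
        = κ c * slopeRate X y₀ v N c k := by
      rw [slopeRate]; field_simp
    rw [e]
    simp only [mul_div_assoc', mul_add, ← Finset.sum_div, Finset.sum_add_distrib]
    simp only [mul_left_comm _ (-N k.castSucc / N (Fin.last n)), ← Finset.mul_sum]
    field_simp; ring

theorem jet_slope_sq (h : TangentGraph X y₀ v N κ Y U) (hX : ContDiffAt ℝ 4 X y₀)
    (hw : N (Fin.last n) ≠ 0) (c : Fin n) :
    Jet2 (fun t => 1 / 2 * ∑ k, slope X y₀ v N U k (0 + t • basisVec c) ^ 2)
      (1 / 2 * ∑ k : Fin n, (-(N k.castSucc) / N (Fin.last n)) ^ 2)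
      (κ c * ∑ k, -(N k.castSucc) / N (Fin.last n) * slopeRate X y₀ v N c k)
      (κ c ^ 2 * ∑ k, slopeRate X y₀ v N c k ^ 2
        + ∑ a, thirdDeriv U c c a * ∑ k : Fin n, -(N k.castSucc) / N (Fin.last n) *
          ((frame X y₀ v a k.castSucc + -(N k.castSucc) / N (Fin.last n)
            * frame X y₀ v a (Fin.last n)) / N (Fin.last n))
        + 2 * κ c * (frame X y₀ v c (Fin.last n) / N (Fin.last n))
          * (κ c * ∑ k, -(N k.castSucc) / N (Fin.last n) * slopeRate X y₀ v N c k)) := by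
  have h1 := (Jet2.sum Finset.univ fun k _ =>
    (h.jet_slope hX hw c k).mul (h.jet_slope hX hw c k)).const_mul (1 / 2)
  simp only [← sq] at h1
  refine h1.congr' rfl ?_ ?_
  · rw [Finset.mul_sum, Finset.mul_sum]
    exact Finset.sum_congr rfl fun k _ => by ring
  · simp only [Finset.mul_sum]
    rw [Finset.sum_comm, ← Finset.sum_add_distrib, ← Finset.sum_add_distrib]
    refine Finset.sum_congr rfl fun k _ => ?_
    have e : ∀ a, thirdDeriv U c c a * (-(N k.castSucc) / N (Fin.last n) *
          ((frame X y₀ v a k.castSucc + -(N k.castSucc) / N (Fin.last n)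
            * frame X y₀ v a (Fin.last n)) / N (Fin.last n)))
        = -(N k.castSucc) / N (Fin.last n) * (thirdDeriv U c c a *
          ((frame X y₀ v a k.castSucc + -(N k.castSucc) / N (Fin.last n)
            * frame X y₀ v a (Fin.last n)) / N (Fin.last n))) := fun a => by ring
    simp only [e, ← Finset.mul_sum]
    ring

/-- In the second derivative of ⟨position, conormal⟩ the normal and tangential contributions are κ_c
and -2κ_c. After the change of sign κ_c/N_last is left, whose F-weighted sum is R/N_last and thus
bounded. -/
theorem jet_support (h : TangentGraph X y₀ v N κ Y U) (hX : ContDiffAt ℝ 4 X y₀)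
    (hw : N (Fin.last n) ≠ 0) (Z : Euc (n + 1)) (c : Fin n) :
    Jet2 (fun t => support X y₀ v N U Z (0 + t • basisVec c)) (-(inner ℝ Z N) / N (Fin.last n))
      (κ c * ((inner ℝ Z (frame X y₀ v c) * N (Fin.last n)
        - inner ℝ Z N * frame X y₀ v c (Fin.last n)) / N (Fin.last n) ^ 2))
      (κ c / N (Fin.last n)
        + ∑ a, thirdDeriv U c c a * ((inner ℝ Z (frame X y₀ v a)
          + -(inner ℝ Z N) / N (Fin.last n) * frame X y₀ v a (Fin.last n)) / N (Fin.last n))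
        + 2 * κ c * (frame X y₀ v c (Fin.last n) / N (Fin.last n))
          * (κ c * ((inner ℝ Z (frame X y₀ v c) * N (Fin.last n)
        - inner ℝ Z N * frame X y₀ v c (Fin.last n)) / N (Fin.last n) ^ 2))) := by
  have h1 : Jet2 (fun t => ∑ k, position X y₀ v N U Z (0 + t • basisVec c) k
      * conormal X y₀ v N U (0 + t • basisVec c) k) (inner ℝ Z N)
      (-(κ c * inner ℝ Z (frame X y₀ v c)))
      (-κ c - ∑ a, thirdDeriv U c c a * inner ℝ Z (frame X y₀ v a)) := by
    refine (Jet2.sum Finset.univ fun k _ =>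
      (h.jet_position hX Z c k).mul (h.jet_conormal hX c k)).congr' ?_ ?_ ?_
    · rw [euc_inner_eq]
    · have e1 : ∑ k, frame X y₀ v c k * N k = 0 := by
        rw [← euc_inner_eq]; exact h.inner_frame_normal c
      rw [Finset.sum_add_distrib, e1, euc_inner_eq, Finset.mul_sum, ← Finset.sum_neg_distrib, zero_add]
      exact Finset.sum_congr rfl fun k _ => by ring
    · have e1 : ∑ k, frame X y₀ v c k * frame X y₀ v c k = 1 := by
        rw [← euc_inner_eq]; exact (h.inner_frame c c).trans (if_pos rfl)
      have e2 : ∑ k, N k * N k = 1 := by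
        rw [← euc_inner_eq]; exact h.inner_normal_self
      have e3 : ∑ k, Z k * -∑ a, thirdDeriv U c c a * frame X y₀ v a k
          = -∑ a, thirdDeriv U c c a * inner ℝ Z (frame X y₀ v a) := by
        simp only [mul_neg, Finset.sum_neg_distrib, euc_inner_eq, Finset.mul_sum]
        rw [Finset.sum_comm]
        congr 1
        exact Finset.sum_congr rfl fun a _ => Finset.sum_congr rfl fun k _ => by ring
      rw [Finset.sum_add_distrib, Finset.sum_add_distrib, e3]
      have e4 : ∑ k, κ c * N k * N k = κ c := by
        simp only [mul_assoc, ← Finset.mul_sum, e2, mul_one]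
      have e5 : ∑ k, 2 * (frame X y₀ v c k * -(κ c * frame X y₀ v c k)) = -2 * κ c := by
        have : ∀ k, 2 * (frame X y₀ v c k * -(κ c * frame X y₀ v c k))
            = -2 * κ c * (frame X y₀ v c k * frame X y₀ v c k) := fun k => by ring
        simp only [this, ← Finset.mul_sum, e1, mul_one]
      rw [e4, e5]; ring
  refine (h1.neg.div (h.jet_conormal hX c (Fin.last n)) hw).congr' rfl ?_ ?_
  · field_simp
  · have e : ((- -(κ c * inner ℝ Z (frame X y₀ v c))) * N (Fin.last n)
        - -inner ℝ Z N * -(κ c * frame X y₀ v c (Fin.last n))) / N (Fin.last n) ^ 2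
        = κ c * ((inner ℝ Z (frame X y₀ v c) * N (Fin.last n)
        - inner ℝ Z N * frame X y₀ v c (Fin.last n)) / N (Fin.last n) ^ 2) := by
      field_simp
    rw [e]
    simp only [mul_div_assoc', mul_add, ← Finset.sum_div, Finset.sum_add_distrib]
    simp only [mul_left_comm _ (-inner ℝ Z N / N (Fin.last n)), ← Finset.mul_sum]
    field_simp; ring

theorem jet_cutoff (h : TangentGraph X y₀ v N κ Y U) (hX : ContDiffAt ℝ 4 X y₀)
    (Z : Euc (n + 1)) (R : ℝ) (c : Fin n) :
    Jet2 (fun t => R ^ 2 - ∑ k : Fin n, position X y₀ v N U Z (0 + t • basisVec c) k.castSucc ^ 2)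
      (R ^ 2 - ∑ k : Fin n, Z k.castSucc ^ 2)
      (-2 * ∑ k : Fin n, Z k.castSucc * frame X y₀ v c k.castSucc)
      (-2 * (∑ k : Fin n, frame X y₀ v c k.castSucc ^ 2
        + κ c * ∑ k : Fin n, Z k.castSucc * N k.castSucc)) := by
  have h1 := (Jet2.const (R ^ 2)).sub (Jet2.sum Finset.univ fun k (_ : k ∈ (Finset.univ : Finset (Fin n))) =>
    (h.jet_position hX Z c k.castSucc).mul (h.jet_position hX Z c k.castSucc))
  simp only [← sq] at h1
  refine h1.congr' rfl ?_ ?_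
  · rw [Finset.mul_sum, zero_sub, ← Finset.sum_neg_distrib]
    exact Finset.sum_congr rfl fun k _ => by ring
  · rw [Finset.mul_sum, zero_sub, ← Finset.sum_neg_distrib, ← Finset.sum_add_distrib, Finset.mul_sum]
    exact Finset.sum_congr rfl fun k _ => by ring

/-- The logarithm of the normal curvature in the direction of the coordinate curve `i`. -/
noncomputable def logCurvature (U : Euc n → ℝ) (i : Fin n) (ξ : Euc n) : ℝ :=
  Real.log (pderiv i (pderiv i U) ξ) - 1 / 2 * Real.log (areaSq U ξ)
    - Real.log (1 + pderiv i U ξ ^ 2)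

/-- The arguments of both correction logarithms are stationary at the origin. They only alter the
second derivative, by -κ_c² and, for c = i, by a further -2κ_i². -/
theorem jet_logCurvature (h : TangentGraph X y₀ v N κ Y U) (hX : ContDiffAt ℝ 4 X y₀)
    {i : Fin n} (hi : 0 < κ i) (c : Fin n) :
    Jet2 (fun t => logCurvature U i (0 + t • basisVec c)) (Real.log (κ i)) (thirdDeriv U i i c / κ i)
      ((fourthDeriv U i c - κ i * κ c ^ 2 - if c = i then 2 * κ i ^ 3 else 0) / κ i
        - (thirdDeriv U i i c / κ i) ^ 2) := by
  have h1 := (h.jet_hessian hX i i c).congr' (if_pos rfl) rfl rfl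
  have h2 := (Jet2.const 1).add ((h.jet_gradient hX i c).mul (h.jet_gradient hX i c))
  simp only [← sq] at h2
  have h3 := ((h1.log hi).sub (((h.jet_areaSq hX c).log one_pos).const_mul (1 / 2))).sub
    (h2.log (by norm_num))
  refine h3.congr' (by simp) (by simp) ?_
  rw [fourthDeriv]
  by_cases hc : c = i
  · subst hc; simp; field_simp; ring
  · simp [hc, Ne.symm hc]; field_simp; ring

/-- The test function of the maximum principle. -/
noncomputable def testFunction (X : Euc n → Euc (n + 1)) (y₀ : Euc n) (v : Fin n → Euc n)
    (N : Euc (n + 1)) (U : Euc n → ℝ) (Z : Euc (n + 1)) (R A β : ℝ) (i : Fin n) (ξ : Euc n) : ℝ :=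
  Real.log (logCurvature U i ξ)
    + 2 * Real.log (R ^ 2 - ∑ k : Fin n, position X y₀ v N U Z ξ k.castSucc ^ 2)
    + A * (1 / 2 * ∑ k, slope X y₀ v N U k ξ ^ 2) + β * support X y₀ v N U Z ξ

end TangentGraph
end HeinzEstimate

/-! ### Geometric relations at the maximum -/

namespace HeinzEstimate
open Filter Topology

theorem LargeEigenvalue.mono {ι : Type*} [Fintype ι] {i₀ : ι} {κ : ι → ℝ} {D D' d d' : ℝ}
    (h : LargeEigenvalue i₀ κ D d) (hD : D ≤ D') (hd : d' ≤ d) : LargeEigenvalue i₀ κ D' d' := by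
  have h0 : 0 < κ i₀ := zero_lt_one.trans_le h.pos
  have h1 : D / κ i₀ ≤ D' / κ i₀ := div_le_div_of_nonneg_right hD h0.le
  exact ⟨h.pos, fun j hj => (h.other j hj).trans h1, h.trace.trans h1, hd.trans h.lower,
    fun j hj => (h.coef j hj).trans h1⟩

/-- Ellipticity of the linearized Gauss equation in the large-curvature regime. -/
theorem LargeEigenvalue.coef_nonneg {ι : Type*} [Fintype ι] {i₀ : ι} {κ : ι → ℝ} {D d : ℝ}
    (h : LargeEigenvalue i₀ κ D d) (hd : 0 ≤ d) (hD : D ≤ κ i₀) (j : ι) :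
    0 ≤ ∑ a, κ a - κ j := by
  have h0 : 0 < κ i₀ := zero_lt_one.trans_le h.pos
  by_cases hj : j = i₀
  · subst hj
    exact nonneg_of_mul_nonneg_right (hd.trans h.lower) h0
  · have h1 := (abs_le.1 (h.coef j hj)).1
    have h2 : D / κ i₀ ≤ 1 := (div_le_one h0).2 hD
    linarith [h.pos]

variable {n : ℕ}

theorem abs_sum_fin_le {f : Fin n → ℝ} {B : ℝ} (h : ∀ k, |f k| ≤ B) : |∑ k, f k| ≤ n * B := by
  refine (Finset.abs_sum_le_sum_abs _ _).trans ((Finset.sum_le_sum fun k _ => h k).trans ?_)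
  simp

theorem sum_castSucc_mul (x y : Euc (n + 1)) :
    ∑ k : Fin n, x k.castSucc * y k.castSucc = inner ℝ x y - x (Fin.last n) * y (Fin.last n) := by
  rw [euc_inner_eq, Fin.sum_univ_castSucc]; ring

theorem abs_apply_le_norm {m : ℕ} (x : Euc m) (k : Fin m) : |x k| ≤ ‖x‖ := by
  simpa using PiLp.norm_apply_le x k

namespace TangentGraph

variable {X : Euc n → Euc (n + 1)} {y₀ : Euc n} {v : Fin n → Euc n} {N : Euc (n + 1)}
  {κ : Fin n → ℝ} {Y : Euc n → Euc n} {U : Euc n → ℝ}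

theorem norm_frame (h : TangentGraph X y₀ v N κ Y U) (a : Fin n) : ‖frame X y₀ v a‖ = 1 := by
  have := (h.inner_frame a a).trans (if_pos rfl)
  rw [real_inner_self_eq_norm_sq] at this
  exact (pow_eq_one_iff_of_nonneg (norm_nonneg _) two_ne_zero).1 this

/-- Expand and use that E_c and N are orthonormal. As |N_last| ≤ 1, the value is at least 1; this
makes |∇u|² contribute F_{i₀} κ_{i₀}². -/
theorem sum_slopeRate_sq (h : TangentGraph X y₀ v N κ Y U) (hw : N (Fin.last n) ≠ 0) (c : Fin n) :
    ∑ k, slopeRate X y₀ v N c k ^ 2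
      = (N (Fin.last n) ^ 2 + frame X y₀ v c (Fin.last n) ^ 2) / N (Fin.last n) ^ 4 := by
  have h1 := sum_castSucc_mul (frame X y₀ v c) (frame X y₀ v c)
  have h2 := sum_castSucc_mul (frame X y₀ v c) N
  have h3 := sum_castSucc_mul N N
  rw [show inner ℝ (frame X y₀ v c) (frame X y₀ v c) = (1 : ℝ) from
    (h.inner_frame c c).trans (if_pos rfl)] at h1
  rw [show inner ℝ (frame X y₀ v c) N = 0 from h.inner_frame_normal c] at h2
  rw [h.inner_normal_self] at h3
  set w := N (Fin.last n)
  set e := frame X y₀ v c (Fin.last n)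
  have h4 : ∀ k, slopeRate X y₀ v N c k ^ 2
      = (w ^ 2 * (frame X y₀ v c k.castSucc * frame X y₀ v c k.castSucc)
        - 2 * w * e * (frame X y₀ v c k.castSucc * N k.castSucc)
        + e ^ 2 * (N k.castSucc * N k.castSucc)) / w ^ 4 := fun k => by
    change ((frame X y₀ v c k.castSucc * w - N k.castSucc * e) / w ^ 2) ^ 2 = _
    field_simp; ring
  simp only [h4, ← Finset.sum_div, Finset.sum_add_distrib, Finset.sum_sub_distrib, ← Finset.mul_sum,
    h1, h2, h3]
  congr 1; ring

/-- Either the cut-off function is large, or its gradient has a large component away from the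
direction `i₀`, or the normalized support function varies in the direction `i₀`. -/
theorem cutoff_dichotomy (h : TangentGraph X y₀ v N κ Y U) (hw : N (Fin.last n) ≠ 0)
    (Z : Euc (n + 1)) {R M B d : ℝ} (hM : ‖Z‖ ≤ M) (hM1 : 1 ≤ M) (i₀ : Fin n)
    (hT : ∀ c, |(inner ℝ Z (frame X y₀ v c) * N (Fin.last n)
        - inner ℝ Z N * frame X y₀ v c (Fin.last n)) / N (Fin.last n) ^ 2| ≤ B)
    (hd0 : 0 < d) (hd : d ≤ 3 * R ^ 2 / 4) (hdB : d * ((n + 1) * M + n * B) < R ^ 2 / 4) :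
    d ≤ R ^ 2 - ∑ k : Fin n, Z k.castSucc ^ 2 ∨
      (∃ j, j ≠ i₀ ∧ d ≤ |-2 * ∑ k : Fin n, Z k.castSucc * frame X y₀ v j k.castSucc|) ∨
      d ≤ |(inner ℝ Z (frame X y₀ v i₀) * N (Fin.last n)
        - inner ℝ Z N * frame X y₀ v i₀ (Fin.last n)) / N (Fin.last n) ^ 2| := by
  by_contra! hcon
  obtain ⟨hc1, hc2, hc3⟩ := hcon
  have hw1 : |N (Fin.last n)| ≤ 1 := (abs_apply_le_norm N _).trans_eq h.normal.norm
  set w := N (Fin.last n) with hwd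
  set α : Fin n → ℝ := fun c => ∑ k : Fin n, Z k.castSucc * frame X y₀ v c k.castSucc with hα
  set e : Fin n → ℝ := fun c => frame X y₀ v c (Fin.last n) with he
  set ν : ℝ := ∑ k : Fin n, Z k.castSucc * N k.castSucc with hν
  set T : Fin n → ℝ := fun c => (inner ℝ Z (frame X y₀ v c) * w - inner ℝ Z N * e c) / w ^ 2 with hTd
  set s := ∑ k : Fin n, Z k.castSucc ^ 2 with hs
  have hT' : ∀ c, T c = (α c * w - ν * e c) / w ^ 2 := fun c => by
    have h1 : inner ℝ Z (frame X y₀ v c) = α c + Z (Fin.last n) * e c := by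
      rw [hα]; simp only [sum_castSucc_mul]; ring
    have h2 : inner ℝ Z N = ν + Z (Fin.last n) * w := by rw [hν, sum_castSucc_mul]; ring
    rw [hTd]; simp only [h1, h2]; ring
  -- The horizontal part of Z. Its norm and its vanishing last component, computed in the frame E_a,
  -- N, give the two sums below.
  let Zh : Euc (n + 1) := Z - Z (Fin.last n) • EuclideanSpace.single (Fin.last n) 1
  have hZc : ∀ k : Fin n, Zh k.castSucc = Z k.castSucc := fun k => by
    simp [Zh, (Fin.castSucc_lt_last k).ne]
  have hZl : Zh (Fin.last n) = 0 := by simp [Zh]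
  have hin : ∀ z, inner ℝ Zh z = ∑ k : Fin n, Z k.castSucc * z k.castSucc := fun z => by
    rw [euc_inner_eq, Fin.sum_univ_castSucc, hZl]; simp [hZc]
  have hexp : Zh = ∑ a, α a • frame X y₀ v a + ν • N := by
    have := h.frame_expand Zh
    simp only [hin] at this
    exact this
  have hsum1 : ∑ a, α a ^ 2 = s - ν ^ 2 := by
    have h1 : inner ℝ Zh Zh = s := by rw [hin, hs]; simp [hZc, sq]
    have h2 : inner ℝ Zh Zh = ∑ a, α a ^ 2 + ν ^ 2 := by
      conv_lhs => enter [3]; rw [hexp]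
      rw [inner_add_right, inner_sum]
      simp only [real_inner_smul_right]
      simp only [hin, sq]
      rfl
    linarith
  have hsum2 : ∑ a, α a * e a = -(ν * w) := by
    have h1 := congrArg (fun z : Euc (n + 1) => z (Fin.last n)) hexp
    simp only [hZl, PiLp.add_apply, WithLp.ofLp_sum, Finset.sum_apply, PiLp.smul_apply,
      smul_eq_mul] at h1
    rw [he]; linarith
  -- If all three alternatives failed, every α_c T_c would contain a factor smaller than d. The
  -- right-hand side, however, has absolute value at least s > R² - d ≥ R²/4.
  have hsum : ∑ c, α c * T c = s / w := by
    have : ∀ c, α c * T c = (w * α c ^ 2 - ν * (α c * e c)) / w ^ 2 := fun c => by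
      rw [hT']; ring
    simp only [this, ← Finset.sum_div, Finset.sum_sub_distrib, ← Finset.mul_sum, hsum1, hsum2]
    field_simp; ring
  have hZM : ∀ c, |α c| ≤ M := fun c => by
    have h1 : s ≤ M ^ 2 := by
      have h1 : ‖Z‖ ^ 2 = s + Z (Fin.last n) ^ 2 := by
        rw [← real_inner_self_eq_norm_sq, euc_inner_eq, Fin.sum_univ_castSucc, hs]
        simp only [sq]
      have h2 : ‖Z‖ ^ 2 ≤ M ^ 2 := pow_le_pow_left₀ (norm_nonneg _) hM 2
      nlinarith [sq_nonneg (Z (Fin.last n))]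
    have h2 : α c ^ 2 ≤ ∑ a, α a ^ 2 :=
      Finset.single_le_sum (f := fun a => α a ^ 2) (fun a _ => sq_nonneg _) (Finset.mem_univ c)
    exact abs_le_of_sq_le_sq (by nlinarith [sq_nonneg ν]) (by linarith)
  have hb : ∀ c, |α c * T c| ≤ d * M + d * B := fun c => by
    rw [abs_mul]
    have hB : 0 ≤ B := (abs_nonneg _).trans (hT c)
    by_cases hci : c = i₀
    · subst hci
      have := mul_le_mul (hZM c) hc3.le (abs_nonneg _) (by linarith)
      nlinarith
    · have h1 := hc2 c hci
      rw [abs_mul] at h1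
      have h2 : |α c| ≤ d := by
        rw [show |(-2 : ℝ)| = 2 by norm_num] at h1
        linarith [abs_nonneg (α c)]
      have := mul_le_mul h2 (hT c) (abs_nonneg _) hd0.le
      nlinarith
  have h1 := abs_sum_fin_le hb
  have hs0 : 0 ≤ s := Finset.sum_nonneg fun k _ => sq_nonneg _
  rw [hsum, abs_div, abs_of_nonneg hs0] at h1
  have h2 : s ≤ s / |w| := by
    rw [le_div_iff₀ (abs_pos.2 hw)]
    exact mul_le_of_le_one_right hs0 hw1
  nlinarith

end TangentGraph
end HeinzEstimate

/-! ### The estimate at a maximum of the test function -/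

namespace HeinzEstimate
open Filter Topology

variable {n : ℕ}

theorem abs_div_le_mul_of_le {x b w M : ℝ} (hM : 1 ≤ M * |w|) (hx : |x| ≤ b) : |x / w| ≤ b * M := by
  have hw : 0 < |w| := by
    rcases (abs_nonneg w).eq_or_lt with h | h
    · rw [← h] at hM; linarith
    · exact h
  have hb : 0 ≤ b := (abs_nonneg x).trans hx
  rw [abs_div, div_le_iff₀ hw]
  nlinarith

theorem abs_mul_le_mul_of_le {x y a b : ℝ} (hx : |x| ≤ a) (hy : |y| ≤ b) : |x * y| ≤ a * b := by
  rw [abs_mul]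
  exact mul_le_mul hx hy (abs_nonneg _) ((abs_nonneg _).trans hx)

/-- Interchange the sums: third derivatives enter only through their F-traces, which the once
differentiated Gauss equation controls. -/
theorem abs_sum_mul_sum_le {F m : Fin n → ℝ} {τ : Fin n → Fin n → ℝ} {b C : ℝ}
    (hm : ∀ a, |m a| ≤ b) (hf : ∀ a, |∑ c, F c * τ c a| ≤ C) :
    |∑ c, F c * ∑ a, τ c a * m a| ≤ n * (C * b) := by
  have e : ∑ c, F c * ∑ a, τ c a * m a = ∑ a, (∑ c, F c * τ c a) * m a := by
    simp only [Finset.mul_sum, Finset.sum_mul]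
    rw [Finset.sum_comm]
    exact Finset.sum_congr rfl fun _ _ => Finset.sum_congr rfl fun _ _ => by ring
  rw [e]
  exact abs_sum_fin_le fun a => abs_mul_le_mul_of_le (hf a) (hm a)

set_option maxHeartbeats 1000000 in
/-- At a maximum of the test function the largest principal curvature is controlled by the cut-off. -/
theorem FramedPoint.exists_cutoff_mul_log_le (n : ℕ) (Λ : ℝ) {δ M R : ℝ} (hδ : 0 < δ) (hR : 0 < R)
    (hM : 1 ≤ M) : ∃ A β lam₀ B : ℝ, 0 ≤ A ∧ 0 ≤ β ∧
      ∀ (p : FramedPoint n Λ) (Z : Euc (n + 1)) (i₀ : Fin n), δ ≤ scalarCurvature p.g p.y₀ →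
        1 ≤ M * |p.N (Fin.last n)| → ‖Z‖ ≤ M → lam₀ ≤ p.κ i₀ →
        ∑ k : Fin n, Z k.castSucc ^ 2 < R ^ 2 →
        (∀ c, IsLocalMax (fun t : ℝ => TangentGraph.testFunction p.X p.y₀ p.v p.N p.U Z R A β i₀
          (0 + t • basisVec c)) 0) →
        (R ^ 2 - ∑ k : Fin n, Z k.castSucc ^ 2) * Real.log (p.κ i₀) ≤ B := by
  obtain ⟨C, hC, hbound⟩ := FramedPoint.exists_bound n Λ
  obtain ⟨l₁, D₁, hl₁, hD₁, hnD₁, hCD₁, hlarge⟩ := largeEigenvalue_of_gauss n hδ hC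
  obtain ⟨l₂, J, hl₂, hJ, hjac⟩ := jacobi_inequality (d := δ / 4) hD₁ (by positivity)
  have hM0 : 0 < M := by linarith
  have hn0 : (0 : ℝ) ≤ n := Nat.cast_nonneg n
  have hC0 : 0 ≤ C := by linarith
  set Tb := (M * 1 + M * 1) * M * M with hTb
  have hTb0 : 0 ≤ Tb := by positivity
  -- One constant serves as lower bound in `LargeEigenvalue` and as threshold in `cutoff_dichotomy`.
  -- The 8 leaves room for the strict inequality with R²/4.
  set d := min (δ / 4) (min (3 * R ^ 2 / 4) (R ^ 2 / (8 * ((n + 1) * M + n * Tb)))) with hd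
  have hq : 0 < (n + 1) * M + n * Tb := by positivity
  have hd0 : 0 < d := by
    rw [hd]; refine lt_min (by positivity) (lt_min (by positivity) (by positivity))
  have hd1 : d ≤ δ / 4 := min_le_left _ _
  have hd2 : d ≤ 3 * R ^ 2 / 4 := (min_le_right _ _).trans (min_le_left _ _)
  have hd3 : d * ((n + 1) * M + n * Tb) < R ^ 2 / 4 := by
    have h1 : d ≤ R ^ 2 / (8 * ((n + 1) * M + n * Tb)) := (min_le_right _ _).trans (min_le_right _ _)
    have h2 : d * ((n + 1) * M + n * Tb) ≤ R ^ 2 / 8 := by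
      rw [le_div_iff₀ (by positivity)] at h1; linarith
    have : 0 < R ^ 2 := by positivity
    linarith
  clear_value d Tb
  set b₁ := 2 * (n * (M * 1)) with hb₁
  set b₂ := n * ((1 * M) * ((1 * 1 + 1 * 1) * M * M)) with hb₂
  set b₃ := n * (C * (n * ((1 * M) * ((1 + 1 * M * 1) * M)))) with hb₃
  set b₄ := C * M + n * (C * ((M * 1 + M * 1 * M * 1) * M)) with hb₄
  have hb₁0 : 0 ≤ b₁ := by positivity
  have hb₂0 : 0 ≤ b₂ := by positivity
  have hb₃0 : 0 ≤ b₃ := by positivity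
  have hb₄0 : 0 ≤ b₄ := by positivity
  set D := D₁ + J + R ^ 2 + b₁ + 2 * n + b₂ + Tb + M + b₃ + b₄ with hDdef
  have hR2 : 0 < R ^ 2 := by positivity
  obtain ⟨A, β, l₃, B, hA, hβ, hmain⟩ := cutoff_mul_log_le_of_max (D := D) (d := d) (by linarith) hd0
  refine ⟨A, β, l₁ + l₂ + |l₃| + D₁ + D, B, hA, hβ, fun p Z i₀ hscal hw hZ hlam hZR hmax => ?_⟩
  obtain ⟨hs1, hs2, hs3, hs4, hs5⟩ := hbound p
  have hX := p.contDiffAt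
  have hwne : p.N (Fin.last n) ≠ 0 := by
    intro h0; rw [h0] at hw; simp at hw; linarith
  have hl3 := le_abs_self l₃
  have hl30 := abs_nonneg l₃
  have hlarge' : LargeEigenvalue i₀ p.κ D₁ (δ / 4) := by
    refine hlarge (Fin n) i₀ p.κ (by simp) (fun j hj => hs3 i₀ j hj.symm) ?_ (by linarith)
    rw [← hs2 i₀]; exact hscal
  have hκ1 : 1 < p.κ i₀ := by linarith
  have hκ0 : 0 < p.κ i₀ := by linarith
  have hlog : 0 < Real.log (p.κ i₀) := Real.log_pos hκ1
  have hρ0 : 0 < R ^ 2 - ∑ k : Fin n, Z k.castSucc ^ 2 := by linarith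
  have hF := fun j => hlarge'.coef_nonneg (by positivity : 0 ≤ δ / 4) (by linarith) j
  have hN1 : ∀ k, |p.N k| ≤ 1 := fun k => (abs_apply_le_norm _ k).trans_eq p.graph.normal.norm
  have hE1 : ∀ a k, |TangentGraph.frame p.X p.y₀ p.v a k| ≤ 1 := fun a k =>
    (abs_apply_le_norm _ k).trans_eq (p.graph.norm_frame a)
  have hZE : ∀ a, |inner ℝ Z (TangentGraph.frame p.X p.y₀ p.v a)| ≤ M := fun a => by
    refine (abs_real_inner_le_norm _ _).trans ?_
    rw [p.graph.norm_frame, mul_one]; exact hZ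
  have hZN : |inner ℝ Z p.N| ≤ M := by
    refine (abs_real_inner_le_norm _ _).trans ?_
    rw [p.graph.normal.norm, mul_one]; exact hZ
  have hp : ∀ k : Fin n, |-(p.N k.castSucc) / p.N (Fin.last n)| ≤ 1 * M := fun k =>
    abs_div_le_mul_of_le hw (by rw [abs_neg]; exact hN1 _)
  have hT : ∀ c, |(inner ℝ Z (TangentGraph.frame p.X p.y₀ p.v c) * p.N (Fin.last n)
      - inner ℝ Z p.N * TangentGraph.frame p.X p.y₀ p.v c (Fin.last n)) / p.N (Fin.last n) ^ 2|
      ≤ Tb := fun c => by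
    rw [sq, ← div_div, hTb]
    refine abs_div_le_mul_of_le hw (abs_div_le_mul_of_le hw ((abs_sub _ _).trans (add_le_add ?_ ?_)))
    · exact abs_mul_le_mul_of_le (hZE c) (hN1 _)
    · exact abs_mul_le_mul_of_le hZN (hE1 _ _)
  have hsl : ∀ c k, |TangentGraph.slopeRate p.X p.y₀ p.v p.N c k| ≤ (1 * 1 + 1 * 1) * M * M :=
    fun c k => by
    rw [TangentGraph.slopeRate, sq, ← div_div]
    refine abs_div_le_mul_of_le hw (abs_div_le_mul_of_le hw ((abs_sub _ _).trans (add_le_add ?_ ?_)))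
    · exact abs_mul_le_mul_of_le (hE1 _ _) (hN1 _)
    · exact abs_mul_le_mul_of_le (hN1 _) (hE1 _ _)
  have hf : ∀ a, |∑ c, (∑ b, p.κ b - p.κ c) * thirdDeriv p.U c c a| ≤ C := fun a => by
    obtain ⟨f, h1, h2⟩ := hs4 a
    rw [← h2]; exact h1
  have hjet := fun c => ((((p.graph.jet_logCurvature hX hκ0 c).log hlog).add
    (((p.graph.jet_cutoff hX Z R c).log hρ0).const_mul 2)).add
    ((p.graph.jet_slope_sq hX hwne c).const_mul A)).add
    ((p.graph.jet_support hX hwne Z c).const_mul β)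
  have hcrit := fun c => (hjet c).isLocalMax (hmax c)
  -- The blanks are filled by unification with the entries of the jets in `hjet`; η is the drift
  -- factor of the quotients.
  refine hmain (Fin n) i₀ p.κ _ _ _ _ _ _ _ _
    (fun c => TangentGraph.frame p.X p.y₀ p.v c (Fin.last n) / p.N (Fin.last n)) _
    (by simp only [Fintype.card_fin]; linarith) (hlarge'.mono (by linarith) hd1) (by linarith) ?_ hρ0
    (by have := Finset.sum_nonneg fun (k : Fin n) (_ : k ∈ Finset.univ) => sq_nonneg (Z k.castSucc)
        linarith) ?_ ?_ ?_ ?_ ?_ (p.graph.cutoff_dichotomy hwne Z hZ hM i₀ hT hd0 hd2 hd3) ?_ ?_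
    (fun c => (hcrit c).1) (fun c => (hcrit c).2)
  · obtain ⟨f₁, h1, h2⟩ := hs4 i₀
    obtain ⟨f₂, h3, h4⟩ := hs5 i₀
    have hU := p.graph.contDiffAt_height
    have hj := hjac (Fin n) i₀ p.κ (fun a b => thirdDeriv p.U a b i₀) (fun c => fourthDeriv p.U c i₀)
      (scalarCurvature p.g p.y₀) f₁ f₂ (by simpa using hnD₁) hlarge' (by linarith)
      (fun a b => thirdDeriv_swap hU a b i₀) (h1.trans hCD₁) (h3.trans hCD₁) (hs2 i₀) h2 h4
    have e1 : ∀ c, thirdDeriv p.U i₀ c i₀ = thirdDeriv p.U i₀ i₀ c := fun c => by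
      rw [thirdDeriv_swap hU, thirdDeriv_rotate hU]
    simp only [e1, fun c => fourthDeriv_comm hU c i₀] at hj
    rw [Finset.mul_sum _ _ (Real.log (p.κ i₀))]
    have e2 : ∀ x : ℝ, Real.log (p.κ i₀) * (x / Real.log (p.κ i₀)) = x := fun x => by field_simp
    have e3 : ∀ F x y : ℝ, Real.log (p.κ i₀) * (F * (x / Real.log (p.κ i₀) - y ^ 2 + y ^ 2)) = F * x :=
      fun F x y => by field_simp; ring
    simp only [e2, e3]
    linarith
  · intro c
    have : |(-2 : ℝ) * ∑ k : Fin n, Z k.castSucc * TangentGraph.frame p.X p.y₀ p.v c k.castSucc|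
        ≤ 2 * (n * (M * 1)) := abs_mul_le_mul_of_le (by norm_num) (abs_sum_fin_le fun k =>
        abs_mul_le_mul_of_le ((abs_apply_le_norm _ _).trans hZ) (hE1 _ _))
    exact this.trans (by linarith)
  · intro c
    have h1 : |(-2 : ℝ) * (∑ k : Fin n, TangentGraph.frame p.X p.y₀ p.v c k.castSucc ^ 2
        + p.κ c * ∑ k : Fin n, Z k.castSucc * p.N k.castSucc)| ≤ 2 * (n * (1 * 1) + |p.κ c| * (n * (M * 1))) := by
      refine abs_mul_le_mul_of_le (by norm_num) ((abs_add_le _ _).trans (add_le_add ?_ ?_))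
      · simp only [sq]
        exact abs_sum_fin_le fun k => abs_mul_le_mul_of_le (hE1 _ _) (hE1 _ _)
      · exact abs_mul_le_mul_of_le le_rfl (abs_sum_fin_le fun k =>
          abs_mul_le_mul_of_le ((abs_apply_le_norm _ _).trans hZ) (hN1 _))
    refine h1.trans ?_
    have h2 : 2 * (n * (1 * 1) + |p.κ c| * (n * (M * 1))) = 2 * n + b₁ * |p.κ c| := by rw [hb₁]; ring
    have h3 : b₁ * |p.κ c| ≤ D * |p.κ c| := mul_le_mul_of_nonneg_right (by linarith) (abs_nonneg _)
    rw [h2]; linarith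
  · intro c
    have : |∑ k : Fin n, -(p.N k.castSucc) / p.N (Fin.last n) *
        TangentGraph.slopeRate p.X p.y₀ p.v p.N c k| ≤ b₂ :=
      abs_sum_fin_le fun k => abs_mul_le_mul_of_le (hp k) (hsl c k)
    exact this.trans (by linarith)
  · exact fun c => (hT c).trans (by linarith)
  · exact fun c => (abs_div_le_mul_of_le hw (hE1 c _)).trans (by linarith)
  · simp only [add_sub_cancel_right, mul_add, Finset.sum_add_distrib]
    have h1 := abs_sum_mul_sum_le (F := fun c => ∑ b, p.κ b - p.κ c)
      (τ := fun c a => thirdDeriv p.U c c a) (m := fun a => ∑ k : Fin n,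
          -(p.N k.castSucc) / p.N (Fin.last n) * ((TangentGraph.frame p.X p.y₀ p.v a k.castSucc
          + -(p.N k.castSucc) / p.N (Fin.last n) * TangentGraph.frame p.X p.y₀ p.v a (Fin.last n))
          / p.N (Fin.last n))) (b := n * ((1 * M) * ((1 + 1 * M * 1) * M)))
      (fun a => abs_sum_fin_le fun k => abs_mul_le_mul_of_le (hp k) (abs_div_le_mul_of_le hw
        ((abs_add_le _ _).trans (add_le_add (hE1 _ _) (abs_mul_le_mul_of_le (hp k) (hE1 _ _)))))) hf
    have h2 := (abs_le.1 h1).1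
    -- All summands are nonnegative, and only c = i₀ is kept.
    have h3 : (∑ b, p.κ b - p.κ i₀) * p.κ i₀ ^ 2 ≤ ∑ c, (∑ b, p.κ b - p.κ c) *
        (p.κ c ^ 2 * ∑ k, TangentGraph.slopeRate p.X p.y₀ p.v p.N c k ^ 2) := by
      have h4 : ∀ c, 1 ≤ ∑ k, TangentGraph.slopeRate p.X p.y₀ p.v p.N c k ^ 2 := fun c => by
        rw [p.graph.sum_slopeRate_sq hwne, le_div_iff₀ (by positivity)]
        have h5 : p.N (Fin.last n) ^ 2 ≤ 1 := (sq_le_one_iff_abs_le_one _).2 (hN1 _)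
        nlinarith [sq_nonneg (p.N (Fin.last n)),
          sq_nonneg (TangentGraph.frame p.X p.y₀ p.v c (Fin.last n))]
      have h6 := Finset.single_le_sum (f := fun c => (∑ b, p.κ b - p.κ c) *
        (p.κ c ^ 2 * ∑ k, TangentGraph.slopeRate p.X p.y₀ p.v p.N c k ^ 2))
        (fun c _ => mul_nonneg (hF c) (mul_nonneg (sq_nonneg _) (by linarith [h4 c])))
        (Finset.mem_univ i₀)
      refine le_trans (mul_le_mul_of_nonneg_left ?_ (hF i₀)) h6
      exact le_mul_of_one_le_right (sq_nonneg _) (h4 i₀)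
    linarith
  · simp only [add_sub_cancel_right, mul_add, Finset.sum_add_distrib]
    have h1 := abs_sum_mul_sum_le (F := fun c => ∑ b, p.κ b - p.κ c)
      (τ := fun c a => thirdDeriv p.U c c a) (m := fun a =>
          (inner ℝ Z (TangentGraph.frame p.X p.y₀ p.v a) + -(inner ℝ Z p.N) / p.N (Fin.last n)
            * TangentGraph.frame p.X p.y₀ p.v a (Fin.last n)) / p.N (Fin.last n))
      (b := (M * 1 + M * 1 * M * 1) * M)
      (fun a => abs_div_le_mul_of_le hw ((abs_add_le _ _).trans (add_le_add
        (by rw [mul_one]; exact hZE a) (abs_mul_le_mul_of_le (abs_div_le_mul_of_le hw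
          (by rw [abs_neg, mul_one]; exact hZN)) (hE1 _ _))))) hf
    have h2 := (abs_le.1 h1).1
    have h3 : ∑ c, (∑ b, p.κ b - p.κ c) * (p.κ c / p.N (Fin.last n))
        = scalarCurvature p.g p.y₀ / p.N (Fin.last n) := by
      rw [hs2 i₀]
      have : ∀ c, (∑ b, p.κ b - p.κ c) * (p.κ c / p.N (Fin.last n))
          = ((∑ b, p.κ b) * p.κ c - p.κ c ^ 2) / p.N (Fin.last n) := fun c => by ring
      simp only [this, ← Finset.sum_div, Finset.sum_sub_distrib, ← Finset.mul_sum]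
      rw [← sq]
    have h4 := (abs_le.1 (abs_div_le_mul_of_le hw hs1)).1
    rw [h3]
    linarith

end HeinzEstimate

/-! ### The immersion as a graph over the ball -/

namespace HeinzEstimate
open Filter Topology

variable {n : ℕ}

/-- The projection of `ℝⁿ⁺¹` onto the first `n` coordinates. -/
noncomputable def horizontal (n : ℕ) : Euc (n + 1) →L[ℝ] Euc n :=
  LinearMap.toContinuousLinearMap
    { toFun := fun z => WithLp.toLp 2 fun i => z i.castSucc
      map_add' := fun _ _ => rfl
      map_smul' := fun _ _ => rfl }

theorem horizontal_apply (z : Euc (n + 1)) (i : Fin n) : horizontal n z i = z i.castSucc := rfl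

theorem horizontal_graphPoint (u : Euc n → ℝ) (x : Euc n) : horizontal n (graphPoint u x) = x := by
  ext i; simp [horizontal_apply, graphPoint]

theorem graphPoint_last (u : Euc n → ℝ) (x : Euc n) : graphPoint u x (Fin.last n) = u x := by
  simp [graphPoint]

theorem euc_ext_castSucc {z z' : Euc (n + 1)} (h : horizontal n z = horizontal n z')
    (hl : z (Fin.last n) = z' (Fin.last n)) : z = z' := by
  ext k
  refine Fin.lastCases hl (fun i => ?_) k
  rw [← horizontal_apply, h, horizontal_apply]

/-- The upward normal `(-∇u, 1)` of the graph of `u`. -/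
noncomputable def upNormal (u : Euc n → ℝ) (x : Euc n) : Euc (n + 1) :=
  WithLp.toLp 2 (Fin.snoc (α := fun _ => ℝ) (fun k => -pderiv k u x) 1)

theorem upNormal_castSucc (u : Euc n → ℝ) (x : Euc n) (k : Fin n) :
    upNormal u x k.castSucc = -pderiv k u x := by simp [upNormal]

theorem upNormal_last (u : Euc n → ℝ) (x : Euc n) : upNormal u x (Fin.last n) = 1 := by
  simp [upNormal]

theorem inner_upNormal (u : Euc n → ℝ) (x : Euc n) (z : Euc (n + 1)) :
    inner ℝ z (upNormal u x) = z (Fin.last n) - fderiv ℝ u x (horizontal n z) := by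
  rw [euc_inner_eq, Fin.sum_univ_castSucc, upNormal_last, fderiv_apply_eq_sum]
  simp only [upNormal_castSucc, horizontal_apply, pderiv, smul_eq_mul, mul_neg,
    Finset.sum_neg_distrib]
  ring

theorem upNormal_ne_zero (u : Euc n → ℝ) (x : Euc n) : upNormal u x ≠ 0 := fun h => by
  have := congrArg (fun z : Euc (n + 1) => z (Fin.last n)) h
  simp [upNormal_last] at this

/-- For the horizontal part q = -∇u one has |q|² = -du(q) ≤ K|q|, hence |q| ≤ K, and √(1 + K²) ≤ 1 +
K. -/
theorem norm_upNormal_le {u : Euc n → ℝ} {x : Euc n} {K : ℝ} (h : ‖fderiv ℝ u x‖ ≤ K) :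
    ‖upNormal u x‖ ≤ 1 + K := by
  have hK : 0 ≤ K := (norm_nonneg _).trans h
  set q : Euc n := horizontal n (upNormal u x) with hq
  have h1 : ‖upNormal u x‖ ^ 2 = ‖q‖ ^ 2 + 1 := by
    rw [← real_inner_self_eq_norm_sq, ← real_inner_self_eq_norm_sq, euc_inner_eq, euc_inner_eq,
      Fin.sum_univ_castSucc, upNormal_last]
    simp [hq, horizontal_apply]
  have h2 : ‖q‖ ^ 2 = -fderiv ℝ u x q := by
    rw [← real_inner_self_eq_norm_sq, euc_inner_eq, fderiv_apply_eq_sum, ← Finset.sum_neg_distrib]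
    refine Finset.sum_congr rfl fun k _ => ?_
    have : q k = -pderiv k u x := upNormal_castSucc u x k
    rw [smul_eq_mul]
    conv_lhs => enter [2]; rw [this]
    rw [pderiv]; ring
  have h3 : |fderiv ℝ u x q| ≤ K * ‖q‖ := (fderiv ℝ u x).le_of_opNorm_le h q
  have h4 : ‖q‖ ≤ K := by
    by_contra hc
    push Not at hc
    nlinarith [neg_le_abs (fderiv ℝ u x q), norm_nonneg q]
  nlinarith [norm_nonneg q, norm_nonneg (upNormal u x)]

/-- An isometric immersion of an open set which is the graph of a `C¹` function over a ball. -/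
structure GraphImmersion (V : Set (Euc n)) (g : Euc n → Matrix (Fin n) (Fin n) ℝ)
    (X : Euc n → Euc (n + 1)) (u : Euc n → ℝ) (x₀ : Euc n) (r : ℝ) : Prop where
  isOpen : IsOpen V
  immersion : IsIsometricImmersion V g X
  contDiffOn : ContDiffOn ℝ 1 u (Metric.ball x₀ r)
  bijOn : Set.BijOn X V (graphPoint u '' Metric.ball x₀ r)

namespace GraphImmersion

variable {V : Set (Euc n)} {g : Euc n → Matrix (Fin n) (Fin n) ℝ} {X : Euc n → Euc (n + 1)}
  {u : Euc n → ℝ} {x₀ : Euc n} {r : ℝ}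

theorem horizontal_mem (h : GraphImmersion V g X u x₀ r) {y : Euc n} (hy : y ∈ V) :
    horizontal n (X y) ∈ Metric.ball x₀ r ∧ X y = graphPoint u (horizontal n (X y)) := by
  obtain ⟨x, hx, he⟩ := h.bijOn.mapsTo hy
  rw [← he, horizontal_graphPoint]
  exact ⟨hx, rfl⟩

theorem last_eq (h : GraphImmersion V g X u x₀ r) {y : Euc n} (hy : y ∈ V) :
    X y (Fin.last n) = u (horizontal n (X y)) := by
  have := (h.horizontal_mem hy).2
  conv_lhs => rw [this]
  exact graphPoint_last _ _

theorem hasFDerivAt (h : GraphImmersion V g X u x₀ r) {y : Euc n} (hy : y ∈ V) :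
    HasFDerivAt u (fderiv ℝ u (horizontal n (X y))) (horizontal n (X y)) :=
  ((h.contDiffOn.contDiffAt (Metric.isOpen_ball.mem_nhds (h.horizontal_mem hy).1)).differentiableAt
    (by simp)).hasFDerivAt

theorem tangent (h : GraphImmersion V g X u x₀ r) {y : Euc n} (hy : y ∈ V) (w : Euc n) :
    fderiv ℝ X y w (Fin.last n)
      = fderiv ℝ u (horizontal n (X y)) (horizontal n (fderiv ℝ X y w)) := by
  have hX : HasFDerivAt X (fderiv ℝ X y) y :=
    ((h.immersion.contDiffAt h.isOpen hy).differentiableAt (by simp)).hasFDerivAt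
  have h1 : HasFDerivAt (fun z => X z (Fin.last n))
      ((EuclideanSpace.proj (Fin.last n) : Euc (n + 1) →L[ℝ] ℝ).comp (fderiv ℝ X y)) y :=
    (EuclideanSpace.proj (Fin.last n) : Euc (n + 1) →L[ℝ] ℝ).hasFDerivAt.comp y hX
  have h2 : HasFDerivAt (fun z => u (horizontal n (X z)))
      ((fderiv ℝ u (horizontal n (X y))).comp ((horizontal n).comp (fderiv ℝ X y))) y :=
    (h.hasFDerivAt hy).comp y ((horizontal n).hasFDerivAt.comp y hX)
  have h3 : (fun z => X z (Fin.last n)) =ᶠ[𝓝 y] fun z => u (horizontal n (X z)) := by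
    filter_upwards [h.isOpen.mem_nhds hy] with z hz using h.last_eq hz
  exact congrArg (fun L => L w) (h1.unique (h2.congr_of_eventuallyEq h3))

theorem inner_tangent_upNormal (h : GraphImmersion V g X u x₀ r) {y : Euc n} (hy : y ∈ V)
    (w : Euc n) : inner ℝ (fderiv ℝ X y w) (upNormal u (horizontal n (X y))) = 0 := by
  rw [inner_upNormal, h.tangent hy, sub_self]

/-- A tangent vector without horizontal part has no vertical part either, since the latter is du of
the former. -/
theorem injective_horizontal (h : GraphImmersion V g X u x₀ r) {y : Euc n} (hy : y ∈ V) :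
    Function.Injective ((horizontal n).comp (fderiv ℝ X y)).toLinearMap := by
  rw [← LinearMap.ker_eq_bot, LinearMap.ker_eq_bot']
  intro w hw
  have hw' : horizontal n (fderiv ℝ X y w) = 0 := hw
  refine h.immersion.injective y hy ?_
  rw [map_zero]
  refine euc_ext_castSucc (by rw [hw', map_zero]) ?_
  rw [h.tangent hy, hw', map_zero]; rfl

/-- The differential of the horizontal projection, as an equivalence. -/
theorem exists_equiv (h : GraphImmersion V g X u x₀ r) {y : Euc n} (hy : y ∈ V) :
    ∃ L : Euc n ≃L[ℝ] Euc n, (L : Euc n →L[ℝ] Euc n) = (horizontal n).comp (fderiv ℝ X y) :=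
  ⟨(LinearEquiv.ofInjectiveEndo _ (h.injective_horizontal hy)).toContinuousLinearEquiv,
    by ext w; rfl⟩

/-- Pair z with the tangent vector lying over each basis vector of the base. -/
theorem eq_smul_upNormal (h : GraphImmersion V g X u x₀ r) {y : Euc n} (hy : y ∈ V)
    {z : Euc (n + 1)} (hz : ∀ w, inner ℝ z (fderiv ℝ X y w) = 0) :
    z = z (Fin.last n) • upNormal u (horizontal n (X y)) := by
  obtain ⟨L, hL⟩ := h.exists_equiv hy
  refine euc_ext_castSucc ?_ (by simp [upNormal_last])
  ext k
  obtain ⟨w, hw⟩ := L.surjective (basisVec k)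
  have hw' : horizontal n (fderiv ℝ X y w) = basisVec k := by
    rw [← hw]; exact (congrArg (fun L => L w) hL).symm
  have h1 := hz w
  rw [euc_inner_eq, Fin.sum_univ_castSucc, h.tangent hy, hw'] at h1
  have h2 : ∑ i : Fin n, z i.castSucc * fderiv ℝ X y w i.castSucc = z k.castSucc := by
    have : ∀ i : Fin n, fderiv ℝ X y w i.castSucc = basisVec (n := n) k i := fun i => by
      rw [← hw', horizontal_apply]
    simp [this, basisVec]
  rw [h2] at h1
  simp only [horizontal_apply, PiLp.smul_apply, smul_eq_mul, upNormal_castSucc, pderiv]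
  linarith

theorem isUnitNormal (h : GraphImmersion V g X u x₀ r) {y : Euc n} (hy : y ∈ V) :
    IsUnitNormal X y (‖upNormal u (horizontal n (X y))‖⁻¹ • upNormal u (horizontal n (X y))) := by
  set ω := upNormal u (horizontal n (X y)) with hω
  have h0 : ‖ω‖ ≠ 0 := norm_ne_zero_iff.2 (upNormal_ne_zero _ _)
  refine ⟨?_, fun w => ?_, fun z hz => ?_⟩
  · rw [norm_smul, norm_inv, norm_norm, inv_mul_cancel₀ h0]
  · rw [real_inner_smul_right, h.inner_tangent_upNormal hy, mul_zero]
  · have h1 := h.eq_smul_upNormal hy (z := z) fun w => by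
      rw [fderiv_apply_eq_sum, inner_sum]
      exact Finset.sum_eq_zero fun i _ => by
        rw [real_inner_smul_right]; exact mul_eq_zero_of_right _ (hz i)
    rw [← hω] at h1
    have h2 : inner ℝ z ω = z (Fin.last n) * ‖ω‖ ^ 2 := by
      conv_lhs => rw [h1, real_inner_smul_left, real_inner_self_eq_norm_sq]
    rw [real_inner_smul_right, smul_smul, h2]
    conv_lhs => rw [h1]
    congr 1
    field_simp

/-- The horizontal projection is bijective from V to the ball with invertible differential. Its
inverse is thus continuous, and the set is the image of a closed ball. -/
theorem isCompact_preimage (h : GraphImmersion V g X u x₀ r) {R : ℝ} (hR : R < r) :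
    IsCompact {y | y ∈ V ∧ horizontal n (X y) ∈ Metric.closedBall x₀ R} := by
  have hsub : Metric.closedBall x₀ R ⊆ Metric.ball x₀ r := Metric.closedBall_subset_ball hR
  have hex : ∀ x ∈ Metric.ball x₀ r, ∃ y ∈ V, horizontal n (X y) = x := fun x hx => by
    obtain ⟨y, hy, he⟩ := h.bijOn.surjOn ⟨x, hx, rfl⟩
    exact ⟨y, hy, by rw [he, horizontal_graphPoint]⟩
  choose! ψ hψV hψ using hex
  have huniq : ∀ y ∈ V, ψ (horizontal n (X y)) = y := fun y hy => by
    have h1 := h.horizontal_mem hy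
    refine h.bijOn.injOn (hψV _ h1.1) hy ?_
    rw [(h.horizontal_mem (hψV _ h1.1)).2, hψ _ h1.1]
    exact h1.2.symm
  have hcont : ContinuousOn ψ (Metric.closedBall x₀ R) := by
    intro x hx
    have hxb := hsub hx
    refine ContinuousAt.continuousWithinAt ?_
    obtain ⟨L, hL⟩ := h.exists_equiv (hψV x hxb)
    have hs : HasStrictFDerivAt (fun y => horizontal n (X y)) (L : Euc n →L[ℝ] Euc n) (ψ x) := by
      rw [hL]
      exact (horizontal n).hasStrictFDerivAt.comp (ψ x)
        ((h.immersion.contDiffAt h.isOpen (hψV x hxb)).hasStrictFDerivAt (by simp))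
    have hmap := hs.map_nhds_eq_of_equiv
    rw [hψ x hxb] at hmap
    intro O hO
    rw [Filter.mem_map, ← hmap, Filter.mem_map]
    filter_upwards [hO, h.isOpen.mem_nhds (hψV x hxb)] with y hy hyV
    rw [Set.mem_preimage, Set.mem_preimage, huniq y hyV]; exact hy
  have himg : {y | y ∈ V ∧ horizontal n (X y) ∈ Metric.closedBall x₀ R}
      = ψ '' Metric.closedBall x₀ R := by
    ext y
    constructor
    · rintro ⟨hy, hx⟩
      exact ⟨_, hx, huniq y hy⟩
    · rintro ⟨x, hx, rfl⟩
      exact ⟨hψV x (hsub hx), by rw [hψ x (hsub hx)]; exact hx⟩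
  rw [himg]
  exact (isCompact_closedBall x₀ R).image_of_continuousOn hcont

theorem continuousOn_upNormal (h : GraphImmersion V g X u x₀ r) :
    ContinuousOn (fun y => upNormal u (horizontal n (X y))) V := by
  have h1 : ContinuousOn (fun y => horizontal n (X y)) V :=
    (horizontal n).continuous.comp_continuousOn h.immersion.contDiffOn.continuousOn
  have h2 : ContinuousOn (fderiv ℝ u) (Metric.ball x₀ r) :=
    h.contDiffOn.continuousOn_fderiv_of_isOpen Metric.isOpen_ball le_rfl
  have h3 : ContinuousOn (fun y => fderiv ℝ u (horizontal n (X y))) V :=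
    h2.comp h1 fun y hy => (h.horizontal_mem hy).1
  refine (PiLp.continuous_toLp 2 _).comp_continuousOn (continuousOn_pi.2 fun k => ?_)
  refine Fin.lastCases ?_ (fun i => ?_) k
  · simp only [Fin.snoc_last]; exact continuousOn_const
  · simp only [Fin.snoc_castSucc]
    exact (h3.clm_apply continuousOn_const).neg

end GraphImmersion

/-- Used to make the curvature of largest absolute value nonnegative. -/
theorem TangentGraph.neg {X : Euc n → Euc (n + 1)} {y₀ : Euc n} {v : Fin n → Euc n}
    {N : Euc (n + 1)} {κ : Fin n → ℝ} {Y : Euc n → Euc n} {U : Euc n → ℝ}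
    (h : TangentGraph X y₀ v N κ Y U) :
    TangentGraph X y₀ v (-N) (fun a => -κ a) Y (fun ξ => -U ξ) where
  base := h.base
  contDiffAt_param := h.contDiffAt_param
  contDiffAt_height := h.contDiffAt_height.neg
  eq := h.eq.mono fun ξ hξ => by rw [hξ, neg_smul_neg]
  inner_frame := h.inner_frame
  normal := ⟨by rw [norm_neg, h.normal.norm], fun w => by rw [inner_neg_right, h.normal.orth, neg_zero],
    fun z hz => by rw [inner_neg_right, neg_smul_neg]; exact h.normal.span z hz⟩
  second := fun a b => by rw [inner_neg_right, h.second]; split_ifs <;> simp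
  expand := h.expand

end HeinzEstimate

/-! ### The global test function and its maximum -/

namespace HeinzEstimate
open Filter Topology

variable {n : ℕ}

/-- The normal curvature in the direction `w` with respect to the upward normal. -/
noncomputable def normalCurvature (X : Euc n → Euc (n + 1)) (u : Euc n → ℝ) (y w : Euc n) : ℝ :=
  inner ℝ (fderiv ℝ (fderiv ℝ X) y w w) (upNormal u (horizontal n (X y)))
    / (‖upNormal u (horizontal n (X y))‖ * ‖fderiv ℝ X y w‖ ^ 2)

/-- The position of `X y` relative to the point `(x₀, 0)`. -/
noncomputable def relPosition (X : Euc n → Euc (n + 1)) (x₀ y : Euc n) : Euc (n + 1) :=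
  X y - graphPoint (fun _ => 0) x₀

/-- The cut-off function `R² - |x - x₀|²`. -/
noncomputable def cutoff (X : Euc n → Euc (n + 1)) (x₀ : Euc n) (R : ℝ) (y : Euc n) : ℝ :=
  R ^ 2 - ∑ k : Fin n, relPosition X x₀ y k.castSucc ^ 2

/-- The exponent `A |∇u|² / 2 + β S`, where `S = (x - x₀) · ∇u - u`. -/
noncomputable def exponent (X : Euc n → Euc (n + 1)) (u : Euc n → ℝ) (x₀ : Euc n) (A β : ℝ)
    (y : Euc n) : ℝ :=
  A * (1 / 2 * ∑ k, pderiv k u (horizontal n (X y)) ^ 2)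
    + β * -(inner ℝ (relPosition X x₀ y) (upNormal u (horizontal n (X y))))

/-- The global test function. -/
noncomputable def globalTest (X : Euc n → Euc (n + 1)) (u : Euc n → ℝ) (x₀ : Euc n) (R A β : ℝ)
    (y w : Euc n) : ℝ :=
  cutoff X x₀ R y ^ 2 * Real.log (max |normalCurvature X u y w| (Real.exp 1))
    * Real.exp (exponent X u x₀ A β y)

theorem normalCurvature_smul (X : Euc n → Euc (n + 1)) (u : Euc n → ℝ) (y w : Euc n) {c : ℝ}
    (hc : c ≠ 0) : normalCurvature X u y (c • w) = normalCurvature X u y w := by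
  simp only [normalCurvature, map_smul, smul_apply, real_inner_smul_left, norm_smul, mul_pow,
    Real.norm_eq_abs, sq_abs]
  rw [← mul_assoc, ← sq, mul_left_comm, mul_div_mul_left _ _ (pow_ne_zero 2 hc)]

theorem sum_relPosition_sq (X : Euc n → Euc (n + 1)) (x₀ y : Euc n) :
    ∑ k : Fin n, relPosition X x₀ y k.castSucc ^ 2 = ‖horizontal n (X y) - x₀‖ ^ 2 := by
  rw [← real_inner_self_eq_norm_sq, euc_inner_eq]
  refine Finset.sum_congr rfl fun k _ => ?_
  simp [relPosition, horizontal_apply, graphPoint, sq]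

namespace GraphImmersion

variable {V : Set (Euc n)} {g : Euc n → Matrix (Fin n) (Fin n) ℝ} {X : Euc n → Euc (n + 1)}
  {u : Euc n → ℝ} {x₀ : Euc n} {r : ℝ}

/-- All normals at a point are proportional to the upward one, and the quotient is invariant under
scaling up to sign. -/
theorem abs_normalCurvature (h : GraphImmersion V g X u x₀ r) {y : Euc n} (hy : y ∈ V)
    {ν : Euc (n + 1)} (hν : ∀ w, inner ℝ (fderiv ℝ X y w) ν = 0) (h0 : ν ≠ 0) (w : Euc n) :
    |normalCurvature X u y w|
      = |inner ℝ (fderiv ℝ (fderiv ℝ X) y w w) ν| / (‖ν‖ * ‖fderiv ℝ X y w‖ ^ 2) := by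
  have h1 := h.eq_smul_upNormal hy (z := ν) fun w => by rw [real_inner_comm]; exact hν w
  have h2 : ν (Fin.last n) ≠ 0 := fun h2 => h0 (by rw [h1, h2, zero_smul])
  conv_rhs => rw [h1]
  rw [real_inner_smul_right, norm_smul, abs_mul, Real.norm_eq_abs, mul_assoc,
    mul_div_mul_left _ _ (abs_ne_zero.2 h2), normalCurvature, abs_div,
    abs_of_nonneg (a := ‖_‖ * _) (by positivity)]

theorem continuousOn_globalTest (h : GraphImmersion V g X u x₀ r) (R A β : ℝ) :
    ContinuousOn (fun q : Euc n × Euc n => globalTest X u x₀ R A β q.1 q.2) (V ×ˢ {0}ᶜ) := by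
  have hfst : Set.MapsTo (Prod.fst : Euc n × Euc n → Euc n) (V ×ˢ {0}ᶜ) V := fun q hq => hq.1
  have hX := h.immersion.contDiffOn
  have c0 : ContinuousOn (fun q : Euc n × Euc n => X q.1) (V ×ˢ {0}ᶜ) :=
    hX.continuousOn.comp continuousOn_fst hfst
  have d1 : ContDiffOn ℝ 3 (fderiv ℝ X) V := hX.fderiv_of_isOpen h.isOpen (by norm_num)
  have d2 : ContDiffOn ℝ 2 (fderiv ℝ (fderiv ℝ X)) V := d1.fderiv_of_isOpen h.isOpen (by norm_num)
  have c1 : ContinuousOn (fun q : Euc n × Euc n => fderiv ℝ X q.1 q.2) (V ×ˢ {0}ᶜ) :=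
    (d1.continuousOn.comp continuousOn_fst hfst).clm_apply continuousOn_snd
  have c2 : ContinuousOn (fun q : Euc n × Euc n => fderiv ℝ (fderiv ℝ X) q.1 q.2 q.2) (V ×ˢ {0}ᶜ) :=
    ((d2.continuousOn.comp continuousOn_fst hfst).clm_apply continuousOn_snd).clm_apply
      continuousOn_snd
  have c3 : ContinuousOn (fun q : Euc n × Euc n => upNormal u (horizontal n (X q.1))) (V ×ˢ {0}ᶜ) :=
    h.continuousOn_upNormal.comp continuousOn_fst hfst
  have c4 : ContinuousOn (fun q : Euc n × Euc n => normalCurvature X u q.1 q.2) (V ×ˢ {0}ᶜ) := by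
    refine (c2.inner c3).div (c3.norm.mul (c1.norm.pow 2)) fun q hq => ?_
    have h1 : fderiv ℝ X q.1 q.2 ≠ 0 := fun h1 => hq.2
      (h.immersion.injective q.1 hq.1 (by rw [h1, map_zero]))
    have h2 := upNormal_ne_zero u (horizontal n (X q.1))
    exact mul_ne_zero (norm_ne_zero_iff.2 h2) (pow_ne_zero 2 (norm_ne_zero_iff.2 h1))
  have c5 : ContinuousOn (fun q : Euc n × Euc n => relPosition X x₀ q.1) (V ×ˢ {0}ᶜ) :=
    c0.sub continuousOn_const
  have c6 : ∀ {m : ℕ} {F : Euc n × Euc n → Euc m} (k : Fin m), ContinuousOn F (V ×ˢ {0}ᶜ) →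
      ContinuousOn (fun q => F q k) (V ×ˢ {0}ᶜ) := fun k hF =>
    (EuclideanSpace.proj k : Euc _ →L[ℝ] ℝ).continuous.comp_continuousOn hF
  have c7 : ∀ k, ContinuousOn (fun q : Euc n × Euc n => pderiv k u (horizontal n (X q.1)))
      (V ×ˢ {0}ᶜ) := fun k =>
    (c6 k.castSucc c3).neg.congr fun q _ => by simp [upNormal_castSucc]
  refine ContinuousOn.mul (ContinuousOn.mul (ContinuousOn.pow ?_ 2) ?_)
    (Real.continuous_exp.comp_continuousOn (ContinuousOn.add ?_ ?_))
  · exact continuousOn_const.sub (continuousOn_finsetSum _ fun k _ => (c6 _ c5).pow 2)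
  · exact (c4.abs.sup continuousOn_const).log fun q _ =>
      ((Real.exp_pos 1).trans_le (le_max_right _ _)).ne'
  · exact continuousOn_const.mul (continuousOn_const.mul
      (continuousOn_finsetSum _ fun k _ => (c7 k).pow 2))
  · exact continuousOn_const.mul (c5.inner c3).neg

/-- The global test function attains its maximum. -/
theorem exists_globalTest_max (h : GraphImmersion V g X u x₀ r) {R : ℝ} (hR : R < r) (A β : ℝ)
    {y w : Euc n} (hy : y ∈ V) (hyR : horizontal n (X y) ∈ Metric.closedBall x₀ R) (hw : w ≠ 0) :
    ∃ y₁ w₁, y₁ ∈ V ∧ horizontal n (X y₁) ∈ Metric.closedBall x₀ R ∧ w₁ ≠ 0 ∧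
      ∀ z ∈ V, horizontal n (X z) ∈ Metric.closedBall x₀ R → ∀ w, w ≠ 0 →
        globalTest X u x₀ R A β z w ≤ globalTest X u x₀ R A β y₁ w₁ := by
  have hnorm : ∀ w : Euc n, w ≠ 0 → ‖w‖⁻¹ • w ∈ Metric.sphere (0 : Euc n) 1 := fun w hw => by
    rw [mem_sphere_zero_iff_norm, norm_smul, norm_inv, norm_norm,
      inv_mul_cancel₀ (norm_ne_zero_iff.2 hw)]
  have hne : ∀ w ∈ Metric.sphere (0 : Euc n) 1, w ≠ 0 := fun w hw h0 => by
    rw [h0] at hw; simp at hw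
  -- Normal curvature is homogeneous of degree zero in w, so directions may be taken on the compact
  -- unit sphere.
  obtain ⟨q, hq, hmax⟩ := ((h.isCompact_preimage hR).prod (isCompact_sphere (0 : Euc n) 1)).exists_isMaxOn
    ⟨(y, ‖w‖⁻¹ • w), ⟨hy, hyR⟩, hnorm w hw⟩
    ((h.continuousOn_globalTest R A β).mono fun q hq => ⟨hq.1.1, hne _ hq.2⟩)
  refine ⟨q.1, q.2, hq.1.1, hq.1.2, hne _ hq.2, fun z hz hzR w hw => ?_⟩
  have h1 := isMaxOn_iff.1 hmax (z, ‖w‖⁻¹ • w) ⟨⟨hz, hzR⟩, hnorm w hw⟩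
  have h2 : globalTest X u x₀ R A β z (‖w‖⁻¹ • w) = globalTest X u x₀ R A β z w := by
    rw [globalTest, globalTest, normalCurvature_smul X u z w (inv_ne_zero (norm_ne_zero_iff.2 hw))]
  exact h2.symm.trans_le h1

end GraphImmersion

namespace TangentGraph

variable {V : Set (Euc n)} {g : Euc n → Matrix (Fin n) (Fin n) ℝ} {X : Euc n → Euc (n + 1)}
  {u : Euc n → ℝ} {x₀ : Euc n} {r : ℝ} {y₀ : Euc n} {v : Fin n → Euc n} {N : Euc (n + 1)}
  {κ : Fin n → ℝ} {Y : Euc n → Euc n} {U : Euc n → ℝ}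

theorem normal_ne_zero (h : TangentGraph X y₀ v N κ Y U) : N ≠ 0 := fun h0 => by
  have := h.normal.norm
  rw [h0, norm_zero] at this
  exact zero_ne_one this

theorem abs_normalCurvature_frame (h : TangentGraph X y₀ v N κ Y U)
    (hG : GraphImmersion V g X u x₀ r) (hy : y₀ ∈ V) (a : Fin n) :
    |normalCurvature X u y₀ (v a)| = |κ a| := by
  rw [hG.abs_normalCurvature hy h.normal.orth h.normal_ne_zero, h.second, if_pos rfl, h.normal.norm,
    show ‖fderiv ℝ X y₀ (v a)‖ = 1 from h.norm_frame a]
  norm_num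

/-- In the principal frame the normal curvature is a weighted mean of the κ_a. -/
theorem abs_normalCurvature_le (h : TangentGraph X y₀ v N κ Y U)
    (hG : GraphImmersion V g X u x₀ r) (hy : y₀ ∈ V) {L : ℝ} (hL : ∀ a, |κ a| ≤ L) {w : Euc n}
    (hw : w ≠ 0) : |normalCurvature X u y₀ w| ≤ L := by
  set c : Fin n → ℝ := fun a => inner ℝ (fderiv ℝ X y₀ w) (fderiv ℝ X y₀ (v a)) with hc
  have hwc : w = ∑ a, c a • v a := h.expand w
  have h1 : inner ℝ (fderiv ℝ (fderiv ℝ X) y₀ w w) N = ∑ a, κ a * c a ^ 2 := by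
    conv_lhs => rw [hwc]
    simp only [map_sum, map_smul, sum_apply, smul_apply, sum_inner, real_inner_smul_left, h.second]
    simp only [mul_ite, mul_zero, Finset.sum_ite_eq', Finset.mem_univ, if_true]
    exact Finset.sum_congr rfl fun a _ => by ring
  have h2 : ‖fderiv ℝ X y₀ w‖ ^ 2 = ∑ a, c a ^ 2 := by
    have h3 : fderiv ℝ X y₀ w = ∑ a, c a • fderiv ℝ X y₀ (v a) := by
      conv_lhs => rw [hwc]
      simp
    rw [← real_inner_self_eq_norm_sq]
    conv_lhs => enter [3]; rw [h3]
    simp only [inner_sum, real_inner_smul_right, sq]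
    rfl
  have hpos : 0 < ‖fderiv ℝ X y₀ w‖ ^ 2 := by
    have : fderiv ℝ X y₀ w ≠ 0 := fun h1 => hw
      (hG.immersion.injective y₀ hy (by rw [h1, map_zero]))
    positivity
  rw [hG.abs_normalCurvature hy h.normal.orth h.normal_ne_zero, h1, h.normal.norm, one_mul,
    div_le_iff₀ hpos, h2, Finset.mul_sum]
  refine (Finset.abs_sum_le_sum_abs _ _).trans (Finset.sum_le_sum fun a _ => ?_)
  rw [abs_mul, abs_of_nonneg (sq_nonneg (c a))]
  exact mul_le_mul_of_nonneg_right (hL a) (sq_nonneg _)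

/-- Along the direction field ∂_i Y the normal curvature is U_ii/(√(1 + |∇U|²)(1 + U_i²)) in
absolute value. It exceeds e at the centre, so nearby the `max` is inactive and the expression is
smooth. A maximum over all directions is thereby tested by one smooth function. -/
theorem eventually_globalTest (h : TangentGraph X y₀ v N κ Y U)
    (hG : GraphImmersion V g X u x₀ r) (hy : y₀ ∈ V) (R A β : ℝ) {i : Fin n}
    (hi : Real.exp 1 < κ i) (hR : 0 < cutoff X x₀ R y₀) :
    ∀ᶠ ξ in 𝓝 (0 : Euc n), Y ξ ∈ V ∧ 0 < cutoff X x₀ R (Y ξ) ∧ vderiv i Y ξ ≠ 0 ∧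
      globalTest X u x₀ R A β (Y ξ) (vderiv i Y ξ)
        = Real.exp (testFunction X y₀ v N U (relPosition X x₀ y₀) R A β i ξ) := by
  have hX := hG.immersion.contDiffAt hG.isOpen hy
  have hYt : Tendsto Y (𝓝 0) (𝓝 y₀) := by
    have := h.contDiffAt_param.continuousAt.tendsto
    rwa [h.base] at this
  have hpos : 0 < κ i := (Real.exp_pos 1).trans hi
  have hcut : ContinuousAt (cutoff X x₀ R) y₀ := by
    have c5 : ContinuousAt (fun y => relPosition X x₀ y) y₀ := hX.continuousAt.sub continuousAt_const
    refine continuousAt_const.sub (tendsto_finsetSum _ fun k _ => ?_)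
    exact ((EuclideanSpace.proj k.castSucc : Euc _ →L[ℝ] ℝ).continuous.continuousAt.comp c5).pow 2
  have hUii : ContinuousAt (pderiv i (pderiv i U)) 0 :=
    (contDiffAt_pderiv (m := 2) (contDiffAt_pderiv (m := 3) h.contDiffAt_height (by norm_num) i)
      (by norm_num) i).continuousAt
  have hUi : ∀ a, ContinuousAt (pderiv a U) 0 := fun a =>
    (contDiffAt_pderiv (m := 3) h.contDiffAt_height (by norm_num) a).continuousAt
  have h0 : pderiv i (pderiv i U) 0 = κ i := by rw [h.second_height_zero hX, if_pos rfl]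
  have hA0 : areaSq U 0 = 1 := by simp [areaSq, h.pderiv_height_zero hX]
  have hAc : ContinuousAt (areaSq U) 0 :=
    continuousAt_const.add (tendsto_finsetSum _ fun a _ => (hUi a).pow 2)
  have hq : ∀ᶠ ξ in 𝓝 (0 : Euc n), Real.exp 1 <
      pderiv i (pderiv i U) ξ / (√(areaSq U ξ) * (1 + pderiv i U ξ ^ 2)) := by
    have hc : ContinuousAt (fun ξ => pderiv i (pderiv i U) ξ
        / (√(areaSq U ξ) * (1 + pderiv i U ξ ^ 2))) 0 := by
      refine hUii.div (hAc.sqrt.mul (continuousAt_const.add ((hUi i).pow 2))) ?_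
      have := Real.sqrt_pos.2 (areaSq_pos U 0)
      positivity
    refine hc.eventually (lt_mem_nhds ?_)
    beta_reduce
    rw [h0, hA0, h.pderiv_height_zero hX]
    simpa using hi
  filter_upwards [h.eventually_tangent hX, h.eventually_second hX, h.eventually_normal hX, h.eq,
    hYt.eventually (hG.isOpen.mem_nhds hy), hYt.eventually (hcut.eventually (lt_mem_nhds hR)),
    hUii.eventually (lt_mem_nhds (h0 ▸ hpos : 0 < pderiv i (pderiv i U) 0)), hq]
    with ξ h1 h2 h33 h4 h5 h6 h7 h8
  have h3 := h33.1
  obtain ⟨i1, i2, i3⟩ := h.inner_conormal ξ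
  set ω := conormal X y₀ v N U ξ with hω
  have hAp := areaSq_pos U ξ
  have hW := Real.sqrt_pos.2 hAp
  have hω0 : ω ≠ 0 := fun h0 => by rw [h0, inner_zero_right] at i2; exact zero_ne_one i2
  have hωn : ‖ω‖ = √(areaSq U ξ) := by rw [← i3, norm_eq_sqrt_real_inner]
  have hωe := hG.eq_smul_upNormal h5 (z := ω) fun w => by rw [real_inner_comm]; exact h3 w
  have hl0 : ω (Fin.last n) ≠ 0 := fun h0 => hω0 (by rw [hωe, h0, zero_smul])
  have hup : upNormal u (horizontal n (X (Y ξ))) = (ω (Fin.last n))⁻¹ • ω := by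
    conv_rhs => enter [2]; rw [hωe]
    rw [smul_smul, inv_mul_cancel₀ hl0, one_smul]
  have hrel : relPosition X x₀ (Y ξ) = position X y₀ v N U (relPosition X x₀ y₀) ξ := by
    simp only [relPosition, position, h4, frame]; abel
  have hT : ‖fderiv ℝ X (Y ξ) (vderiv i Y ξ)‖ ^ 2 = 1 + pderiv i U ξ ^ 2 := by
    rw [h1 i, ← real_inner_self_eq_norm_sq]
    simp only [inner_add_left, inner_add_right, real_inner_smul_left, real_inner_smul_right,
      h.inner_frame, h.inner_normal_self, h.inner_frame_normal, real_inner_comm _ N, if_true]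
    ring
  have hcurv : |normalCurvature X u (Y ξ) (vderiv i Y ξ)|
      = pderiv i (pderiv i U) ξ / (√(areaSq U ξ) * (1 + pderiv i U ξ ^ 2)) := by
    rw [hG.abs_normalCurvature h5 h3 hω0, hT, hωn]
    have e2 := congrArg (fun z => inner ℝ z ω) (h2 i i)
    simp only [inner_add_left, h3, add_zero, real_inner_smul_left, i2, mul_one] at e2
    rw [e2, abs_of_pos h7]
  have hlog : Real.log (max |normalCurvature X u (Y ξ) (vderiv i Y ξ)| (Real.exp 1))
      = logCurvature U i ξ := by
    have hp : 0 < 1 + pderiv i U ξ ^ 2 := by positivity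
    rw [hcurv, max_eq_left h8.le, Real.log_div h7.ne' (by positivity),
      Real.log_mul hW.ne' hp.ne', Real.log_sqrt hAp.le, logCurvature]
    ring
  have hlog1 : 0 < logCurvature U i ξ := by
    rw [← hlog]
    exact Real.log_pos (lt_of_lt_of_le (by simp) (le_max_right _ _))
  have hexp : exponent X u x₀ A β (Y ξ) = A * (1 / 2 * ∑ k, slope X y₀ v N U k ξ ^ 2)
      + β * support X y₀ v N U (relPosition X x₀ y₀) ξ := by
    have e1 : ∀ k : Fin n, pderiv k u (horizontal n (X (Y ξ))) = slope X y₀ v N U k ξ := fun k => by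
      have := congrArg (fun z : Euc (n + 1) => z k.castSucc) hup
      simp only [upNormal_castSucc, PiLp.smul_apply, smul_eq_mul] at this
      rw [slope, ← hω]
      field_simp at this ⊢
      linarith
    have e2 : -(inner ℝ (relPosition X x₀ (Y ξ)) (upNormal u (horizontal n (X (Y ξ)))))
        = support X y₀ v N U (relPosition X x₀ y₀) ξ := by
      rw [hup, real_inner_smul_right, euc_inner_eq, hrel, support, ← hω]
      field_simp
    rw [exponent, e2]
    simp only [e1]
  refine ⟨h5, h6, fun h0 => ?_, ?_⟩
  · rw [h0, map_zero, norm_zero] at hT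
    nlinarith [sq_nonneg (pderiv i U ξ)]
  · have hcutp : cutoff X x₀ R (Y ξ) = R ^ 2 - ∑ k : Fin n,
        position X y₀ v N U (relPosition X x₀ y₀) ξ k.castSucc ^ 2 := by rw [cutoff, hrel]
    rw [globalTest, hlog, hexp, testFunction, ← hcutp]
    simp only [Real.exp_add, two_mul, Real.exp_log hlog1, Real.exp_log h6]
    ring

end TangentGraph
end HeinzEstimate

/-! ### From the maximum to the curvature bound -/

namespace HeinzEstimate
open Filter Topology

variable {n : ℕ}

theorem norm_relPosition_le {X : Euc n → Euc (n + 1)} {x₀ y : Euc n} {r K : ℝ}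
    (hx : ‖horizontal n (X y) - x₀‖ ≤ r) (hl : |X y (Fin.last n)| ≤ K) :
    ‖relPosition X x₀ y‖ ≤ r + K := by
  have h1 : ‖relPosition X x₀ y‖ ^ 2 = ‖horizontal n (X y) - x₀‖ ^ 2 + X y (Fin.last n) ^ 2 := by
    rw [← sum_relPosition_sq, ← real_inner_self_eq_norm_sq, euc_inner_eq, Fin.sum_univ_castSucc]
    simp [relPosition, graphPoint_last, sq]
  have h2 : X y (Fin.last n) ^ 2 ≤ K ^ 2 := sq_le_sq' (abs_le.1 hl).1 (abs_le.1 hl).2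
  have h3 : ‖horizontal n (X y) - x₀‖ ^ 2 ≤ r ^ 2 := pow_le_pow_left₀ (norm_nonneg _) hx 2
  have hr : 0 ≤ r := (norm_nonneg _).trans hx
  have hK : 0 ≤ K := (abs_nonneg _).trans hl
  refine le_of_sq_le_sq ?_ (by positivity)
  nlinarith [mul_nonneg hr hK]

namespace GraphImmersion

variable {V : Set (Euc n)} {g : Euc n → Matrix (Fin n) (Fin n) ℝ} {X : Euc n → Euc (n + 1)}
  {u : Euc n → ℝ} {x₀ : Euc n} {r K M : ℝ}

theorem norm_bounds (h : GraphImmersion V g X u x₀ r) (hu : C1Bound (Metric.ball x₀ r) u K)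
    (hM : 1 + |K| + r ≤ M) (hr : 0 < r) {y : Euc n} (hy : y ∈ V) :
    ‖relPosition X x₀ y‖ ≤ M ∧ ‖upNormal u (horizontal n (X y))‖ ≤ M := by
  have h1 := (h.horizontal_mem hy).1
  have hK := le_abs_self K
  constructor
  · have h2 : |X y (Fin.last n)| ≤ K := by rw [h.last_eq hy]; exact hu.abs_le _ h1
    have h3 : ‖horizontal n (X y) - x₀‖ ≤ r := (mem_ball_iff_norm.1 h1).le
    linarith [norm_relPosition_le h3 h2]
  · linarith [norm_upNormal_le (hu.grad_le _ h1)]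

theorem abs_exponent_le (h : GraphImmersion V g X u x₀ r) (hu : C1Bound (Metric.ball x₀ r) u K)
    (hM : 1 + |K| + r ≤ M) (hr : 0 < r) {A β : ℝ} (hA : 0 ≤ A) (hβ : 0 ≤ β) {y : Euc n} (hy : y ∈ V) :
    |exponent X u x₀ A β y| ≤ A * M ^ 2 + β * M ^ 2 := by
  obtain ⟨h1, h2⟩ := h.norm_bounds hu hM hr hy
  have hM0 : 0 ≤ M := (norm_nonneg _).trans h1
  have h3 : ∑ k, pderiv k u (horizontal n (X y)) ^ 2 ≤ M ^ 2 := by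
    refine le_trans ?_ (pow_le_pow_left₀ (norm_nonneg _) h2 2)
    rw [← real_inner_self_eq_norm_sq, euc_inner_eq, Fin.sum_univ_castSucc, upNormal_last]
    simp only [upNormal_castSucc, ← sq, neg_sq]
    linarith
  have h4 : 0 ≤ ∑ k, pderiv k u (horizontal n (X y)) ^ 2 := Finset.sum_nonneg fun _ _ => sq_nonneg _
  refine (abs_add_le _ _).trans (add_le_add ?_ ?_)
  · rw [abs_of_nonneg (by positivity)]
    exact mul_le_mul_of_nonneg_left (by linarith) hA
  · rw [abs_mul, abs_of_nonneg hβ, abs_neg]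
    refine mul_le_mul_of_nonneg_left ((abs_real_inner_le_norm _ _).trans ?_) hβ
    rw [sq]; exact mul_le_mul h1 h2 (norm_nonneg _) hM0

end GraphImmersion

theorem IsPrincipalCurvature.exists_normalCurvature {V : Set (Euc n)}
    {g : Euc n → Matrix (Fin n) (Fin n) ℝ} {X : Euc n → Euc (n + 1)} {u : Euc n → ℝ} {x₀ : Euc n}
    {r : ℝ} (h : GraphImmersion V g X u x₀ r) {y : Euc n} (hy : y ∈ V) {κ : ℝ}
    (hκ : IsPrincipalCurvature X y κ) : ∃ w, w ≠ 0 ∧ |normalCurvature X u y w| = |κ| := by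
  obtain ⟨ν, hν, horth, w, hw, he⟩ := hκ
  refine ⟨w, hw, ?_⟩
  have hne : fderiv ℝ X y w ≠ 0 := fun h1 => hw
    (h.immersion.injective y hy (by rw [h1, map_zero]))
  have hpos : 0 < ‖fderiv ℝ X y w‖ ^ 2 := by positivity
  rw [h.abs_normalCurvature hy horth (fun h0 => by rw [h0, norm_zero] at hν; exact zero_ne_one hν),
    he, hν, one_mul, real_inner_self_eq_norm_sq, abs_mul, abs_of_pos hpos,
    mul_div_cancel_right₀ _ hpos.ne']

theorem cutoff_nonneg {X : Euc n → Euc (n + 1)} {x₀ y : Euc n} {R : ℝ}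
    (h : horizontal n (X y) ∈ Metric.closedBall x₀ R) : 0 ≤ cutoff X x₀ R y := by
  rw [cutoff, sum_relPosition_sq, sub_nonneg]
  exact pow_le_pow_left₀ (norm_nonneg _) (mem_closedBall_iff_norm.1 h) 2

/-- A bound for the global test function at its maximum. -/
theorem exists_globalTest_bound (n : ℕ) (r Λ δ K : ℝ) (hr : 0 < r) (hδ : 0 < δ) :
    ∃ A β T : ℝ, 0 ≤ A ∧ 0 ≤ β ∧ ∀ (x₀ : Euc n) (V : Set (Euc n))
      (g : Euc n → Matrix (Fin n) (Fin n) ℝ) (X : Euc n → Euc (n + 1)) (u : Euc n → ℝ),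
      GraphImmersion V g X u x₀ r → MetricC4Bound V g Λ →
      (∀ y ∈ V, δ ≤ scalarCurvature g y) → C1Bound (Metric.ball x₀ r) u K →
      ∀ y ∈ V, horizontal n (X y) ∈ Metric.closedBall x₀ (3 * r / 4) → ∀ w, w ≠ 0 →
        globalTest X u x₀ (3 * r / 4) A β y w ≤ T := by
  -- Any radius strictly between r/2 and r would serve: the closed ball is compact inside the
  -- domain, and the cut-off is bounded below on the half ball.
  set R := 3 * r / 4 with hRd
  have hR : 0 < R := by positivity
  have hRr : R < r := by rw [hRd]; linarith
  set M := 1 + |K| + r with hMd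
  have hM : 1 ≤ M := by rw [hMd]; linarith [abs_nonneg K]
  obtain ⟨A, β, lam₀, B, hA, hβ, hmain⟩ := FramedPoint.exists_cutoff_mul_log_le n Λ hδ hR hM
  set Q := A * M ^ 2 + β * M ^ 2 with hQ
  set L := max lam₀ (Real.exp 1) with hL
  have hL1 : 0 < Real.log L :=
    Real.log_pos (lt_of_lt_of_le (by simp) (le_max_right _ _))
  refine ⟨A, β, R ^ 4 * Real.log L * Real.exp Q + R ^ 2 * |B| * Real.exp Q, hA, hβ,
    fun x₀ V g X u hG hg hscal hu y hy hyR w hw => ?_⟩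
  obtain ⟨y₁, w₁, hy₁, hy₁R, hw₁, hmax⟩ := hG.exists_globalTest_max hRr A β hy hyR hw
  refine (hmax y hy hyR w hw).trans ?_
  obtain ⟨hb1, hb2⟩ := hG.norm_bounds hu le_rfl hr hy₁
  have hexpQ : Real.exp (exponent X u x₀ A β y₁) ≤ Real.exp Q :=
    Real.exp_le_exp.2 ((le_abs_self _).trans (hG.abs_exponent_le hu le_rfl hr hA hβ hy₁))
  have hcut0 := cutoff_nonneg hy₁R
  have hcutR : cutoff X x₀ R y₁ ≤ R ^ 2 := by
    rw [cutoff, sum_relPosition_sq]; linarith [sq_nonneg ‖horizontal n (X y₁) - x₀‖]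
  have hN := hG.isUnitNormal hy₁
  obtain ⟨v, κ', Y, U', hT'⟩ := exists_tangentGraph (hG.immersion.contDiffAt hG.isOpen hy₁)
    (hG.immersion.injective y₁ hy₁) hN
  -- A nonzero w exists only for n ≥ 1, so a largest curvature can be chosen.
  have hne : (Finset.univ : Finset (Fin n)).Nonempty := by
    rw [Finset.univ_nonempty_iff]
    by_contra hcon
    rw [not_nonempty_iff] at hcon
    exact hw (by ext i; exact hcon.elim i)
  obtain ⟨i₀, -, hi₀⟩ := Finset.exists_max_image Finset.univ (fun a => |κ' a|) hne
  have hex : ∃ N κ U, TangentGraph X y₁ v N κ Y U ∧ 0 ≤ κ i₀ ∧ (∀ a, |κ a| ≤ κ i₀) ∧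
      1 ≤ M * |N (Fin.last n)| := by
    have hNl : 1 ≤ M * |(‖upNormal u (horizontal n (X y₁))‖⁻¹ • upNormal u (horizontal n (X y₁)))
        (Fin.last n)| := by
      have h0 : 0 < ‖upNormal u (horizontal n (X y₁))‖ := norm_pos_iff.2 (upNormal_ne_zero _ _)
      rw [PiLp.smul_apply, upNormal_last, smul_eq_mul, mul_one, abs_of_pos (inv_pos.2 h0),
        ← div_eq_mul_inv, one_le_div h0]
      exact hb2
    rcases le_total 0 (κ' i₀) with hs | hs
    · exact ⟨_, κ', U', hT', hs, fun a => by
        rw [← abs_of_nonneg hs]; exact hi₀ a (Finset.mem_univ a), hNl⟩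
    · refine ⟨_, _, _, hT'.neg, by linarith, fun a => ?_, ?_⟩
      · rw [abs_neg, ← abs_of_nonpos hs]; exact hi₀ a (Finset.mem_univ a)
      · rw [PiLp.neg_apply, abs_neg]; exact hNl
  clear hi₀ hT' hN
  obtain ⟨N, κ, U, hT, hκ0, hκ, hNl⟩ := hex
  have hval : ∀ w, w ≠ 0 → globalTest X u x₀ R A β y₁ w ≤ cutoff X x₀ R y₁ ^ 2 *
      Real.log (max (κ i₀) (Real.exp 1)) * Real.exp (exponent X u x₀ A β y₁) := fun w hw => by
    refine mul_le_mul_of_nonneg_right (mul_le_mul_of_nonneg_left ?_ (sq_nonneg _)) (Real.exp_pos _).le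
    exact Real.log_le_log ((Real.exp_pos 1).trans_le (le_max_right _ _))
      (max_le_max (hT.abs_normalCurvature_le hG hy₁ hκ hw) le_rfl)
  have hexp0 := (Real.exp_pos (exponent X u x₀ A β y₁)).le
  have hexpQ0 := (Real.exp_pos Q).le
  rcases le_or_gt (κ i₀) L with hcase | hcase
  · have h1 : Real.log (max (κ i₀) (Real.exp 1)) ≤ Real.log L :=
      Real.log_le_log ((Real.exp_pos 1).trans_le (le_max_right _ _))
        (max_le hcase (le_max_right _ _))
    have h2 : cutoff X x₀ R y₁ ^ 2 ≤ R ^ 4 := by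
      have := pow_le_pow_left₀ hcut0 hcutR 2
      calc _ ≤ _ := this
        _ = R ^ 4 := by ring
    have h3 : cutoff X x₀ R y₁ ^ 2 * Real.log (max (κ i₀) (Real.exp 1)) ≤ R ^ 4 * Real.log L :=
      (mul_le_mul_of_nonneg_left h1 (sq_nonneg _)).trans (mul_le_mul_of_nonneg_right h2 hL1.le)
    have h4 := mul_le_mul h3 hexpQ hexp0 (mul_nonneg (by positivity) hL1.le)
    have h5 : 0 ≤ R ^ 2 * |B| * Real.exp Q := by positivity
    linarith [hval w₁ hw₁]
  · have hle : Real.exp 1 < κ i₀ := (le_max_right _ _).trans_lt hcase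
    have hll : lam₀ ≤ κ i₀ := (le_max_left _ _).trans hcase.le
    have hlog : 0 ≤ Real.log (κ i₀) := Real.log_nonneg (by
      have : (1 : ℝ) < Real.exp 1 := by simp
      linarith)
    have hval1 := hval w₁ hw₁
    rw [max_eq_left hle.le] at hval1
    -- The pointwise estimate controls one power of the cut-off times the logarithm; the second
    -- power is at most R². On the boundary, where the cut-off vanishes, nothing is to be shown.
    have hkey : cutoff X x₀ R y₁ * Real.log (κ i₀) ≤ |B| := by
      rcases hcut0.eq_or_lt with hz | hpos
      · rw [← hz, zero_mul]; exact abs_nonneg B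
      · refine le_trans ?_ (le_abs_self B)
        let p : FramedPoint n Λ := ⟨V, g, X, y₁, v, N, κ, Y, U, hG.isOpen, hg, hG.immersion, hy₁, hT⟩
        refine hmain p (relPosition X x₀ y₁) i₀ (hscal y₁ hy₁) hNl hb1 hll
          (by rw [cutoff] at hpos; linarith) fun c => ?_
        have hev := hT.eventually_globalTest hG hy₁ R A β hle hpos
        have hev0 := hev.self_of_nhds
        -- The maximizing w₁ may be replaced by the principal direction of i₀, as no direction has
        -- larger normal curvature. So exp of the test function attains the global maximum at ξ = 0.
        have htop : globalTest X u x₀ R A β y₁ w₁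
            ≤ Real.exp (TangentGraph.testFunction X y₁ v N U (relPosition X x₀ y₁) R A β i₀ 0) := by
          rw [← hev0.2.2.2, hT.base, hT.vderiv_param_zero (hG.immersion.contDiffAt hG.isOpen hy₁)]
          refine (hval w₁ hw₁).trans (le_of_eq ?_)
          rw [globalTest, hT.abs_normalCurvature_frame hG hy₁, abs_of_nonneg hκ0]
        filter_upwards [(tendsto_line (0 : Euc n) c).eventually hev] with t ht
        have hin : horizontal n (X (Y (0 + t • basisVec c))) ∈ Metric.closedBall x₀ R := by
          rw [mem_closedBall_iff_norm]
          have h2 := ht.2.1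
          rw [cutoff, sum_relPosition_sq] at h2
          exact le_of_sq_le_sq (by linarith) hR.le
        have h3 := (hmax _ ht.1 hin _ ht.2.2.1).trans htop
        rw [ht.2.2.2, Real.exp_le_exp] at h3
        simpa using h3
    have h3 : cutoff X x₀ R y₁ ^ 2 * Real.log (κ i₀) ≤ R ^ 2 * |B| := by
      calc _ = cutoff X x₀ R y₁ * (cutoff X x₀ R y₁ * Real.log (κ i₀)) := by ring
        _ ≤ _ := mul_le_mul hcutR hkey (mul_nonneg hcut0 hlog) (by positivity)
    have h4 := mul_le_mul h3 hexpQ hexp0 (by positivity)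
    have h5 : 0 ≤ R ^ 4 * Real.log L * Real.exp Q := by positivity
    linarith

end HeinzEstimate

theorem theorem1 (n : ℕ) (r Λ δ K : ℝ) (hr : 0 < r) (hδ : 0 < δ) :
    ∃ C : ℝ, ∀ (x₀ : HeinzEstimate.Euc n) (V : Set (HeinzEstimate.Euc n))
      (g : HeinzEstimate.Euc n → Matrix (Fin n) (Fin n) ℝ)
      (X : HeinzEstimate.Euc n → HeinzEstimate.Euc (n + 1)) (u : HeinzEstimate.Euc n → ℝ),
      IsOpen V →
      HeinzEstimate.MetricC4Bound V g Λ →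
      HeinzEstimate.IsIsometricImmersion V g X →
      (∀ y ∈ V, δ ≤ HeinzEstimate.scalarCurvature g y) →
      HeinzEstimate.C1Bound (Metric.ball x₀ r) u K →
      Set.BijOn X V (HeinzEstimate.graphPoint u '' Metric.ball x₀ r) →
      ∀ x ∈ Metric.closedBall x₀ (r / 2), ∀ y ∈ V, X y = HeinzEstimate.graphPoint u x →
        ∀ κ : ℝ, HeinzEstimate.IsPrincipalCurvature X y κ → |κ| ≤ C := by
  open HeinzEstimate in
  obtain ⟨A, β, T, hA, hβ, hT⟩ := exists_globalTest_bound n r Λ δ K hr hδ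
  set M := 1 + |K| + r with hM
  set Q := A * M ^ 2 + β * M ^ 2 with hQ
  -- On the half ball the cut-off is at least (9/16 - 1/4) r² = 5r²/16, and the exponential factor
  -- is at least e^{-Q}. The bound T on the test function then bounds log |κ|.
  refine ⟨Real.exp (T * Real.exp Q / (5 * r ^ 2 / 16) ^ 2),
    fun x₀ V g X u hV hg hX hscal hu hbij x hx y hy hxy κ hκ => ?_⟩
  have hG : GraphImmersion V g X u x₀ r := ⟨hV, hX, hu.contDiffOn, hbij⟩
  have hhor : horizontal n (X y) = x := by rw [hxy, horizontal_graphPoint]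
  obtain ⟨w, hw, hwκ⟩ := hκ.exists_normalCurvature hG hy
  have hx' : ‖x - x₀‖ ≤ r / 2 := mem_closedBall_iff_norm.1 hx
  have h1 := hT x₀ V g X u hG hg hscal hu y hy
    (by rw [hhor, mem_closedBall_iff_norm]; linarith) w hw
  have hcut : 5 * r ^ 2 / 16 ≤ cutoff X x₀ (3 * r / 4) y := by
    rw [cutoff, sum_relPosition_sq, hhor]
    have := pow_le_pow_left₀ (norm_nonneg _) hx' 2
    nlinarith
  have hexp : (Real.exp Q)⁻¹ ≤ Real.exp (exponent X u x₀ A β y) := by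
    rw [← Real.exp_neg, Real.exp_le_exp]
    exact (abs_le.1 (hG.abs_exponent_le hu le_rfl hr hA hβ hy)).1
  rw [globalTest, hwκ] at h1
  set l := Real.log (max |κ| (Real.exp 1)) with hl
  have hmax : 0 < max |κ| (Real.exp 1) := (Real.exp_pos 1).trans_le (le_max_right _ _)
  have hl0 : 0 ≤ l := Real.log_nonneg (by
    have : (1 : ℝ) ≤ Real.exp 1 := by simp
    exact this.trans (le_max_right _ _))
  have h2 : (5 * r ^ 2 / 16) ^ 2 * l * (Real.exp Q)⁻¹ ≤ T := by
    refine le_trans (mul_le_mul (mul_le_mul_of_nonneg_right (pow_le_pow_left₀ (by positivity) hcut 2)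
      hl0) hexp (inv_nonneg.2 (Real.exp_pos Q).le) (mul_nonneg (sq_nonneg _) hl0)) h1
  have h3 : l ≤ T * Real.exp Q / (5 * r ^ 2 / 16) ^ 2 := by
    rw [le_div_iff₀ (by positivity)]
    rw [← div_eq_mul_inv, div_le_iff₀ (Real.exp_pos Q)] at h2
    linarith
  calc |κ| ≤ max |κ| (Real.exp 1) := le_max_left _ _
    _ = Real.exp l := (Real.exp_log hmax).symm
    _ ≤ _ := Real.exp_le_exp.2 h3
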